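/- Theorem. Fix countably infinite sets of atoms, agents and skills. Let $\mathcal L_{CDEF+-=\equiv}$ be the language $$\varphi ::= p \mid \neg\varphi \mid (\varphi\to\varphi) \mid K_a\varphi \mid C_G\varphi \mid D_G\varphi \mid E_G\varphi \mid F_G\varphi \mid (+_S)_a\varphi \mid (-_S)_a\varphi \mid (=_S)_a\varphi \mid (\equiv_b)_a\varphi ,$$ where $p$ is an atom, $a,b$ are agents, $G$ is a finite nonempty set of agents and $S$ is a finite nonempty set of skills. A sublanguage is obtained by keeping only some of the eight kinds of operators $C,D,E,F,+,-,=,\equiv$ (atoms, $\neg$, $\to$ and $K_a$ are always kept). A model $M=(W,E,C,\beta)$ consists of a nonempty set $W$ of worlds, a function $E$ from $W\times W$ to sets of skills with $E(w,u)=E(u,w)$, and with $w=u$ whenever $E(w,u)$ is the set of all skills, a function $C$ from agents to sets of skills, and a function $\beta$ from $W$ to sets of atoms. Truth is defined by: - $M,w\models p$ iff $p\in\beta(w)$; negation and implication are classical; - $M,w\models K_a\psi$ iff $M,u\models\psi$ for all $u\in W$ with $C(a)\subseteq E(w,u)$; - $M,w\models D_G\psi$ (respectively $F_G\psi$) iff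 $M,u\models\psi$ for all $u\in W$ with $\bigcup_{a\in G}C(a)\subseteq E(w,u)$ (respectively $\bigcap_{a\in G}C(a)\subseteq E(w,u)$); - $M,w\models E_G\psi$ iff $M,w\models K_a\psi$ for all $a\in G$; - $M,w\models C_G\psi$ iff $M,w\models E_G^n\psi$ for all $n\ge 1$; - $M,w\models(+_S)_a\psi$, $(-_S)_a\psi$, $(=_S)_a\psi$, $(\equiv_b)_a\psi$ iff $M',w\models\psi$, where $M'$ is $M$ with $C(a)$ replaced by $C(a)\cup S$, $C(a)\setminus S$, $S$, $C(b)$ respectively. The model checking problem for a language is: given a formula $\varphi$ of the language, a finite model $M$ and a world $w$ of $M$, decide whether $M,w\models\varphi$. The input is a string over a fixed finite alphabet: $W$, $E$, $\beta$ and the restriction of $C$ to a finite set of agents that contains all agents occurring in $\varphi$ are written out as finite lists of worlds, triples $(w,u,E(w,u))$, pairs $(w,\beta(w))$ and pairs $(a,C(a))$ (so all these sets are finite), followed by $w$ and $\varphi$; worlds, atoms, agents and skills are named by binary strings. Then the model checking problems for $\mathcal L_{CDEF+-=\equiv}$ and for all of its sublanguages are in P: the set of input strings that present some $(M,w,\varphi)$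 with $M,w\models\varphi$ is decided by a Turing machine in time polynomial in the length of the string. -/

import Mathlib

namespace EpistemicSkills

/-! ### Syntax -/

/-- Names are finite binary strings; they form a countably infinite set. -/
abbrev Name := List Bool

/-- The countably infinite set of atomic propositions. -/
abbrev Atom := Name

/-- The countably infinite set of agents. -/
abbrev Agent := Name

/-- The countably infinite set of epistemic skills. -/
abbrev Skill := Name

/-- Formulas of the language with the operators `K_a`, `C_G`, `D_G`, `E_G`, `F_G`, `(+_S)_a`,
`(-_S)_a`, `(=_S)_a` and `(≡_b)_a`, where `G` and `S` are finite and nonempty. -/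
inductive Formula : Type
  | atom (p : Atom)
  | neg (φ : Formula)
  | imp (φ ψ : Formula)
  | know (a : Agent) (φ : Formula)
  | common (G : Finset Agent) (hG : G.Nonempty) (φ : Formula)
  | distributed (G : Finset Agent) (hG : G.Nonempty) (φ : Formula)
  | mutual (G : Finset Agent) (hG : G.Nonempty) (φ : Formula)
  | field (G : Finset Agent) (hG : G.Nonempty) (φ : Formula)
  | upskill (S : Finset Skill) (hS : S.Nonempty) (a : Agent) (φ : Formula)
  | downskill (S : Finset Skill) (hS : S.Nonempty) (a : Agent) (φ : Formula)
  | reskill (S : Finset Skill) (hS : S.Nonempty) (a : Agent) (φ : Formula)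
  | learn (b a : Agent) (φ : Formula)

/-- The eight optional kinds of operators `C`, `D`, `E`, `F`, `+`, `-`, `=`, `≡`. A set of them
determines a language that extends the basic language (atoms, Boolean operators, `K_a`). -/
inductive Op : Type
  | common | distributed | mutual | field | upskill | downskill | reskill | learn

/-- The optional operators occurring in a formula. -/
def Formula.ops : Formula → Set Op
  | .atom _ => ∅
  | .neg φ => φ.ops
  | .imp φ ψ => φ.ops ∪ ψ.ops
  | .know _ φ => φ.ops
  | .common _ _ φ => insert Op.common φ.ops
  | .distributed _ _ φ => insert Op.distributed φ.ops
  | .mutual _ _ φ => insert Op.mutual φ.ops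
  | .field _ _ φ => insert Op.field φ.ops
  | .upskill _ _ _ φ => insert Op.upskill φ.ops
  | .downskill _ _ _ φ => insert Op.downskill φ.ops
  | .reskill _ _ _ φ => insert Op.reskill φ.ops
  | .learn _ _ φ => insert Op.learn φ.ops

/-- The agents occurring in a formula. -/
def Formula.agents : Formula → Set Agent
  | .atom _ => ∅
  | .neg φ => φ.agents
  | .imp φ ψ => φ.agents ∪ ψ.agents
  | .know a φ => insert a φ.agents
  | .common G _ φ => (G : Set Agent) ∪ φ.agents
  | .distributed G _ φ => (G : Set Agent) ∪ φ.agents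
  | .mutual G _ φ => (G : Set Agent) ∪ φ.agents
  | .field G _ φ => (G : Set Agent) ∪ φ.agents
  | .upskill _ _ a φ => insert a φ.agents
  | .downskill _ _ a φ => insert a φ.agents
  | .reskill _ _ a φ => insert a φ.agents
  | .learn b a φ => insert b (insert a φ.agents)

/-! ### Semantics -/

/-- Models `(W, E, C, β)`. -/
structure Model (W : Type) where
  nonempty : Nonempty W
  /-- the edge function -/
  E : W → W → Set Skill
  /-- the capability function -/
  C : Agent → Set Skill
  /-- the valuation -/
  β : W → Set Atom
  positivity : ∀ w u, E w u = Set.univ → w = u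
  symmetry : ∀ w u, E w u = E u w

namespace Model

variable {W : Type}

/-- The model that differs from `M` only in that agent `a` has the skill set `S`. -/
def setSkills (M : Model W) (a : Agent) (S : Set Skill) : Model W :=
  { M with C := Function.update M.C a S }

/-- The worlds `w` such that all `u` with `S ⊆ E(w, u)` lie in `T`. -/
def box (M : Model W) (S : Set Skill) (T : Set W) : Set W :=
  {w | ∀ u, S ⊆ M.E w u → u ∈ T}

/-- The worlds where every agent of `G` knows `T`. -/
def everyone (M : Model W) (G : Finset Agent) (T : Set W) : Set W :=
  {w | ∀ a ∈ G, w ∈ M.box (M.C a) T}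

/-- The truth set of a formula in a model. In the clause for `C_G`, the `n`-fold iterate of
`everyone` gives the truth set of `E_G^n φ`. -/
def truthSet : Formula → Model W → Set W
  | .atom p, M => {w | p ∈ M.β w}
  | .neg φ, M => {w | w ∉ truthSet φ M}
  | .imp φ ψ, M => {w | w ∈ truthSet φ M → w ∈ truthSet ψ M}
  | .know a φ, M => M.box (M.C a) (truthSet φ M)
  | .common G _ φ, M => {w | ∀ n : ℕ, 1 ≤ n → w ∈ (M.everyone G)^[n] (truthSet φ M)}
  | .distributed G _ φ, M => M.box (⋃ a ∈ G, M.C a) (truthSet φ M)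
  | .mutual G _ φ, M => M.everyone G (truthSet φ M)
  | .field G _ φ, M => M.box (⋂ a ∈ G, M.C a) (truthSet φ M)
  | .upskill S _ a φ, M => truthSet φ (M.setSkills a (M.C a ∪ S))
  | .downskill S _ a φ, M => truthSet φ (M.setSkills a (M.C a \ S))
  | .reskill S _ a φ, M => truthSet φ (M.setSkills a S)
  | .learn b a φ, M => truthSet φ (M.setSkills a (M.C b))

/-- `M, w ⊨ φ`. -/
def Sat (M : Model W) (w : W) (φ : Formula) : Prop := w ∈ truthSet φ M

end Model

/-! ### Writing formulas and finite models as strings over a finite alphabet -/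

/-- The finite alphabet. -/
inductive Letter : Type
  | mark | bit (b : Bool)
  | lbrace | rbrace | lpar | rpar | comma
  | neg | imp | K | C | D | E | F
  | plus | minus | eq | equiv

/-- A name is written as a mark followed by its bits. -/
def nameStr (x : Name) : List Letter := .mark :: x.map .bit

/-- Listing `{x₁,…,xₙ}` of strings. -/
def listStr (xs : List (List Letter)) : List Letter :=
  [.lbrace] ++ List.intercalate [.comma] xs ++ [.rbrace]

/-- Listing of names. -/
def setStr (l : List Name) : List Letter := listStr (l.map nameStr)

/-- `φ.Writes s`: the string `s` is a way of writing the formula `φ`. The sets `G` and `S` in `φ`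
are written by listing their elements. Up to the number of letters per name and repetitions in
listings, the number of symbols of `s` is the length of `φ`. -/
inductive Formula.Writes : Formula → List Letter → Prop
  | atom (p : Atom) : Writes (.atom p) (nameStr p)
  | neg {φ : Formula} {s : List Letter} (h : Writes φ s) : Writes (.neg φ) ([.neg] ++ s)
  | imp {φ ψ : Formula} {s t : List Letter} (h : Writes φ s) (h' : Writes ψ t) :
      Writes (.imp φ ψ) ([.lpar] ++ s ++ [.imp] ++ t ++ [.rpar])
  | know {φ : Formula} {s : List Letter} (a : Agent) (h : Writes φ s) :
      Writes (.know a φ) ([.K] ++ nameStr a ++ s)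
  | common {φ : Formula} {s : List Letter} (G : Finset Agent) (hG : G.Nonempty) (l : List Agent)
      (hl : l.toFinset = G) (h : Writes φ s) :
      Writes (.common G hG φ) ([.C] ++ setStr l ++ s)
  | distributed {φ : Formula} {s : List Letter} (G : Finset Agent) (hG : G.Nonempty)
      (l : List Agent) (hl : l.toFinset = G) (h : Writes φ s) :
      Writes (.distributed G hG φ) ([.D] ++ setStr l ++ s)
  | mutual {φ : Formula} {s : List Letter} (G : Finset Agent) (hG : G.Nonempty) (l : List Agent)
      (hl : l.toFinset = G) (h : Writes φ s) :
      Writes (.mutual G hG φ) ([.E] ++ setStr l ++ s)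
  | field {φ : Formula} {s : List Letter} (G : Finset Agent) (hG : G.Nonempty) (l : List Agent)
      (hl : l.toFinset = G) (h : Writes φ s) :
      Writes (.field G hG φ) ([.F] ++ setStr l ++ s)
  | upskill {φ : Formula} {s : List Letter} (S : Finset Skill) (hS : S.Nonempty) (a : Agent)
      (l : List Skill) (hl : l.toFinset = S) (h : Writes φ s) :
      Writes (.upskill S hS a φ) ([.lpar, .plus] ++ setStr l ++ [.rpar] ++ nameStr a ++ s)
  | downskill {φ : Formula} {s : List Letter} (S : Finset Skill) (hS : S.Nonempty) (a : Agent)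
      (l : List Skill) (hl : l.toFinset = S) (h : Writes φ s) :
      Writes (.downskill S hS a φ) ([.lpar, .minus] ++ setStr l ++ [.rpar] ++ nameStr a ++ s)
  | reskill {φ : Formula} {s : List Letter} (S : Finset Skill) (hS : S.Nonempty) (a : Agent)
      (l : List Skill) (hl : l.toFinset = S) (h : Writes φ s) :
      Writes (.reskill S hS a φ) ([.lpar, .eq] ++ setStr l ++ [.rpar] ++ nameStr a ++ s)
  | learn {φ : Formula} {s : List Letter} (b a : Agent) (h : Writes φ s) :
      Writes (.learn b a φ) ([.lpar, .equiv] ++ nameStr b ++ [.rpar] ++ nameStr a ++ s)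

/-- Finite listings of the four components of a model: the worlds (given by names), the triples
`(w, u, E(w, u))`, the pairs `(a, C(a))` for finitely many agents `a`, and the pairs
`(w, β(w))`; the skill sets and sets of atoms are themselves given by listings. -/
structure Presentation where
  worlds : List Name
  edges : List (Name × Name × List Skill)
  caps : List (Agent × List Skill)
  vals : List (Name × List Atom)

namespace Presentation

/-- The set of worlds that is listed. -/
abbrev World (p : Presentation) : Type := {w : Name // w ∈ p.worlds}

/-- The set of agents whose capabilities are listed. -/
def agents (p : Presentation) : Set Agent := {a | ∃ S, (a, S) ∈ p.caps}

/-- `p.Presents M`: the listings in `p` are those of `E` and `β`, and of `C` restricted to the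
set `p.agents`. -/
structure Presents (p : Presentation) (M : Model p.World) : Prop where
  edge_total : ∀ w u : p.World, ∃ S, (w.1, u.1, S) ∈ p.edges
  edge_mem : ∀ w u S, (w, u, S) ∈ p.edges →
    ∃ (hw : w ∈ p.worlds) (hu : u ∈ p.worlds), M.E ⟨w, hw⟩ ⟨u, hu⟩ = {s | s ∈ S}
  cap_mem : ∀ a S, (a, S) ∈ p.caps → M.C a = {s | s ∈ S}
  val_total : ∀ w : p.World, ∃ S, (w.1, S) ∈ p.vals
  val_mem : ∀ w S, (w, S) ∈ p.vals → ∃ hw : w ∈ p.worlds, M.β ⟨w, hw⟩ = {q | q ∈ S}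

/-- A pair `(x,{…})` as a string. -/
def pairStr (e : Name × List Name) : List Letter :=
  [.lpar] ++ nameStr e.1 ++ [.comma] ++ setStr e.2 ++ [.rpar]

/-- A triple `(w,u,{…})` as a string. -/
def tripleStr (e : Name × Name × List Name) : List Letter :=
  [.lpar] ++ nameStr e.1 ++ [.comma] ++ nameStr e.2.1 ++ [.comma] ++ setStr e.2.2 ++ [.rpar]

/-- The quadruple `(W,E,C,β)` as a string. -/
def str (p : Presentation) : List Letter :=
  [.lpar] ++ setStr p.worlds ++ [.comma] ++ listStr (p.edges.map tripleStr) ++ [.comma] ++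
    listStr (p.caps.map pairStr) ++ [.comma] ++ listStr (p.vals.map pairStr) ++ [.rpar]

end Presentation

/-! ### The model checking problem and the class P -/

/-- The model checking problem for the language with the optional operators `X`: the set of all
strings that consist of a finite model `M`, a world `w` of `M` and a formula `φ` of the language
with `M, w ⊨ φ`, where the capabilities of all agents occurring in `φ` are listed. -/
def modelChecking (X : Set Op) : Language Letter :=
  {s | ∃ (p : Presentation) (M : Model p.World) (w : p.World) (φ : Formula) (t : List Letter),
    p.Presents M ∧ φ.ops ⊆ X ∧ φ.agents ⊆ p.agents ∧ φ.Writes t ∧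
    s = p.str ++ nameStr w.1 ++ t ∧ M.Sat w φ}

/-- The class P: the language `L` is decided by a (multi-stack) Turing machine that halts on
every input string within a number of steps that is polynomial in the length of the string. -/
def InP {Γ : Type} (L : Language Γ) : Prop :=
  ∃ f : List Γ → Bool, (∀ s, f s = true ↔ s ∈ L) ∧
    Nonempty (Turing.TM2ComputableInPolyTime (id : List Γ → List Γ) Computability.encodeBool f)

end EpistemicSkills

/-! Formulas are evaluated bottom-up by truth sets. Given the listings of a finite model, each
operator turns the truth sets of its operands into its own by a few loops over the listings. Only
two points need an argument. Common knowledge of a set `T` of worlds is the intersection of the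
sets `Eⁿ T`, `n ≥ 1`; the iteration `Z ↦ E (T ∩ Z)`, begun with all worlds, produces the intersections of
the first ones of them, and as it is decreasing it is stationary after `|W|` rounds (`commonList`,
`iterate_everyone_eq`). The operators that change a model only touch the capabilities of one
agent, so that the evaluation carries along a list of capabilities in which new entries are put in
front of older ones; each step adds at most one entry, and an entry grows at most by what is read
from the input, so that capabilities, and everything else that is stored, remain polynomially
bounded (`stateOK_step`).

The evaluation is a pushdown process on the text of the formula: a state consists of the truth set
computed last, the capabilities, a stack of frames that say how to go on, and the unread text. Two
steps per letter suffice. A run on a formula computes its truth set (`runs_of_writes`), and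
conversely a run that does not fail has read a formula (`parses_of_accepts`). Notations of names,
sets and models are decoded by functions that are correct on well-formed input, and the result is
written out again and compared with the input, which settles what happens on all other strings
(`exactly`).

For the time bound, values are binary trees, which lie on the stack of a machine in preorder; since
this is a prefix code, a value on top of a stack can be moved and copied without a marker at its
end. Structured programs on five stacks compile to multi-stack Turing machines step by step
(`Exec.runs`, `exists_machine`). The functions computed by such programs in polynomial time, with
values of polynomial size, are closed under composition, pairing, case distinction, and iteration
whose intermediate values are of polynomial size (`PTime.comp`, `PTime.pair`, `PTime.cases_nil`,
`PTime.iter`). From these follow the usual operations on lists, and the algorithm `decideMC` is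
composed of them (`ptime_decideMC`). The number of iterations is the size of a value, which
suits both loops over lists and the evaluation itself. -/

namespace EpistemicSkills.PolyTime

/-! ### A structured language on five stacks -/

/-- The five stacks of bits: `A` carries arguments and results, `C` saved values, `B` a value in
transit (reversed), `D` the nesting depth while a value is scanned, `N` loop counters in unary. -/
inductive Reg : Type
  | A | B | C | D | N
  deriving DecidableEq

instance : Fintype Reg := ⟨{.A, .B, .C, .D, .N}, fun k => by cases k <;> decide⟩

/-- The contents of the five stacks. -/
abbrev Store := Reg → List Bool

/-- The store with the given contents. -/
def st (a b c d n : List Bool) : Store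
  | .A => a | .B => b | .C => c | .D => d | .N => n

section
variable (a b c d n x : List Bool)
@[simp] theorem st_A : st a b c d n .A = a := rfl
@[simp] theorem st_B : st a b c d n .B = b := rfl
@[simp] theorem st_C : st a b c d n .C = c := rfl
@[simp] theorem st_D : st a b c d n .D = d := rfl
@[simp] theorem st_N : st a b c d n .N = n := rfl
@[simp] theorem update_st_A : Function.update (st a b c d n) .A x = st x b c d n := by
  funext k; cases k <;> rfl
@[simp] theorem update_st_B : Function.update (st a b c d n) .B x = st a x c d n := by
  funext k; cases k <;> rfl
@[simp] theorem update_st_C : Function.update (st a b c d n) .C x = st a b x d n := by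
  funext k; cases k <;> rfl
@[simp] theorem update_st_D : Function.update (st a b c d n) .D x = st a b c x n := by
  funext k; cases k <;> rfl
@[simp] theorem update_st_N : Function.update (st a b c d n) .N x = st a b c d x := by
  funext k; cases k <;> rfl
end

/-- Structured programs. `ifPop k p q` pops the stack `k` and runs `p` if a `true` was popped and
`q` otherwise; `loop k p` pops the stack `k` and, as long as a `true` was popped, runs `p` and
starts again. -/
inductive Prog : Type
  | skip
  | push (k : Reg) (b : Bool)
  | ifPop (k : Reg) (p q : Prog)
  | seq (p q : Prog)
  | loop (k : Reg) (p : Prog)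

/-- `Exec p S t S'`: run on the store `S`, the program `p` ends after `t` steps with the
store `S'`. -/
inductive Exec : Prog → Store → ℕ → Store → Prop
  | skip {S : Store} : Exec .skip S 1 S
  | push {k : Reg} {b : Bool} {S : Store} :
      Exec (.push k b) S 1 (Function.update S k (b :: S k))
  | pop_true {k : Reg} {p q : Prog} {S S' : Store} {l : List Bool} {t : ℕ} (h : S k = true :: l)
      (hp : Exec p (Function.update S k l) t S') : Exec (.ifPop k p q) S (t + 1) S'
  | pop_false {k : Reg} {p q : Prog} {S S' : Store} {l : List Bool} {t : ℕ}
      (h : S k = false :: l) (hq : Exec q (Function.update S k l) t S') :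
      Exec (.ifPop k p q) S (t + 1) S'
  | seq {p q : Prog} {S S' S'' : Store} {t t' : ℕ} (hp : Exec p S t S') (hq : Exec q S' t' S'') :
      Exec (.seq p q) S (t + t') S''
  | loop_true {k : Reg} {p : Prog} {S S' S'' : Store} {l : List Bool} {t t' : ℕ}
      (h : S k = true :: l) (hp : Exec p (Function.update S k l) t S')
      (hl : Exec (.loop k p) S' t' S'') : Exec (.loop k p) S (t + t' + 1) S''
  | loop_false {k : Reg} {p : Prog} {S : Store} {l : List Bool} (h : S k = false :: l) :
      Exec (.loop k p) S 1 (Function.update S k l)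

/-! ### Compilation to multi-stack Turing machines -/

open Turing

/-- The labels that the compiled program needs. -/
def Prog.Lab : Prog → Type
  | .skip => Unit
  | .push _ _ => Unit
  | .ifPop _ p q => Option (p.Lab ⊕ q.Lab)
  | .seq p q => p.Lab ⊕ q.Lab
  | .loop _ p => Option p.Lab

/-- The labels of a program are finitely many. -/
instance Prog.labFintype : (p : Prog) → Fintype p.Lab
  | .skip => inferInstanceAs (Fintype Unit)
  | .push _ _ => inferInstanceAs (Fintype Unit)
  | .ifPop _ p q =>
    letI := p.labFintype
    letI := q.labFintype
    inferInstanceAs (Fintype (Option (p.Lab ⊕ q.Lab)))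
  | .seq p q =>
    letI := p.labFintype
    letI := q.labFintype
    inferInstanceAs (Fintype (p.Lab ⊕ q.Lab))
  | .loop _ p =>
    letI := p.labFintype
    inferInstanceAs (Fintype (Option p.Lab))

/-- The label where a compiled program starts. -/
def Prog.entry : (p : Prog) → p.Lab
  | .skip => ()
  | .push _ _ => ()
  | .ifPop _ _ _ => none
  | .seq p _ => .inl p.entry
  | .loop _ _ => none

/-- The stack alphabets of the machine: the input stack `none` holds letters of the input
alphabet `I`, the stacks of the program hold bits. -/
abbrev Sym (I : Type) : Option Reg → Type
  | none => I
  | some _ => Bool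

/-- The finite memory of the machine: the symbol popped last. -/
abbrev Var (I : Type) : Type := Option I × Option Bool

/-- Pop the stack `k` and branch on the bit. -/
def popBranch {I Λ : Type} (k : Reg) (l₁ l₂ : Λ) : TM2.Stmt (Sym I) Λ (Var I) :=
  .pop (some k) (fun _ x => (none, x))
    (.branch (fun v => v.2 == some true)
      (.load (fun _ => (none, none)) (.goto fun _ => l₁))
      (.load (fun _ => (none, none)) (.goto fun _ => l₂)))

/-- The compiled program: its labels are embedded into the labels of the machine by `ι`, and it
leaves to the label `ex` in the end. -/
def Prog.stmt {I Λ : Type} : (p : Prog) → (p.Lab → Λ) → Λ → p.Lab → TM2.Stmt (Sym I) Λ (Var I)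
  | .skip, _, ex, _ => .goto fun _ => ex
  | .push k b, _, ex, _ => .push (some k) (fun _ => b) (.goto fun _ => ex)
  | .ifPop k p q, ι, _, none => popBranch k (ι (some (.inl p.entry))) (ι (some (.inr q.entry)))
  | .ifPop _ p _, ι, ex, some (.inl l) => p.stmt (fun l => ι (some (.inl l))) ex l
  | .ifPop _ _ q, ι, ex, some (.inr l) => q.stmt (fun l => ι (some (.inr l))) ex l
  | .seq p q, ι, _, .inl l => p.stmt (fun l => ι (.inl l)) (ι (.inr q.entry)) l
  | .seq _ q, ι, ex, .inr l => q.stmt (fun l => ι (.inr l)) ex l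
  | .loop k p, ι, ex, none => popBranch k (ι (some p.entry)) ex
  | .loop _ p, ι, _, some l => p.stmt (fun l => ι (some l)) (ι none) l

/-- The stacks of the machine. -/
def stk {I : Type} (s : List I) (S : Store) : ∀ k, List (Sym I k)
  | none => s
  | some k => S k

theorem update_stk {I : Type} (s : List I) (S : Store) (k : Reg) (x : List Bool) :
    Function.update (stk s S) (some k) x = stk s (Function.update S k x) := by
  funext j
  rcases j with _ | j
  · rfl
  · by_cases h : j = k
    · subst h
      simp [stk]
    · simp [stk, h]

theorem update_stk_none {I : Type} (s s' : List I) (S : Store) :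
    Function.update (stk s S) none s' = stk s' S := by
  funext j
  rcases j with _ | j <;> simp [stk]

/-- `Runs M t c c'`: the machine `M` gets from `c` to `c'` in `t` steps. -/
def Runs {I Λ : Type} (M : Λ → TM2.Stmt (Sym I) Λ (Var I)) (t : ℕ)
    (c c' : TM2.Cfg (Sym I) Λ (Var I)) : Prop :=
  (flip bind (TM2.step M))^[t] (some c) = some c'

theorem Runs.trans {I Λ : Type} {M : Λ → TM2.Stmt (Sym I) Λ (Var I)} {t t' : ℕ}
    {c c' c'' : TM2.Cfg (Sym I) Λ (Var I)} (h : Runs M t c c') (h' : Runs M t' c' c'') :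
    Runs M (t + t') c c'' := by
  unfold Runs at *
  rw [add_comm, Function.iterate_add_apply, h, h']

theorem Runs.one {I Λ : Type} {M : Λ → TM2.Stmt (Sym I) Λ (Var I)}
    {c c' : TM2.Cfg (Sym I) Λ (Var I)} (h : TM2.step M c = some c') : Runs M 1 c c' := h

theorem Runs.popBranch {I Λ : Type} {M : Λ → TM2.Stmt (Sym I) Λ (Var I)} {l l₁ l₂ : Λ} {k : Reg}
    (hM : M l = popBranch k l₁ l₂) {s : List I} {S : Store} {b : Bool} {x : List Bool}
    (hS : S k = b :: x) :
    Runs M 1 ⟨some l, (none, none), stk s S⟩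
      ⟨some (if b then l₁ else l₂), (none, none), stk s (Function.update S k x)⟩ := by
  apply Runs.one
  have h : stk s S (some k) = b :: x := hS
  simp only [TM2.step, hM, PolyTime.popBranch, TM2.stepAux, h, ← update_stk]
  cases b <;> rfl

/-- A machine that contains the compiled program carries out its executions. -/
theorem Exec.runs {I Λ : Type} {M : Λ → TM2.Stmt (Sym I) Λ (Var I)} {p : Prog} {S S' : Store}
    {t : ℕ} (h : Exec p S t S') (s : List I) :
    ∀ {ι : p.Lab → Λ} {ex : Λ}, (∀ l, M (ι l) = p.stmt ι ex l) →
      Runs M t ⟨some (ι p.entry), (none, none), stk s S⟩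
        ⟨some ex, (none, none), stk s S'⟩ := by
  induction h with
  | skip =>
    intro ι ex hM
    apply Runs.one
    simp only [TM2.step, hM, Prog.stmt, TM2.stepAux]
  | push =>
    intro ι ex hM
    apply Runs.one
    simp only [TM2.step, hM, Prog.stmt, TM2.stepAux, ← update_stk]
    rfl
  | pop_true h _ ih =>
    intro ι ex hM
    rw [add_comm]
    exact (Runs.popBranch (hM none) h).trans
      (ih (ι := fun l => ι (some (.inl l))) fun l => hM (some (.inl l)))
  | pop_false h _ ih =>
    intro ι ex hM
    rw [add_comm]
    exact (Runs.popBranch (hM none) h).trans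
      (ih (ι := fun l => ι (some (.inr l))) fun l => hM (some (.inr l)))
  | seq _ _ ihp ihq =>
    intro ι ex hM
    exact (ihp (ι := fun l => ι (.inl l)) fun l => hM (.inl l)).trans
      (ihq (ι := fun l => ι (.inr l)) fun l => hM (.inr l))
  | loop_true h _ _ ihp ihl =>
    intro ι ex hM
    rw [add_comm, ← add_assoc]
    exact ((Runs.popBranch (hM none) h).trans
      (ihp (ι := fun l => ι (some l)) fun l => hM (some l))).trans (ihl hM)
  | loop_false h =>
    intro ι ex hM
    exact Runs.popBranch (hM none) h

/-! ### Machines that read a string, run a program and write a bit -/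

section Machine
variable {I : Type} (code : I → List Bool) (p : Prog)

/-- Push a word on the stack `A`. -/
def pushWord {Λ : Type} : List Bool → TM2.Stmt (Sym I) Λ (Var I) → TM2.Stmt (Sym I) Λ (Var I)
  | [], q => q
  | b :: w, q => pushWord w (.push (some .A) (fun _ => b) q)

/-- The machine that pushes the codes of the input letters on `A`, runs `p`, and replaces the
code of the result on `A` by a single bit. -/
def machineStmt : I ⊕ p.Lab ⊕ Fin 3 → TM2.Stmt (Sym I) (I ⊕ p.Lab ⊕ Fin 3) (Var I)
  | .inl i => .load (fun _ => (none, none)) (pushWord (code i) (.goto fun _ => .inr (.inr 1)))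
  | .inr (.inl l) => p.stmt (fun l => .inr (.inl l)) (.inr (.inr 2)) l
  | .inr (.inr 0) => .push (some .A) (fun _ => false) (.goto fun _ => .inr (.inr 1))
  | .inr (.inr 1) => .pop none (fun _ x => (x, none))
      (.goto fun v => v.1.elim (.inr (.inl p.entry)) .inl)
  | .inr (.inr 2) => .pop (some .A) (fun _ x => (none, x))
      (.branch (fun v => v.2 == some true)
        (.pop (some .A) (fun _ _ => (none, none)) (.pop (some .A) (fun _ _ => (none, none))
          (.push (some .A) (fun _ => true) .halt)))
        (.load (fun _ => (none, none)) (.push (some .A) (fun _ => false) .halt)))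

/-- The bundled machine. -/
def machine [Fintype I] : FinTM2 where
  K := Option Reg
  k₀ := none
  k₁ := some .A
  Γ := Sym I
  Λ := I ⊕ p.Lab ⊕ Fin 3
  main := .inr (.inr 0)
  σ := Var I
  initialState := (none, none)
  Γk₀Fin := inferInstanceAs (Fintype I)
  m := machineStmt code p

/-- What the stack `A` holds when the string `s` was read on top of `x`. -/
def readWord (s : List I) (x : List Bool) : List Bool := s.foldl (fun x i => code i ++ x) x

/-- The code of a bit; it is the code of the tree that represents the bit. -/
def bitWord (b : Bool) : List Bool := if b then [true, false, false] else [false]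

theorem stepAux_pushWord {Λ : Type} (w : List Bool) (q : TM2.Stmt (Sym I) Λ (Var I)) (v : Var I)
    (s : List I) (S : Store) :
    TM2.stepAux (pushWord w q) v (stk s S) =
      TM2.stepAux q v (stk s (Function.update S .A (w ++ S .A))) := by
  induction w generalizing q with
  | nil => simp [pushWord]
  | cons b w ih =>
    rw [pushWord, ih, TM2.stepAux, update_stk]
    simp [stk]

theorem runs_read (s : List I) (v : Var I) (x : List Bool) :
    Runs (machineStmt code p) (2 * s.length + 1)
      ⟨some (.inr (.inr 1)), v, stk s (st x [] [] [] [])⟩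
      ⟨some (.inr (.inl p.entry)), (none, none), stk [] (st (readWord code s x) [] [] [] [])⟩ := by
  induction s generalizing v x with
  | nil =>
    apply Runs.one
    simp only [TM2.step, machineStmt, TM2.stepAux]
    simp [stk, readWord, update_stk_none]
  | cons i s ih =>
    rw [List.length_cons, show 2 * (s.length + 1) + 1 = (1 + 1) + (2 * s.length + 1) by ring]
    refine Runs.trans (c' := ⟨some (.inr (.inr 1)), (none, none),
      stk s (st (code i ++ x) [] [] [] [])⟩) (Runs.trans (c' := ⟨some (.inl i), (some i, none),
      stk s (st x [] [] [] [])⟩) ?_ ?_) ?_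
    · apply Runs.one
      simp only [TM2.step, machineStmt, TM2.stepAux]
      simp [stk, update_stk_none]
    · apply Runs.one
      simp only [TM2.step, machineStmt, TM2.stepAux, stepAux_pushWord]
      simp
    · exact ih (none, none) (code i ++ x)

theorem runs_finish (b : Bool) :
    Runs (machineStmt code p) 1
      ⟨some (.inr (.inr 2)), (none, none), stk [] (st (bitWord b) [] [] [] [])⟩
      ⟨none, (none, none), stk [] (st [b] [] [] [] [])⟩ := by
  apply Runs.one
  cases b <;>
    simp only [TM2.step, machineStmt, TM2.stepAux, bitWord, update_stk] <;>
    simp [stk]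

/-- A program that turns the code of the input into the code of a bit, in polynomial time, yields a
Turing machine. -/
theorem exists_machine [Fintype I] (f : List I → Bool) (q : Polynomial ℕ)
    (h : ∀ s, ∃ t ≤ q.eval s.length,
      Exec p (st (readWord code s [false]) [] [] [] []) t (st (bitWord (f s)) [] [] [] [])) :
    Nonempty (TM2ComputableInPolyTime (id : List I → List I) Computability.encodeBool f) := by
  refine ⟨{ tm := machine code p, inputAlphabet := Equiv.refl I, outputAlphabet := Equiv.refl Bool,
            time := q + 2 * Polynomial.X + 3, outputsFun := fun s => ?_ }⟩
  apply Classical.choice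
  obtain ⟨t, ht, he⟩ := h s
  have h₀ : Runs (machineStmt code p) 1
      ⟨some (.inr (.inr 0)), (none, none), stk s (st [] [] [] [] [])⟩
      ⟨some (.inr (.inr 1)), (none, none), stk s (st [false] [] [] [] [])⟩ := by
    apply Runs.one
    simp only [TM2.step, machineStmt, TM2.stepAux, update_stk]
    simp [stk]
  have h₁ := ((h₀.trans (runs_read code p s _ _)).trans
    (he.runs [] (ι := fun l => Sum.inr (Sum.inl l)) (ex := Sum.inr (Sum.inr 2)) fun l => rfl)).trans
    (runs_finish code p (f s))
  refine ⟨⟨⟨1 + (2 * s.length + 1) + t + 1, ?_⟩, ?_⟩⟩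
  · have hi : initList (machine code p) (List.map (Equiv.refl I).invFun (id s)) =
        ⟨some (.inr (.inr 0)), (none, none), stk s (st [] [] [] [] [])⟩ := by
      simp only [initList, machine]
      congr 1
      funext k
      rcases k with _ | k
      · exact List.map_id s
      · cases k <;> rfl
    have ho : haltList (machine code p)
        (List.map (Equiv.refl Bool).invFun (Computability.encodeBool (f s))) =
        ⟨none, (none, none), stk [] (st [f s] [] [] [] [])⟩ := by
      simp only [haltList, machine]
      congr 1
      funext k
      rcases k with _ | k
      · rfl
      · cases k <;> rfl
    refine Eq.trans ?_ (Eq.trans h₁ ?_)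
    · exact congrArg _ (congrArg some hi)
    · exact congrArg some ho.symm
  · simp
    omega
end Machine

/-! ### Binary trees as universal data -/

/-- Binary trees, the values that programs work on. -/
inductive Tr : Type
  | nil
  | node (l r : Tr)

/-- The number of nodes and leaves. -/
def Tr.size : Tr → ℕ
  | .nil => 1
  | .node l r => l.size + r.size + 1

/-- The tree in preorder, a prefix code: a tree on top of a stack can be told from what lies
below it. -/
def Tr.code : Tr → List Bool
  | .nil => [false]
  | .node l r => true :: (l.code ++ r.code)

@[simp] theorem Tr.length_code (x : Tr) : x.code.length = x.size := by
  induction x with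
  | nil => rfl
  | node l r hl hr => simp [code, size, hl, hr]

theorem Tr.size_pos (x : Tr) : 1 ≤ x.size := by
  cases x <;> simp [size]

/-- `Ex p S T S'`: run on the store `S`, the program `p` ends after at most `T` steps with the
store `S'`. -/
def Ex (p : Prog) (S : Store) (T : ℕ) (S' : Store) : Prop := ∃ t ≤ T, Exec p S t S'

namespace Ex
variable {p q : Prog} {S S' S'' S₁ : Store} {T T' : ℕ} {k : Reg} {l : List Bool}

theorem mono (h : Ex p S T S') (hT : T ≤ T') : Ex p S T' S' := by
  obtain ⟨t, ht, he⟩ := h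
  exact ⟨t, ht.trans hT, he⟩

theorem skip : Ex .skip S 1 S := ⟨1, le_rfl, .skip⟩

theorem push {b : Bool} (h : Function.update S k (b :: S k) = S') : Ex (.push k b) S 1 S' :=
  ⟨1, le_rfl, h ▸ .push⟩

theorem seq (hp : Ex p S T S') (hq : Ex q S' T' S'') : Ex (.seq p q) S (T + T') S'' := by
  obtain ⟨t, ht, he⟩ := hp
  obtain ⟨t', ht', he'⟩ := hq
  exact ⟨t + t', add_le_add ht ht', .seq he he'⟩

theorem pop_true (h : S k = true :: l) (h' : Function.update S k l = S₁) (hp : Ex p S₁ T S') :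
    Ex (.ifPop k p q) S (T + 1) S' := by
  subst h'
  obtain ⟨t, ht, he⟩ := hp
  exact ⟨t + 1, by omega, .pop_true h he⟩

theorem pop_false (h : S k = false :: l) (h' : Function.update S k l = S₁) (hq : Ex q S₁ T S') :
    Ex (.ifPop k p q) S (T + 1) S' := by
  subst h'
  obtain ⟨t, ht, he⟩ := hq
  exact ⟨t + 1, by omega, .pop_false h he⟩

theorem loop_true (h : S k = true :: l) (h' : Function.update S k l = S₁) (hp : Ex p S₁ T S')
    (hl : Ex (.loop k p) S' T' S'') : Ex (.loop k p) S (T + T' + 1) S'' := by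
  subst h'
  obtain ⟨t, ht, he⟩ := hp
  obtain ⟨t', ht', he'⟩ := hl
  exact ⟨t + t' + 1, by omega, .loop_true h he he'⟩

theorem loop_false (h : S k = false :: l) (h' : Function.update S k l = S') :
    Ex (.loop k p) S 1 S' := by
  subst h'
  exact ⟨1, le_rfl, .loop_false h⟩

end Ex

/-! ### Moving and copying trees between stacks -/

/-- The word `x` under `k` further bits `true`. -/
def ones : ℕ → List Bool → List Bool
  | 0, x => x
  | k + 1, x => true :: ones k x

theorem ones_cons (k : ℕ) (x : List Bool) : ones k (true :: x) = ones (k + 1) x := by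
  induction k with
  | zero => rfl
  | succ k ih => rw [ones, ih]; rfl

theorem ones_ones (j k : ℕ) (x : List Bool) : ones j (ones k x) = ones (j + k) x := by
  induction k with
  | zero => rfl
  | succ k ih => rw [ones, ones_cons, ones, ih]; rfl

/-- Transfer one bit from the source stack to `B`, count it on `N`, and update the number of trees
that are still to be read, which is kept in unary on `D`. -/
def scanBody (src : Reg) : Prog :=
  .ifPop src
    (.seq (.push .B true) (.seq (.push .N true) (.seq (.push .D true) (.push .D true))))
    (.seq (.push .B false) (.push .N true))

/-- Take the top tree off the source stack: put it in reverse on `B` and its size on `N`. -/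
def scan (src : Reg) : Prog :=
  .seq (.push .N false) (.seq (.push .D false) (.seq (.push .D true) (.loop .D (scanBody src))))

/-- One round of nesting: the loop scans a tree and goes on with the depth `d`. That the rest of the
run is a hypothesis makes the induction on trees work, since a node is scanned by two such runs. -/
theorem scan_loop_A (x : Tr) {a b c d n : List Bool} {T : ℕ} {S : Store}
    (h : Ex (.loop .D (scanBody .A)) (st a (x.code.reverse ++ b) c d (ones x.size n)) T S) :
    Ex (.loop .D (scanBody .A)) (st (x.code ++ a) b c (true :: d) n) (6 * x.size + T) S := by
  induction x generalizing a b d n T with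
  | nil =>
    refine (Ex.loop_true rfl (update_st_D ..) (.pop_false rfl (update_st_A ..)
      (.seq (.push (update_st_B ..)) (.push (update_st_N ..)))) h).mono ?_
    simp only [Tr.size]
    omega
  | node l r hl hr =>
    have h' : Ex (.loop .D (scanBody .A)) (st a (r.code.reverse ++ (l.code.reverse ++ (true :: b)))
        c d (ones r.size (ones l.size (true :: n)))) T S := by
      rw [ones_ones, ones_cons, add_comm r.size]
      simpa [Tr.code, Tr.size] using h
    rw [Tr.code, List.cons_append, List.append_assoc]
    refine (Ex.loop_true rfl (update_st_D ..) (.pop_true rfl (update_st_A ..)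
      (.seq (.push (update_st_B ..)) (.seq (.push (update_st_N ..))
        (.seq (.push (update_st_D ..)) (.push (update_st_D ..)))))) (hl (hr h'))).mono ?_
    simp only [Tr.size]
    omega

theorem scan_loop_C (x : Tr) {a b c d n : List Bool} {T : ℕ} {S : Store}
    (h : Ex (.loop .D (scanBody .C)) (st a (x.code.reverse ++ b) c d (ones x.size n)) T S) :
    Ex (.loop .D (scanBody .C)) (st a b (x.code ++ c) (true :: d) n) (6 * x.size + T) S := by
  induction x generalizing c b d n T with
  | nil =>
    refine (Ex.loop_true rfl (update_st_D ..) (.pop_false rfl (update_st_C ..)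
      (.seq (.push (update_st_B ..)) (.push (update_st_N ..)))) h).mono ?_
    simp only [Tr.size]
    omega
  | node l r hl hr =>
    have h' : Ex (.loop .D (scanBody .C)) (st a (r.code.reverse ++ (l.code.reverse ++ (true :: b)))
        c d (ones r.size (ones l.size (true :: n)))) T S := by
      rw [ones_ones, ones_cons, add_comm r.size]
      simpa [Tr.code, Tr.size] using h
    rw [Tr.code, List.cons_append, List.append_assoc]
    refine (Ex.loop_true rfl (update_st_D ..) (.pop_true rfl (update_st_C ..)
      (.seq (.push (update_st_B ..)) (.seq (.push (update_st_N ..))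
        (.seq (.push (update_st_D ..)) (.push (update_st_D ..)))))) (hl (hr h'))).mono ?_
    simp only [Tr.size]
    omega

theorem scan_A (x : Tr) (a b c d n : List Bool) :
    Ex (scan .A) (st (x.code ++ a) b c d n) (6 * x.size + 4)
      (st a (x.code.reverse ++ b) c d (ones x.size (false :: n))) := by
  refine (Ex.seq (.push (update_st_N ..)) (.seq (.push (update_st_D ..))
    (.seq (.push (update_st_D ..)) (scan_loop_A x (.loop_false rfl (update_st_D ..)))))).mono ?_
  omega

theorem scan_C (x : Tr) (a b c d n : List Bool) :
    Ex (scan .C) (st a b (x.code ++ c) d n) (6 * x.size + 4)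
      (st a (x.code.reverse ++ b) c d (ones x.size (false :: n))) := by
  refine (Ex.seq (.push (update_st_N ..)) (.seq (.push (update_st_D ..))
    (.seq (.push (update_st_D ..)) (scan_loop_C x (.loop_false rfl (update_st_D ..)))))).mono ?_
  omega

/-- Push a bit on `A` and on `C`, as far as the flags say so. -/
def put (toA toC : Bool) (b : Bool) : Prog :=
  .seq (if toA then .push .A b else .skip) (if toC then .push .C b else .skip)

/-- Move the bits counted on `N` from `B` to the stacks that are flagged. -/
def restore (toA toC : Bool) : Prog :=
  .loop .N (.ifPop .B (put toA toC true) (put toA toC false))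

theorem put_st (toA toC e : Bool) (a b c d n : List Bool) :
    Ex (put toA toC e) (st a b c d n) 2
      (st (if toA then e :: a else a) b (if toC then e :: c else c) d n) := by
  refine Ex.seq (T := 1) (T' := 1) (S' := st (if toA then e :: a else a) b c d n) ?_ ?_
  · cases toA
    · exact .skip
    · exact .push (update_st_A ..)
  · cases toC
    · exact .skip
    · exact .push (update_st_C ..)

theorem restore_word (toA toC : Bool) (w : List Bool) (a b c d n : List Bool) :
    Ex (restore toA toC) (st a (w ++ b) c d (ones w.length (false :: n))) (4 * w.length + 1)
      (st (if toA then w.reverse ++ a else a) b (if toC then w.reverse ++ c else c) d n) := by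
  induction w generalizing a c with
  | nil => simpa [restore, ones] using Ex.loop_false rfl (update_st_N ..)
  | cons e w ih =>
    have h := ih (if toA then e :: a else a) (if toC then e :: c else c)
    have h' : Ex (.ifPop .B (put toA toC true) (put toA toC false))
        (st a (e :: w ++ b) c d (ones w.length (false :: n))) 3
        (st (if toA then e :: a else a) (w ++ b) (if toC then e :: c else c) d
          (ones w.length (false :: n))) := by
      cases e
      · exact .pop_false rfl (update_st_B ..) (put_st ..)
      · exact .pop_true rfl (update_st_B ..) (put_st ..)
    have h'' := Ex.loop_true (S := st a (e :: w ++ b) c d (ones (e :: w).length (false :: n)))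
      rfl (update_st_N ..) h' h
    refine Eq.mp ?_ (h''.mono (T' := 4 * (e :: w).length + 1) ?_)
    · cases toA <;> cases toC <;> simp [restore]
    · simp only [List.length_cons]
      omega

/-- Move the top tree of the source stack to the stacks that are flagged. -/
def move (src : Reg) (toA toC : Bool) : Prog := .seq (scan src) (restore toA toC)

theorem move_A (toA toC : Bool) (x : Tr) (a b c d n : List Bool) :
    Ex (move .A toA toC) (st (x.code ++ a) b c d n) (10 * x.size + 5)
      (st (if toA then x.code ++ a else a) b (if toC then x.code ++ c else c) d n) := by
  have h := restore_word toA toC x.code.reverse a b c d n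
  simp only [List.length_reverse, Tr.length_code, List.reverse_reverse] at h
  exact ((scan_A x a b c d n).seq h).mono (by omega)

theorem move_C (x : Tr) (a b c d n : List Bool) :
    Ex (move .C true false) (st a b (x.code ++ c) d n) (10 * x.size + 5)
      (st (x.code ++ a) b c d n) := by
  have h := restore_word true false x.code.reverse a b c d n
  simp only [List.length_reverse, Tr.length_code, List.reverse_reverse] at h
  exact ((scan_C x a b c d n).seq h).mono (by omega)

/-! ### Polynomial-time functions between types of trees -/

/-- Types whose elements are represented by trees. -/
class TEnc (α : Type) where
  /-- the representing tree -/
  enc : α → Tr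

open TEnc

/-- The size of the representing tree. -/
def sz {α : Type} [TEnc α] (x : α) : ℕ := (enc x).size

theorem sz_pos {α : Type} [TEnc α] (x : α) : 1 ≤ sz x := Tr.size_pos _

instance {α : Type} [TEnc α] {P : α → Prop} : TEnc {x // P x} := ⟨fun x => enc x.1⟩

instance {α β : Type} [TEnc α] [TEnc β] : TEnc (α × β) := ⟨fun x => .node (enc x.1) (enc x.2)⟩

/-- `f` is computed in polynomial time by a program that replaces the argument on top of `A` by
the value and otherwise leaves the store as it was; the size of the value is polynomially bounded,
too. -/
@[fun_prop]
def PTime {α β : Type} [TEnc α] [TEnc β] (f : α → β) : Prop :=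
  ∃ (p : Prog) (q : Polynomial ℕ), ∀ x, sz (f x) ≤ q.eval (sz x) ∧ ∀ a b c d n,
    Ex p (st ((enc x).code ++ a) b c d n) (q.eval (sz x)) (st ((enc (f x)).code ++ a) b c d n)

theorem eval_mono (q : Polynomial ℕ) {m n : ℕ} (h : m ≤ n) : q.eval m ≤ q.eval n := by
  induction q using Polynomial.induction_on' with
  | add p q hp hq =>
    rw [Polynomial.eval_add, Polynomial.eval_add]
    exact add_le_add hp hq
  | monomial k c =>
    rw [Polynomial.eval_monomial, Polynomial.eval_monomial]
    exact Nat.mul_le_mul_left _ (Nat.pow_le_pow_left h k)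

namespace PTime
variable {α β γ σ τ : Type} [TEnc α] [TEnc β] [TEnc γ] [TEnc σ] [TEnc τ]

theorem size_le {f : α → β} (hf : PTime f) : ∃ q : Polynomial ℕ, ∀ x, sz (f x) ≤ q.eval (sz x) := by
  obtain ⟨p, q, h⟩ := hf
  exact ⟨q, fun x => (h x).1⟩

/-- Functions with the same representation are the same to the programs. -/
theorem of_enc {f : α → β} (hf : PTime f) {g : α → γ} (h : ∀ x, enc (g x) = enc (f x)) :
    PTime g := by
  obtain ⟨p, q, hp⟩ := hf
  refine ⟨p, q, fun x => ?_⟩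
  rw [sz, h]
  exact hp x

@[fun_prop]
protected theorem id : PTime (fun x : α => x) :=
  ⟨.skip, Polynomial.X + 1, fun x => ⟨by simp, fun a b c d n => Ex.skip.mono (by simp)⟩⟩

@[fun_prop]
protected theorem comp {g : β → γ} {f : α → β} (hg : PTime g) (hf : PTime f) :
    PTime (fun x => g (f x)) := by
  obtain ⟨pf, qf, hf⟩ := hf
  obtain ⟨pg, qg, hg⟩ := hg
  refine ⟨.seq pf pg, qf + qg.comp qf, fun x => ?_⟩
  have h := eval_mono qg (hf x).1
  rw [Polynomial.eval_add, Polynomial.eval_comp]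
  exact ⟨(hg (f x)).1.trans (by omega), fun a b c d n =>
    (((hf x).2 a b c d n).seq ((hg (f x)).2 a b c d n)).mono (by omega)⟩

/-- Every constant is computed by pushing it. -/
@[fun_prop]
protected theorem const (y : β) : PTime (fun _ : α => y) := by
  have h : ∀ w : List Bool, ∃ p : Prog, ∀ a b c d n : List Bool,
      Ex p (st a b c d n) (w.length + 1) (st (w ++ a) b c d n) := by
    intro w
    induction w with
    | nil => exact ⟨.skip, fun a b c d n => .skip⟩
    | cons e w ih =>
      obtain ⟨p, hp⟩ := ih
      exact ⟨.seq p (.push .A e), fun a b c d n => (hp a b c d n).seq (.push (update_st_A ..))⟩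
  obtain ⟨p, hp⟩ := h (enc y).code
  refine ⟨.seq (move .A false false) p, 10 * Polynomial.X + Polynomial.C (sz y + 6), fun x => ?_⟩
  simp only [Polynomial.eval_add, Polynomial.eval_mul, Polynomial.eval_X, Polynomial.eval_C,
    Polynomial.eval_ofNat]
  refine ⟨by omega, fun a b c d n =>
    ((move_A false false (enc x) a b c d n).seq (hp _ _ _ _ _)).mono ?_⟩
  rw [Tr.length_code]
  simp only [sz]
  omega

@[fun_prop]
theorem pair {f : α → β} {g : α → γ} (hf : PTime f) (hg : PTime g) :
    PTime (fun x => (f x, g x)) := by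
  obtain ⟨pf, qf, hf⟩ := hf
  obtain ⟨pg, qg, hg⟩ := hg
  -- Save a copy of the argument, compute `g x`, bring back the copy, compute `f x` on top, and put
  -- the bit of a node in front of the two codes.
  refine ⟨.seq (move .A true true) (.seq pg (.seq (move .C true false) (.seq pf (.push .A true)))),
    20 * Polynomial.X + qf + qg + 20, fun x => ?_⟩
  simp only [Polynomial.eval_add, Polynomial.eval_mul, Polynomial.eval_X, Polynomial.eval_ofNat]
  refine ⟨?_, fun a b c d n => ?_⟩
  · have h₁ := (hf x).1
    have h₂ := (hg x).1
    simp only [sz, enc, Tr.size] at *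
    omega
  · have h := (move_A true true (enc x) a b c d n).seq
      (((hg x).2 a b ((enc x).code ++ c) d n).seq
        ((move_C (enc x) ((enc (g x)).code ++ a) b c d n).seq
          (((hf x).2 ((enc (g x)).code ++ a) b c d n).seq (.push (b := true) (update_st_A ..)))))
    refine Eq.mp ?_ (h.mono (T' := 20 * sz x + qf.eval (sz x) + qg.eval (sz x) + 20) ?_)
    · simp [enc, Tr.code]
    · simp only [sz]
      omega

/-- The left subtree of a value is computed in polynomial time. -/
theorem left {f : α → β} (hf : PTime f) {g : α → γ}
    (h : ∀ x, ∃ r, enc (f x) = .node (enc (g x)) r) : PTime g := by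
  obtain ⟨pf, qf, hf⟩ := hf
  refine ⟨.seq pf (.ifPop .A (.seq (move .A false true) (.seq (move .A false false)
    (move .C true false))) .skip), 40 * qf + 20, fun x => ?_⟩
  simp only [Polynomial.eval_add, Polynomial.eval_mul, Polynomial.eval_ofNat]
  obtain ⟨r, hr⟩ := h x
  have h₁ := (hf x).1
  have h₂ : sz (f x) = sz (g x) + r.size + 1 := by simp [sz, hr, Tr.size]
  refine ⟨by omega, fun a b c d n => ?_⟩
  have h₃ := (hf x).2 a b c d n
  rw [hr, Tr.code, List.cons_append, List.append_assoc] at h₃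
  refine (h₃.seq (.pop_true rfl (update_st_A ..) ((move_A false true ..).seq
    ((move_A false false ..).seq (move_C (enc (g x)) a b c d n))))).mono ?_
  simp only [sz] at *
  omega

/-- The right subtree of a value is computed in polynomial time. -/
theorem right {f : α → β} (hf : PTime f) {g : α → γ}
    (h : ∀ x, ∃ l, enc (f x) = .node l (enc (g x))) : PTime g := by
  obtain ⟨pf, qf, hf⟩ := hf
  refine ⟨.seq pf (.ifPop .A (move .A false false) .skip), 40 * qf + 20, fun x => ?_⟩
  simp only [Polynomial.eval_add, Polynomial.eval_mul, Polynomial.eval_ofNat]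
  obtain ⟨l, hl⟩ := h x
  have h₁ := (hf x).1
  have h₂ : sz (f x) = l.size + sz (g x) + 1 := by simp [sz, hl, Tr.size]
  refine ⟨by omega, fun a b c d n => ?_⟩
  have h₃ := (hf x).2 a b c d n
  rw [hl, Tr.code, List.cons_append, List.append_assoc] at h₃
  refine (h₃.seq (.pop_true rfl (update_st_A ..) (move_A false false ..))).mono ?_
  simp only [sz] at *
  omega

/-- Case distinction on whether the value of `c` is represented by a leaf. Each case has to be
treated only on the arguments where it occurs. -/
theorem cases_nil {c : α → τ} (hc : PTime c) {f : {x // enc (c x) = .nil} → γ}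
    {g : {x // enc (c x) ≠ .nil} → γ} {h : α → γ} (hf : PTime f) (hg : PTime g)
    (hhf : ∀ x, h x.1 = f x) (hhg : ∀ x, h x.1 = g x) : PTime h := by
  obtain ⟨pc, qc, hc⟩ := hc
  obtain ⟨pf, qf, hf⟩ := hf
  obtain ⟨pg, qg, hg⟩ := hg
  -- Once the bit of a node was popped, its two subtrees have to be thrown away.
  refine ⟨.seq (move .A true true) (.seq pc (.ifPop .A
    (.seq (move .A false false) (.seq (move .A false false) (.seq (move .C true false) pg)))
    (.seq (move .C true false) pf))), 40 * Polynomial.X + 20 * qc + qf + qg + 40, fun x => ?_⟩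
  simp only [Polynomial.eval_add, Polynomial.eval_mul, Polynomial.eval_X, Polynomial.eval_ofNat]
  have h₀ : ∀ a b c d n, _ := fun a b c' d n => (move_A true true (enc x) a b c' d n).seq
    ((hc x).2 a b ((enc x).code ++ c') d n)
  have h₁ := (hc x).1
  have h₂ := sz_pos x
  by_cases hx : enc (c x) = .nil
  · have h₃ := (hf ⟨x, hx⟩).1
    rw [← hhf ⟨x, hx⟩] at h₃
    change sz (h x) ≤ qf.eval (sz x) at h₃
    refine ⟨by omega, fun a b c' d n => ?_⟩
    have h₄ := (hf ⟨x, hx⟩).2 a b c' d n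
    rw [← hhf ⟨x, hx⟩] at h₄
    have h₅ := (hc x).2 a b ((enc x).code ++ c') d n
    rw [hx] at h₅
    refine ((move_A true true (enc x) a b c' d n).seq (h₅.seq (.pop_false rfl (update_st_A ..)
      ((move_C (enc x) a b c' d n).seq h₄)))).mono ?_
    change _ + (_ + (_ + qf.eval (sz x) + 1)) ≤ _
    simp only [sz] at *
    omega
  · have h₃ := (hg ⟨x, hx⟩).1
    rw [← hhg ⟨x, hx⟩] at h₃
    change sz (h x) ≤ qg.eval (sz x) at h₃
    refine ⟨by omega, fun a b c' d n => ?_⟩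
    have h₄ := (hg ⟨x, hx⟩).2 a b c' d n
    rw [← hhg ⟨x, hx⟩] at h₄
    have h₅ := (hc x).2 a b ((enc x).code ++ c') d n
    obtain ⟨l, r, hlr⟩ : ∃ l r, enc (c x) = .node l r := by
      cases h : enc (c x) with
      | nil => exact absurd h hx
      | node l r => exact ⟨l, r, rfl⟩
    rw [hlr, Tr.code, List.cons_append, List.append_assoc] at h₅
    have h₆ : sz (c x) = l.size + r.size + 1 := by simp [sz, hlr, Tr.size]
    refine ((move_A true true (enc x) a b c' d n).seq (h₅.seq (.pop_true rfl (update_st_A ..)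
      ((move_A false false ..).seq ((move_A false false ..).seq
        ((move_C (enc x) a b c' d n).seq h₄)))))).mono ?_
    change _ + (_ + (_ + (_ + (_ + qg.eval (sz x))) + 1)) ≤ _
    simp only [sz] at *
    omega

theorem iter_loop {g : σ → σ} {p : Prog} {q : Polynomial ℕ}
    (hg : ∀ s a b c d n, Ex p (st ((enc s).code ++ a) b c d n) (q.eval (sz s))
      (st ((enc (g s)).code ++ a) b c d n)) {M : ℕ} (w : List Bool) (s : σ)
    (hM : ∀ i ≤ w.length, q.eval (sz (g^[i] s)) ≤ M) (a b c d n : List Bool) :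
    Ex (.loop .N (.seq (.ifPop .B .skip .skip) p))
      (st ((enc s).code ++ a) (w ++ b) c d (ones w.length (false :: n)))
      (w.length * (M + 3) + 1) (st ((enc (g^[w.length] s)).code ++ a) b c d n) := by
  induction w generalizing s with
  | nil => exact (Ex.loop_false rfl (update_st_N ..)).mono (by simp)
  | cons e w ih =>
    have h := ih (g s) fun i hi => by
      simpa using hM (i + 1) (by simpa using hi)
    have h' : Ex (.ifPop .B .skip .skip)
        (st ((enc s).code ++ a) (e :: w ++ b) c d (ones w.length (false :: n))) 2
        (st ((enc s).code ++ a) (w ++ b) c d (ones w.length (false :: n))) := by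
      cases e
      · exact .pop_false rfl (update_st_B ..) .skip
      · exact .pop_true rfl (update_st_B ..) .skip
    have h₀ := hM 0 (by simp)
    refine (Ex.loop_true (S := st ((enc s).code ++ a) (e :: w ++ b) c d
      (ones (e :: w).length (false :: n))) rfl (update_st_N ..) (h'.seq (hg s ..)) h).mono ?_
    simp only [List.length_cons, Function.iterate_zero, id_eq] at *
    ring_nf
    omega

/-- Iterating a polynomial-time function as many times as the size of a value takes polynomial
time, provided that the iterates do not grow too much. -/
theorem iter {h : α → τ} {f : α → σ} {g : σ → σ} (hh : PTime h) (hf : PTime f) (hg : PTime g)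
    (B : Polynomial ℕ) (hB : ∀ x, ∀ i ≤ sz (h x), sz (g^[i] (f x)) ≤ B.eval (sz x)) :
    PTime (fun x => g^[sz (h x)] (f x)) := by
  obtain ⟨p, q, hp⟩ := hh.pair hf
  obtain ⟨pg, qg, hg⟩ := hg
  refine ⟨.seq p (.ifPop .A (.seq (scan .A) (.loop .N (.seq (.ifPop .B .skip .skip) pg))) .skip),
    B + 10 * q + q * (qg.comp B + 3) + 10, fun x => ?_⟩
  simp only [Polynomial.eval_add, Polynomial.eval_mul, Polynomial.eval_comp,
    Polynomial.eval_ofNat]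
  have h₁ := hB x _ le_rfl
  refine ⟨by omega, fun a b c d n => ?_⟩
  have h₂ := (hp x).2 a b c d n
  have h₃ : (enc (h x, f x)).code ++ a = true :: ((enc (h x)).code ++ ((enc (f x)).code ++ a)) := by
    simp [enc, Tr.code]
  rw [h₃] at h₂
  have h₄ := iter_loop (fun s => (hg s).2) (M := qg.eval (B.eval (sz x))) (enc (h x)).code.reverse
    (f x) (fun i hi => eval_mono _ (hB x i (by simpa [sz] using hi))) a b c d n
  simp only [List.length_reverse, Tr.length_code] at h₄
  refine (h₂.seq (.pop_true rfl (update_st_A ..) ((scan_A ..).seq h₄))).mono ?_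
  have h₅ : sz (h x) ≤ q.eval (sz x) := by
    refine le_trans ?_ (hp x).1
    simp only [sz, enc, Tr.size]
    omega
  have h₆ := Nat.mul_le_mul_right (qg.eval (B.eval (sz x)) + 3) h₅
  simp only [sz] at *
  omega

end PTime

/-! ### Encodings of the basic types -/

instance : TEnc ℕ := ⟨fun n => n.rec .nil fun _ x => .node .nil x⟩

/-- Types that are listed, up to junk values, by an initial segment of the natural numbers; their
elements are represented by their number in unary. -/
class FinTy (α : Type) where
  /-- the number of an element -/
  idx : α → ℕ
  /-- the element with a given number -/
  ofIdx : ℕ → α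
  /-- a bound for the numbers -/
  card : ℕ
  idx_lt : ∀ x, idx x < card
  ofIdx_idx : ∀ x, ofIdx (idx x) = x

instance {α : Type} [FinTy α] : TEnc α := ⟨fun x => enc (FinTy.idx x)⟩

instance : FinTy Bool where
  idx b := bif b then 1 else 0
  ofIdx n := n == 1
  card := 2
  idx_lt b := by cases b <;> simp
  ofIdx_idx b := by cases b <;> rfl

instance {α : Type} [TEnc α] : TEnc (List α) := ⟨fun l => l.rec .nil fun x _ y => .node (enc x) y⟩

instance {α : Type} [TEnc α] : TEnc (Option α) := ⟨fun o => o.elim .nil fun x => .node (enc x) .nil⟩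

section
variable {α β : Type} [TEnc α] [TEnc β]

@[simp] theorem sz_nil : sz ([] : List α) = 1 := rfl

@[simp] theorem sz_cons (x : α) (l : List α) : sz (x :: l) = sz x + sz l + 1 := rfl

@[simp] theorem sz_none : sz (none : Option α) = 1 := rfl

@[simp] theorem sz_some (x : α) : sz (some x) = sz x + 2 := rfl

@[simp] theorem sz_pair (x : α) (y : β) : sz (x, y) = sz x + sz y + 1 := rfl

theorem sz_append (l l' : List α) : sz (l ++ l') + 1 = sz l + sz l' := by
  induction l with
  | nil => simp [add_comm]
  | cons x l ih => simp only [List.cons_append, sz_cons]; omega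

theorem sz_reverse (l : List α) : sz l.reverse = sz l := by
  induction l with
  | nil => rfl
  | cons x l ih =>
    have := sz_append l.reverse [x]
    simp only [List.reverse_cons, sz_cons, sz_nil] at *
    omega

theorem sz_le_of_sublist {l l' : List α} (h : l.Sublist l') : sz l ≤ sz l' := by
  induction h with
  | slnil => exact le_rfl
  | cons x _ ih => simp only [sz_cons]; omega
  | cons_cons x _ ih => simp only [sz_cons]; omega

theorem length_le_sz (l : List α) : 2 * l.length + 1 ≤ sz l := by
  induction l with
  | nil => exact le_rfl
  | cons x l ih =>
    have := sz_pos x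
    simp only [List.length_cons, sz_cons]
    omega

theorem sz_le_of_mem {x : α} {l : List α} (h : x ∈ l) : sz x ≤ sz l := by
  induction h with
  | head => simp only [sz_cons]; omega
  | tail _ _ ih => simp only [sz_cons]; omega

theorem sz_le_of_forall {l : List α} {M : ℕ} (h : ∀ x ∈ l, sz x ≤ M) :
    sz l ≤ l.length * (M + 1) + 1 := by
  induction l with
  | nil => simp
  | cons x l ih =>
    have h₁ := h x (by simp)
    have h₂ := ih fun y hy => h y (by simp [hy])
    simp only [sz_cons, List.length_cons]
    ring_nf at *
    omega

end

/-! ### Closure properties of polynomial-time functions -/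

/-- Case distinction on a list. -/
def lcase {β γ : Type} (l : List β) (z : γ) (s : β → List β → γ) : γ :=
  match l with
  | [] => z
  | b :: t => s b t

/-- Case distinction on an option. -/
def ocase {β γ : Type} (o : Option β) (z : γ) (s : β → γ) : γ :=
  match o with
  | none => z
  | some b => s b

@[simp] theorem lcase_nil {β γ : Type} (z : γ) (s : β → List β → γ) : lcase [] z s = z := rfl
@[simp] theorem lcase_cons {β γ : Type} (b : β) (t : List β) (z : γ) (s : β → List β → γ) :
    lcase (b :: t) z s = s b t := rfl
@[simp] theorem ocase_none {β γ : Type} (z : γ) (s : β → γ) : ocase none z s = z := rfl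
@[simp] theorem ocase_some {β γ : Type} (b : β) (z : γ) (s : β → γ) :
    ocase (some b) z s = s b := rfl

namespace PTime
variable {α β γ σ τ : Type} [TEnc α] [TEnc β] [TEnc γ] [TEnc σ] [TEnc τ]

@[fun_prop]
theorem fst {f : α → β × γ} (hf : PTime f) : PTime (fun x => (f x).1) :=
  hf.left fun x => ⟨enc (f x).2, rfl⟩

@[fun_prop]
theorem snd {f : α → β × γ} (hf : PTime f) : PTime (fun x => (f x).2) :=
  hf.right fun x => ⟨enc (f x).1, rfl⟩

@[fun_prop]
theorem val {P : α → Prop} {f : β → {x // P x}} (hf : PTime f) : PTime (fun x => (f x).1) :=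
  hf.of_enc fun _ => rfl

@[fun_prop]
theorem cons {f : α → β} {l : α → List β} (hf : PTime f) (hl : PTime l) :
    PTime (fun x => f x :: l x) :=
  (hf.pair hl).of_enc fun _ => rfl

@[fun_prop]
theorem mk_some {f : α → β} (hf : PTime f) : PTime (fun x => some (f x)) :=
  (hf.pair (PTime.const ([] : List Bool))).of_enc fun _ => rfl

@[fun_prop]
protected theorem lcase {l : α → List β} {z : α → γ} {s : α → β → List β → γ} (hl : PTime l)
    (hz : PTime z) (hs : PTime (fun q : α × β × List β => s q.1 q.2.1 q.2.2)) :
    PTime (fun x => lcase (l x) (z x) (s x)) := by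
  have h : ∀ x : {x // enc (l x) ≠ .nil}, ∃ b t, l x.1 = b :: t := by
    rintro ⟨x, hx⟩
    cases hl : l x with
    | nil => exact absurd (congrArg enc hl) hx
    | cons b t => exact ⟨b, t, rfl⟩
  choose b t hbt using h
  have hv : PTime (fun x : {x // enc (l x) ≠ .nil} => l x.1) := by fun_prop
  have hb : PTime b := hv.left fun x => ⟨enc (t x), by rw [hbt]; rfl⟩
  have ht : PTime t := hv.right fun x => ⟨enc (b x), by rw [hbt]; rfl⟩
  refine cases_nil hl (f := fun x => z x.1) (g := fun x => s x.1 (b x) (t x))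
    (by fun_prop) (hs.comp (f := fun x => (x.1, b x, t x)) (by fun_prop)) ?_ ?_
  · rintro ⟨x, hx⟩
    cases hl : l x with
    | nil => rw [lcase_nil]
    | cons b t => rw [hl] at hx; cases hx
  · intro x
    rw [hbt, lcase_cons]

@[fun_prop]
protected theorem ocase {o : α → Option β} {z : α → γ} {s : α → β → γ} (ho : PTime o) (hz : PTime z)
    (hs : PTime (fun q : α × β => s q.1 q.2)) : PTime (fun x => ocase (o x) (z x) (s x)) := by
  have hl : PTime (fun x => (o x).toList) := ho.of_enc fun x => by cases o x <;> rfl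
  have h : PTime (fun x => lcase (o x).toList (z x) fun b _ => s x b) :=
    PTime.lcase hl hz (hs.comp (f := fun q : α × β × List β => (q.1, q.2.1)) (by fun_prop))
  convert h using 2 with x
  cases o x <;> rfl

theorem cases_nat {n : α → ℕ} (hn : PTime n) {K : ℕ} (hK : ∀ x, n x < K) {f : ℕ → α → γ}
    (hf : ∀ k, PTime (f k)) : PTime (fun x => f (n x) x) := by
  induction K generalizing α f with
  | zero =>
    convert hf 0 using 2 with x
    exact absurd (hK x) (by simp)
  | succ K ih =>
    have h : ∀ x : {x // enc (n x) ≠ .nil}, n x.1 = n x.1 - 1 + 1 := by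
      rintro ⟨x, hx⟩
      cases hn : n x with
      | zero => exact absurd (congrArg enc hn) hx
      | succ k => rfl
    have hm : PTime (fun x : {x // enc (n x) ≠ .nil} => n x.1 - 1) := by
      refine (hn.comp (f := fun x : {x // enc (n x) ≠ .nil} => x.1) (by fun_prop)).right
        fun x => ⟨.nil, ?_⟩
      conv_lhs => rw [h]
      rfl
    have h₁ := ih (f := fun k x => f (k + 1) x.1) hm
      (fun x => by have := hK x.1; have := h x; omega)
      (fun k => (hf (k + 1)).comp (by fun_prop))
    refine cases_nil hn (f := fun x => f 0 x.1) ((hf 0).comp (by fun_prop)) h₁ ?_ ?_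
    · rintro ⟨x, hx⟩
      cases hn : n x with
      | zero => rfl
      | succ k => rw [hn] at hx; cases hx
    · intro x
      exact congrArg (fun k => f k x.1) (h x)

/-- Case distinction on an element of a finite type. -/
theorem cases_fin {ρ : Type} [FinTy ρ] {g : α → ρ} (hg : PTime g) {f : ρ → α → γ}
    (hf : ∀ k, PTime (f k)) : PTime (fun x => f (g x) x) := by
  have h := cases_nat (n := fun x => FinTy.idx (g x)) (hg.of_enc fun x => rfl)
    (fun x => FinTy.idx_lt (g x)) (f := fun k => f (FinTy.ofIdx k)) fun k => hf _
  simpa only [FinTy.ofIdx_idx] using h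

/-- A function on a finite type. -/
theorem of_fin {ρ : Type} [FinTy ρ] (f : ρ → γ) {g : α → ρ} (hg : PTime g) :
    PTime (fun x => f (g x)) :=
  cases_fin hg (f := fun k _ => f k) fun k => by fun_prop

@[fun_prop]
theorem cond {c : α → Bool} {f g : α → γ} (hc : PTime c) (hf : PTime f) (hg : PTime g) :
    PTime (fun x => bif c x then f x else g x) :=
  cases_fin hc (f := fun b x => bif b then f x else g x) fun b => by cases b <;> assumption

@[fun_prop]
theorem and {f g : α → Bool} (hf : PTime f) (hg : PTime g) : PTime (fun x => f x && g x) := by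
  convert hf.cond hg (PTime.const false) using 2 with x
  cases f x <;> rfl

@[fun_prop]
theorem or {f g : α → Bool} (hf : PTime f) (hg : PTime g) : PTime (fun x => f x || g x) := by
  convert hf.cond (PTime.const true) hg using 2 with x
  cases f x <;> rfl

@[fun_prop]
theorem not {f : α → Bool} (hf : PTime f) : PTime (fun x => !f x) := of_fin _ hf

/-- A fold over a list whose intermediate values stay polynomially bounded. -/
theorem foldl {l : α → List β} {z : α → σ} {s : α → σ → β → σ} (hl : PTime l) (hz : PTime z)
    (hs : PTime (fun q : α × σ × β => s q.1 q.2.1 q.2.2)) (B : Polynomial ℕ)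
    (hB : ∀ x l', l' <+: l x → sz (l'.foldl (s x) (z x)) ≤ B.eval (sz x)) :
    PTime (fun x => (l x).foldl (s x) (z x)) := by
  let g : α × List β × σ → α × List β × σ := fun q =>
    lcase q.2.1 q fun b t => (q.1, t, s q.1 q.2.2 b)
  have hg : PTime g := PTime.lcase (by fun_prop) (by fun_prop)
    (.pair (by fun_prop) (.pair (by fun_prop) (hs.comp
      (f := fun q : (α × List β × σ) × β × List β => (q.1.1, q.1.2.2, q.2.1)) (by fun_prop))))
  have hi : ∀ x i, g^[i] (x, l x, z x) =
      (x, (l x).drop i, ((l x).take i).foldl (s x) (z x)) := by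
    intro x i
    induction i with
    | zero => simp
    | succ i ih =>
      rw [Function.iterate_succ_apply', ih]
      cases h : (l x).drop i with
      | nil =>
        have h' := List.drop_eq_nil_iff.1 h
        simp [g, List.take_of_length_le h', List.take_of_length_le (h'.trans (Nat.le_succ i)),
          List.drop_of_length_le (h'.trans (Nat.le_succ i))]
      | cons b t =>
        have h' : i < (l x).length := by
          by_contra hc
          rw [List.drop_of_length_le (by omega)] at h
          cases h
        rw [List.drop_eq_getElem_cons h'] at h
        injection h with h₁ h₂
        rw [List.take_succ_eq_append_getElem h']
        simp [g, h₁, h₂, List.foldl_append]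
  obtain ⟨ql, hql⟩ := hl.size_le
  have h := iter hl (f := fun x => (x, l x, z x)) (by fun_prop) hg (Polynomial.X + ql + B + 2)
    (fun x i _ => by
      rw [hi]
      have h₁ := hB x _ (List.take_prefix i (l x))
      have h₂ := sz_le_of_sublist (List.drop_sublist i (l x))
      have h₃ := hql x
      simp only [sz_pair, Polynomial.eval_add, Polynomial.eval_X, Polynomial.eval_ofNat]
      omega)
  convert h.snd.snd using 2 with x
  rw [hi, List.take_of_length_le]
  have := length_le_sz (l x)
  omega

@[fun_prop]
theorem reverse {l : α → List β} (hl : PTime l) : PTime (fun x => (l x).reverse) := by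
  obtain ⟨q, hq⟩ := hl.size_le
  have h : ∀ l : List β, l.foldl (fun t b => b :: t) [] = l.reverse := by
    intro l
    rw [List.foldl_eq_foldr_reverse]
    simp
  simp only [← h]
  refine foldl hl (by fun_prop) (by fun_prop) q fun x l' hl' => ?_
  rw [h, sz_reverse]
  exact (sz_le_of_sublist hl'.sublist).trans (hq x)

@[fun_prop]
theorem append {l l' : α → List β} (hl : PTime l) (hl' : PTime l') :
    PTime (fun x => l x ++ l' x) := by
  obtain ⟨q, hq⟩ := hl.size_le
  obtain ⟨q', hq'⟩ := hl'.size_le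
  have h : ∀ l l' : List β, l.foldl (fun t b => b :: t) l' = l.reverse ++ l' := by
    intro l l'
    rw [List.foldl_eq_foldr_reverse]
    simp
  have h' : ∀ x, l x ++ l' x = (l x).reverse.foldl (fun t b => b :: t) (l' x) := by
    simp [h]
  simp only [h']
  refine foldl hl.reverse (by fun_prop) (by fun_prop) (q + q') fun x l'' h'' => ?_
  have h₁ := sz_append l''.reverse (l' x)
  have h₂ := sz_le_of_sublist h''.sublist
  have h₃ := hq x
  have h₄ := hq' x
  rw [sz_reverse] at *
  rw [h, Polynomial.eval_add]
  omega

@[fun_prop]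
theorem map {l : α → List β} {f : α → β → γ} (hl : PTime l)
    (hf : PTime (fun q : α × β => f q.1 q.2)) : PTime (fun x => (l x).map (f x)) := by
  obtain ⟨q, hq⟩ := hl.size_le
  obtain ⟨r, hr⟩ := hf.size_le
  have h : ∀ x (l : List β), l.foldl (fun t b => f x b :: t) [] = (l.map (f x)).reverse := by
    intro x l
    induction l using List.reverseRecOn with
    | nil => rfl
    | append_singleton l b ih => simp [List.foldl_append, ih]
  have h' : ∀ x, (l x).map (f x) = ((l x).foldl (fun t b => f x b :: t) []).reverse := by
    simp [h]
  simp only [h']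
  refine reverse (foldl hl (by fun_prop) (.cons (hf.comp
    (f := fun q : α × List γ × β => (q.1, q.2.2)) (by fun_prop)) (by fun_prop))
    (q * (r.comp (Polynomial.X + q + 1) + 1) + 1) fun x l' hl' => ?_)
  rw [h, sz_reverse]
  have h₁ : ∀ y ∈ l'.map (f x), sz y ≤ r.eval (sz x + q.eval (sz x) + 1) := by
    intro y hy
    obtain ⟨b, hb, rfl⟩ := List.mem_map.1 hy
    refine (hr (x, b)).trans (eval_mono r ?_)
    have h₂ := (sz_le_of_mem (hl'.sublist.subset hb)).trans (hq x)
    simp only [sz_pair]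
    omega
  refine (sz_le_of_forall h₁).trans ?_
  simp only [Polynomial.eval_add, Polynomial.eval_mul, Polynomial.eval_comp, Polynomial.eval_X,
    Polynomial.eval_one, List.length_map]
  have h₃ := length_le_sz l'
  have h₄ := (sz_le_of_sublist hl'.sublist).trans (hq x)
  gcongr
  omega

@[fun_prop]
theorem flatten {l : α → List (List β)} (hl : PTime l) : PTime (fun x => (l x).flatten) := by
  obtain ⟨q, hq⟩ := hl.size_le
  have h : ∀ l : List (List β), l.foldl (fun t b => t ++ b) [] = l.flatten := by
    intro l
    induction l using List.reverseRecOn with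
    | nil => rfl
    | append_singleton l b ih => simp [List.foldl_append, ih]
  have h' : ∀ l : List (List β), sz l.flatten ≤ sz l := by
    intro l
    induction l with
    | nil => exact le_rfl
    | cons b l ih =>
      have := sz_append b l.flatten
      simp only [List.flatten_cons, sz_cons]
      omega
  simp only [← h]
  refine foldl hl (by fun_prop) (by fun_prop) q fun x l' hl' => ?_
  rw [h]
  exact (h' l').trans ((sz_le_of_sublist hl'.sublist).trans (hq x))

@[fun_prop]
theorem filter {l : α → List β} {f : α → β → Bool} (hl : PTime l)
    (hf : PTime (fun q : α × β => f q.1 q.2)) : PTime (fun x => (l x).filter (f x)) := by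
  have h : ∀ x, (l x).filter (f x) =
      ((l x).map fun b => bif f x b then [b] else []).flatten := by
    intro x
    induction l x with
    | nil => rfl
    | cons b l ih => cases h : f x b <;> simp [h, ih]
  simp only [h]
  fun_prop

@[fun_prop]
theorem all {l : α → List β} {f : α → β → Bool} (hl : PTime l)
    (hf : PTime (fun q : α × β => f q.1 q.2)) : PTime (fun x => (l x).all (f x)) := by
  have h : ∀ x, (l x).all (f x) =
      lcase ((l x).filter fun b => !f x b) true fun _ _ => false := by
    intro x
    induction l x with
    | nil => rfl
    | cons b l ih => cases h : f x b <;> simp [h, ih]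
  simp only [h]
  fun_prop

@[fun_prop]
theorem any {l : α → List β} {f : α → β → Bool} (hl : PTime l)
    (hf : PTime (fun q : α × β => f q.1 q.2)) : PTime (fun x => (l x).any (f x)) := by
  have h : ∀ x, (l x).any (f x) = !(l x).all fun b => !f x b := by
    intro x
    simp [List.any_eq_not_all_not]
  simp only [h]
  fun_prop

@[fun_prop]
theorem tail {l : α → List β} (hl : PTime l) : PTime (fun x => (l x).tail) := by
  have h : ∀ x, (l x).tail = lcase (l x) [] fun _ t => t := by
    intro x
    cases l x <;> rfl
  simp only [h]
  fun_prop

@[fun_prop]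
theorem head? {l : α → List β} (hl : PTime l) : PTime (fun x => (l x).head?) := by
  have h : ∀ x, (l x).head? = lcase (l x) none fun b _ => some b := by
    intro x
    cases l x <;> rfl
  simp only [h]
  fun_prop

end PTime

/-! ### Deciding equality -/

/-- Equality as a Boolean. -/
def eqb {α : Type} [DecidableEq α] (x y : α) : Bool := decide (x = y)

@[simp] theorem eqb_iff {α : Type} [DecidableEq α] {x y : α} : eqb x y = true ↔ x = y := by
  simp [eqb]

/-- Types where equality is decided in polynomial time. -/
class PEq (α : Type) [TEnc α] [DecidableEq α] : Prop where
  eqb : PTime (fun q : α × α => eqb q.1 q.2)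

@[fun_prop]
theorem PTime.eqb {α β : Type} [TEnc α] [TEnc β] [DecidableEq β] [PEq β] {f g : α → β}
    (hf : PTime f) (hg : PTime g) : PTime (fun x => eqb (f x) (g x)) :=
  PEq.eqb.comp (hf.pair hg)

instance {α : Type} [FinTy α] [DecidableEq α] : PEq α :=
  ⟨PTime.cases_fin (g := fun q : α × α => q.1) (by fun_prop) (f := fun k q => eqb k q.2)
    fun k => PTime.of_fin _ (by fun_prop)⟩

instance {α : Type} [TEnc α] [DecidableEq α] [PEq α] : PEq (List α) := by
  -- Folding over the first list, remove equal heads from the second one.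
  let s : Option (List α) → α → Option (List α) := fun o b =>
    ocase o none fun l => lcase l none fun b' t => bif eqb b b' then some t else none
  have hs : ∀ l l' : List α, (∀ r, l.foldl s (some l') = some r ↔ l' = l ++ r) := by
    intro l
    have hn : ∀ l : List α, l.foldl s none = none := by
      intro l
      induction l with
      | nil => rfl
      | cons b l ih => exact ih
    induction l with
    | nil => simp
    | cons b l ih =>
      intro l' r
      cases l' with
      | nil => simp [s, hn]
      | cons b' t =>
        by_cases h : b = b'
        · subst h
          have h₁ : s (some (b :: t)) b = some t := by simp [s, eqb]
          simp [h₁, ih]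
        · have h₁ : s (some (b' :: t)) b = none := by simp [s, eqb, h]
          simp [h₁, hn, Ne.symm h]
  have h : ∀ q : List α × List α, eqb q.1 q.2 =
      ocase (q.1.foldl s (some q.2)) false fun r => lcase r true fun _ _ => false := by
    rintro ⟨l, l'⟩
    have h₁ := hs l l'
    rw [Bool.eq_iff_iff, eqb_iff]
    cases h : l.foldl s (some l') with
    | none =>
      have := h₁ []
      simp only [h, List.append_nil] at this
      simp only [ocase_none]
      constructor
      · intro he
        exact absurd (this.2 he.symm) (by simp)
      · simp
    | some r =>
      have := (h₁ r).1 h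
      cases r with
      | nil => simpa using this.symm
      | cons => simp [this]
  constructor
  simp only [h]
  refine .ocase (.foldl (by fun_prop) (by fun_prop) (by fun_prop) (Polynomial.X + 2) ?_)
    (by fun_prop) (by fun_prop)
  rintro ⟨l, l'⟩ l₁ -
  cases h : l₁.foldl s (some l') with
  | none => simp
  | some r =>
    have h₁ := (hs l₁ l' r).1 h
    have h₂ := sz_append l₁ r
    have h₃ := sz_pos l₁
    rw [← h₁] at h₂
    simp only [sz_some, sz_pair, Polynomial.eval_add, Polynomial.eval_X, Polynomial.eval_ofNat]
    omega

/-! ### Reading strings -/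

deriving instance DecidableEq for Letter

/-- The letters of the alphabet. -/
def letters : List Letter :=
  [.mark, .bit false, .bit true, .lbrace, .rbrace, .lpar, .rpar, .comma, .neg, .imp, .K, .C, .D,
    .E, .F, .plus, .minus, .eq, .equiv]

theorem mem_letters (c : Letter) : c ∈ letters := by
  rcases c with _ | b | _ | _ | _ | _ | _ | _ | _ | _ | _ | _ | _ | _ | _ | _ | _ | _ <;>
    try cases b
  all_goals decide

instance : FinTy Letter where
  idx c := letters.idxOf c
  ofIdx n := letters.getD n .mark
  card := letters.length
  idx_lt c := List.idxOf_lt_length_iff.2 (mem_letters c)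
  ofIdx_idx c := by
    rw [List.getD_eq_getElem _ _ (List.idxOf_lt_length_iff.2 (mem_letters c)), List.getElem_idxOf]

instance : Fintype Letter := ⟨letters.toFinset, fun c => List.mem_toFinset.2 (mem_letters c)⟩

/-- One round of a reading loop: `e` reads an element off the remaining string, if possible. -/
def loopStep {β : Type} (e : List Letter → Option (β × List Letter))
    (q : List β × List Letter) : List β × List Letter :=
  ocase (e q.2) q fun r => (r.1 :: q.1, r.2)

/-- Read elements as long as possible. -/
def many {β : Type} (e : List Letter → Option (β × List Letter)) (s : List Letter) :
    List β × List Letter :=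
  (((loopStep e)^[sz s] ([], s)).1.reverse, ((loopStep e)^[sz s] ([], s)).2)

theorem many_inv {β : Type} [TEnc β] {e : List Letter → Option (β × List Letter)}
    (he : ∀ s q, e s = some q → q.2 <:+ s) {M : ℕ} {s : List Letter}
    (hM : ∀ s' q, s' <:+ s → e s' = some q → sz q.1 ≤ M) (i : ℕ) :
    ((loopStep e)^[i] ([], s)).2 <:+ s ∧
      sz ((loopStep e)^[i] ([], s)).1 ≤ i * (M + 1) + 1 := by
  induction i with
  | zero => simp
  | succ i ih =>
    rw [Function.iterate_succ_apply', loopStep]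
    obtain ⟨h₁, h₂⟩ := ih
    cases h : e ((loopStep e)^[i] ([], s)).2 with
    | none =>
      rw [ocase_none]
      exact ⟨h₁, h₂.trans (by gcongr; omega)⟩
    | some q =>
      rw [ocase_some]
      refine ⟨(he _ _ h).trans h₁, ?_⟩
      have := hM _ _ h₁ h
      rw [sz_cons, add_mul]
      omega

theorem many_suffix {β : Type} [TEnc β] {e : List Letter → Option (β × List Letter)}
    (he : ∀ s q, e s = some q → q.2 <:+ s) (s : List Letter) : (many e s).2 <:+ s := by
  unfold many
  generalize sz s = n
  induction n with
  | zero => simp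
  | succ n ih =>
    rw [Function.iterate_succ_apply', loopStep]
    dsimp only at ih ⊢
    cases h : e ((loopStep e)^[n] ([], s)).2 with
    | none => exact ih
    | some q => exact (he _ _ h).trans ih

theorem ptime_many {β : Type} [TEnc β] {e : List Letter → Option (β × List Letter)}
    (he : ∀ s q, e s = some q → q.2 <:+ s) (hp : PTime e) : PTime (many e) := by
  obtain ⟨r, hr⟩ := hp.size_le
  have h := PTime.iter (h := fun s : List Letter => s) (f := fun s => (([] : List β), s))
    (g := loopStep e) (by fun_prop) (by fun_prop) (by unfold loopStep; fun_prop)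
    (Polynomial.X * (r + 1) + Polynomial.X + 2) (fun s i hi => by
      have h := many_inv he (M := r.eval (sz s)) (s := s) (fun s' q hs' hq => by
        have h₁ := hr s'
        have h₂ := eval_mono r (sz_le_of_sublist hs'.sublist)
        rw [hq, sz_some, sz, enc, instTEncProd, Tr.size] at h₁
        unfold sz
        unfold sz at h₁ h₂
        omega) i
      have h₁ := sz_le_of_sublist h.1.sublist
      have h₂ := h.2
      have h₃ := Nat.mul_le_mul_right (r.eval (sz s) + 1) hi
      simp only [Polynomial.eval_add, Polynomial.eval_mul, Polynomial.eval_X, Polynomial.eval_one,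
        Polynomial.eval_ofNat]
      change sz _ + sz _ + 1 ≤ _
      omega)
  unfold many
  fun_prop

/-- If `u` lists the elements of a list in front of a remainder in such a way that `e` reads them
one by one, then `many` reads the whole list. -/
theorem many_eq {β : Type} {e : List Letter → Option (β × List Letter)} (u : List β → List Letter)
    (hu : ∀ x l, e (u (x :: l)) = some (x, u l)) (h₀ : e (u []) = none) (l : List β)
    (hl : l.length ≤ (u l).length) : many e (u l) = (l, u []) := by
  have h : ∀ (l : List β) (n : ℕ) (a : List β), l.length ≤ n →
      (loopStep e)^[n] (a, u l) = (l.reverse ++ a, u []) := by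
    intro l
    induction l with
    | nil =>
      intro n a _
      exact Function.iterate_fixed (by simp [loopStep, h₀]) n
    | cons x l ih =>
      intro n a hn
      obtain ⟨n, rfl⟩ : ∃ k, n = k + 1 := ⟨n - 1, by simp at hn; omega⟩
      rw [Function.iterate_succ_apply, loopStep, hu, ocase_some, ih n _ (by simpa using hn)]
      simp
  have h₁ := length_le_sz (u l)
  rw [many, h l _ _ (by omega)]
  simp

-- Proofs of polynomial time are to stop at `many`, whose iteration needs a bound for its values.
attribute [irreducible] many

/-- A reader: a polynomial-time function that takes an element off the front of a string. It is
required to work only on strings that begin with an element in the given notation and where no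
bit follows that could be mistaken for a part of it. -/
structure Reader {β : Type} [TEnc β] (write : β → List Letter)
    (p : List Letter → β × List Letter) : Prop where
  ptime : PTime p
  suffix : ∀ s, (p s).2 <:+ s
  read : ∀ x r, (∀ b, r.head? ≠ some (.bit b)) → p (write x ++ r) = (x, r)

/-- The bit that a letter stands for. -/
def bitOf : Letter → Option Bool
  | .bit b => some b
  | _ => none

@[fun_prop]
theorem PTime.bitOf {α : Type} [TEnc α] {f : α → Letter} (hf : PTime f) :
    PTime (fun x => bitOf (f x)) := of_fin _ hf

/-- Read a bit. -/
def readBit (s : List Letter) : Option (Bool × List Letter) :=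
  lcase s none fun c t => ocase (bitOf c) none fun b => some (b, t)

/-- Read a name. -/
def readName (s : List Letter) : Name × List Letter := many readBit s.tail

theorem reader_name : Reader nameStr readName := by
  have h : ∀ s q, readBit s = some q → q.2 <:+ s := by
    intro s q hq
    rcases s with _ | ⟨c, t⟩
    · simp [readBit] at hq
    · cases hc : bitOf c with
      | none => simp [readBit, hc] at hq
      | some b =>
        simp only [readBit, hc, lcase_cons, ocase_some, Option.some.injEq] at hq
        subst hq
        exact List.suffix_cons c t
  refine ⟨?_, fun s => (many_suffix h _).trans (List.tail_suffix s), fun x r hr => ?_⟩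
  · have := ptime_many h (by unfold readBit; fun_prop)
    unfold readName
    fun_prop
  · rw [readName, nameStr, List.cons_append, List.tail_cons]
    refine many_eq (e := readBit) (fun l => l.map .bit ++ r)
      (fun b l => by simp [readBit, bitOf]) ?_ x (by simp)
    cases r with
    | nil => simp [readBit]
    | cons c t =>
      have h₀ : bitOf c = none := by
        cases c with
        | bit b => exact absurd rfl (hr b)
        | _ => rfl
      simp [readBit, h₀]

@[fun_prop]
theorem PTime.readName {α : Type} [TEnc α] {f : α → List Letter} (hf : PTime f) :
    PTime fun x => readName (f x) := reader_name.ptime.comp hf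

/-- Read an element of a listing, after a comma. -/
def readItem {β : Type} (p : List Letter → β × List Letter) (s : List Letter) :
    Option (β × List Letter) :=
  lcase s none fun c t => bif eqb c .comma then some (p t) else none

/-- Read a listing. -/
def readList {β : Type} (p : List Letter → β × List Letter) (s : List Letter) :
    List β × List Letter :=
  bif eqb s.tail.head? (some .rbrace) then ([], s.tail.tail)
  else ((many (readItem p) (.comma :: s.tail)).1, (many (readItem p) (.comma :: s.tail)).2.tail)

instance {α : Type} [TEnc α] [DecidableEq α] [PEq α] : PEq (Option α) := by
  constructor
  have h : ∀ q : Option α × Option α, eqb q.1 q.2 =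
      ocase q.1 (ocase q.2 true fun _ => false) fun x => ocase q.2 false fun y => eqb x y := by
    rintro ⟨_ | x, _ | y⟩ <;> simp [eqb]
  simp only [h]
  fun_prop

theorem comma_intercalate (x : List Letter) (xs : List (List Letter)) :
    .comma :: List.intercalate [.comma] (x :: xs) = (x :: xs).flatMap fun y => .comma :: y := by
  induction xs generalizing x with
  | nil => simp [List.intercalate]
  | cons y xs ih =>
    rw [List.flatMap_cons, ← ih y]
    simp [List.intercalate]

theorem listStr_cons (x : List Letter) (xs : List (List Letter)) :
    listStr (x :: xs) =
      .lbrace :: (((x :: xs).flatMap fun y => .comma :: y).tail ++ [.rbrace]) := by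
  rw [← comma_intercalate]
  simp [listStr]

theorem tail_suffix_of_suffix_cons {c : Letter} {s t : List Letter} (h : s <:+ c :: t) :
    s.tail <:+ t := by
  rcases List.suffix_cons_iff.1 h with rfl | h
  · simp
  · exact (List.tail_suffix s).trans h

theorem Reader.list {β : Type} [TEnc β] {write : β → List Letter}
    {p : List Letter → β × List Letter} (hp : Reader write p)
    (hw : ∀ x, ∃ c t, write x = c :: t ∧ c ≠ .rbrace) :
    Reader (fun l => listStr (l.map write)) (readList p) := by
  have h : ∀ s q, readItem p s = some q → q.2 <:+ s := by
    intro s q hq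
    rcases s with _ | ⟨c, t⟩
    · simp [readItem] at hq
    · cases hc : eqb c .comma with
      | false => simp [readItem, hc] at hq
      | true =>
        simp only [readItem, hc, lcase_cons, cond_true, Option.some.injEq] at hq
        subst hq
        exact (hp.suffix t).trans (List.suffix_cons c t)
  have hpt := hp.ptime
  have hm := ptime_many h (by unfold readItem; fun_prop)
  refine ⟨.cond (by fun_prop) (by fun_prop) (.pair (hm.comp (by fun_prop)).fst
    (hm.comp (by fun_prop)).snd.tail), fun s => ?_, fun l r hr => ?_⟩
  · unfold readList
    cases eqb s.tail.head? (some .rbrace)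
    · rw [cond_false]
      exact (tail_suffix_of_suffix_cons (many_suffix h _)).trans (List.tail_suffix s)
    · rw [cond_true]
      exact (List.tail_suffix _).trans (List.tail_suffix s)
  · cases l with
    | nil => simp [readList, listStr, List.intercalate, eqb]
    | cons x l =>
      obtain ⟨c, t, hc, hn⟩ := hw x
      let u : List β → List Letter := fun l =>
        (l.flatMap fun y => .comma :: write y) ++ .rbrace :: r
      have hu : listStr ((x :: l).map write) ++ r = .lbrace :: (u (x :: l)).tail := by
        rw [List.map_cons, listStr_cons]
        simp [u, List.flatMap_map]
      have hu' : .comma :: (u (x :: l)).tail = u (x :: l) := by simp [u]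
      have hh : (u (x :: l)).tail.head? = some c := by simp [u, hc]
      have hlen : ∀ l, l.length ≤ (u l).length := by
        intro l
        induction l with
        | nil => simp
        | cons y l ih =>
          simp only [u, List.flatMap_cons, List.length_append, List.length_cons] at *
          omega
      have hmany := many_eq u (e := readItem p) (fun x l => by
        have h₁ := hp.read x (u l) (by cases l <;> simp [u])
        have h₂ : u (x :: l) = .comma :: (write x ++ u l) := by simp [u]
        rw [h₂]
        simp [readItem, eqb, h₁]) (by simp [u, readItem, eqb]) (x :: l) (hlen _)
      have hne : eqb (some c) (some Letter.rbrace) = false := by simpa [eqb] using hn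
      rw [hu, readList, List.tail_cons, hh, hne, hu', hmany]
      simp [u]

/-- Read a listing of names. -/
def readSet : List Letter → List Name × List Letter := readList readName

theorem reader_set : Reader setStr readSet :=
  reader_name.list fun x => ⟨.mark, _, rfl, by simp⟩

@[fun_prop]
theorem PTime.readSet {α : Type} [TEnc α] {f : α → List Letter} (hf : PTime f) :
    PTime fun x => readSet (f x) := reader_set.ptime.comp hf

/-- Read a pair of a name and a listing of names. -/
def readPair (s : List Letter) : (Name × List Name) × List Letter :=
  (((readName s.tail).1, (readSet (readName s.tail).2.tail).1),
    (readSet (readName s.tail).2.tail).2.tail)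

/-- Read a triple of two names and a listing of names. -/
def readTriple (s : List Letter) : (Name × Name × List Name) × List Letter :=
  (((readName s.tail).1, (readPair (readName s.tail).2).1), (readPair (readName s.tail).2).2)

theorem reader_pair : Reader Presentation.pairStr readPair := by
  refine ⟨by unfold readPair; fun_prop, fun s => ?_, fun ⟨x, l⟩ r hr => ?_⟩
  · exact (List.tail_suffix _).trans ((reader_set.suffix _).trans ((List.tail_suffix _).trans
      ((reader_name.suffix _).trans (List.tail_suffix s))))
  · have h₃ := reader_name.read x (.comma :: (setStr l ++ (.rpar :: r))) (by simp)
    have h₄ := reader_set.read l (.rpar :: r) (by simp)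
    simp [readPair, Presentation.pairStr, h₃, h₄]

theorem reader_triple : Reader Presentation.tripleStr readTriple := by
  refine ⟨by unfold readTriple; fun_prop, fun s => ?_, fun ⟨w, u, l⟩ r hr => ?_⟩
  · exact (reader_pair.suffix _).trans ((reader_name.suffix _).trans (List.tail_suffix s))
  · have h₃ := reader_name.read w (.comma :: (nameStr u ++ (.comma :: (setStr l ++ (.rpar :: r)))))
      (by simp)
    have h₄ := reader_name.read u (.comma :: (setStr l ++ (.rpar :: r))) (by simp)
    have h₅ := reader_set.read l (.rpar :: r) (by simp)
    simp [readTriple, readPair, Presentation.tripleStr, h₃, h₄, h₅]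

instance : TEnc Presentation := ⟨fun p => enc (p.worlds, p.edges, p.caps, p.vals)⟩

namespace PTime
variable {α : Type} [TEnc α] {f : α → Presentation}

theorem presentation (hf : PTime f) :
    PTime fun x => ((f x).worlds, (f x).edges, (f x).caps, (f x).vals) := hf.of_enc fun _ => rfl

@[fun_prop]
theorem worlds (hf : PTime f) : PTime fun x => (f x).worlds := hf.presentation.fst

@[fun_prop]
theorem edges (hf : PTime f) : PTime fun x => (f x).edges := hf.presentation.snd.fst

@[fun_prop]
theorem caps (hf : PTime f) : PTime fun x => (f x).caps := hf.presentation.snd.snd.fst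

@[fun_prop]
theorem vals (hf : PTime f) : PTime fun x => (f x).vals := hf.presentation.snd.snd.snd

@[fun_prop]
theorem presentation_mk {W : α → List Name} {E : α → List (Name × Name × List Skill)}
    {C : α → List (Agent × List Skill)} {V : α → List (Name × List Atom)} (hW : PTime W)
    (hE : PTime E) (hC : PTime C) (hV : PTime V) :
    PTime fun x => Presentation.mk (W x) (E x) (C x) (V x) :=
  (hW.pair (hE.pair (hC.pair hV))).of_enc fun _ => rfl

@[fun_prop]
theorem nameStr {f : α → Name} (hf : PTime f) : PTime fun x => nameStr (f x) := by
  have : PTime (fun q : α × Bool => Letter.bit q.2) := of_fin Letter.bit (by fun_prop)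
  unfold EpistemicSkills.nameStr
  fun_prop

@[fun_prop]
theorem listStr {l : α → List (List Letter)} (hl : PTime l) : PTime fun x => listStr (l x) := by
  have h : ∀ x, EpistemicSkills.listStr (l x) =
      .lbrace :: (((l x).map fun y => .comma :: y).flatten.tail ++ [.rbrace]) := by
    intro x
    cases l x with
    | nil => simp [EpistemicSkills.listStr, List.intercalate]
    | cons y l => rw [listStr_cons, List.flatMap_def]
  simp only [h]
  fun_prop

@[fun_prop]
theorem setStr {l : α → List Name} (hl : PTime l) : PTime fun x => setStr (l x) := by
  unfold EpistemicSkills.setStr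
  fun_prop

@[fun_prop]
theorem str (hf : PTime f) : PTime fun x => (f x).str := by
  unfold Presentation.str Presentation.tripleStr Presentation.pairStr
  fun_prop

end PTime

/-- Read a quadruple of listings. -/
def readPresentation (s : List Letter) : Presentation × List Letter :=
  let a := readSet s.tail
  let b := readList readTriple a.2.tail
  let c := readList readPair b.2.tail
  let d := readList readPair c.2.tail
  (⟨a.1, b.1, c.1, d.1⟩, d.2.tail)

theorem reader_presentation : Reader Presentation.str readPresentation := by
  have h₁ := reader_set
  have h₂ := reader_triple.list fun x => ⟨.lpar, _, rfl, by simp⟩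
  have h₃ := reader_pair.list fun x => ⟨.lpar, _, rfl, by simp⟩
  have h₄ := h₁.ptime
  have h₅ := h₂.ptime
  have h₆ := h₃.ptime
  refine ⟨by unfold readPresentation; fun_prop, fun s => ?_, fun ⟨W, E, C, V⟩ r hr => ?_⟩
  · exact (List.tail_suffix _).trans ((h₃.suffix _).trans ((List.tail_suffix _).trans
      ((h₃.suffix _).trans ((List.tail_suffix _).trans ((h₂.suffix _).trans
      ((List.tail_suffix _).trans ((h₁.suffix _).trans (List.tail_suffix s))))))))
  · have h₇ := h₃.read V (.rpar :: r) (by simp)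
    have h₈ := h₃.read C (.comma :: (listStr (V.map Presentation.pairStr) ++ (.rpar :: r)))
      (by simp)
    have h₉ := h₂.read E (.comma :: (listStr (C.map Presentation.pairStr) ++
      (.comma :: (listStr (V.map Presentation.pairStr) ++ (.rpar :: r))))) (by simp)
    have h₁₀ := h₁.read W (.comma :: (listStr (E.map Presentation.tripleStr) ++
      (.comma :: (listStr (C.map Presentation.pairStr) ++
      (.comma :: (listStr (V.map Presentation.pairStr) ++ (.rpar :: r))))))) (by simp)
    simp [readPresentation, Presentation.str, h₇, h₈, h₉, h₁₀]

@[fun_prop]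
theorem PTime.readPresentation {α : Type} [TEnc α] {f : α → List Letter} (hf : PTime f) :
    PTime fun x => readPresentation (f x) := reader_presentation.ptime.comp hf

/-- Read an element and fail unless the string begins with a notation of it. -/
def exactly {β : Type} (write : β → List Letter) (p : List Letter → β × List Letter)
    (s : List Letter) : Option (β × List Letter) :=
  bif eqb (write (p s).1 ++ (p s).2) s then some (p s) else none

theorem exactly_eq_some {β : Type} {write : β → List Letter} {p : List Letter → β × List Letter}
    {s r : List Letter} {x : β} (h : exactly write p s = some (x, r)) : s = write x ++ r := by
  unfold exactly at h
  cases he : eqb (write (p s).1 ++ (p s).2) s with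
  | false => simp [he] at h
  | true =>
    simp only [he, cond_true, Option.some.injEq] at h
    rw [eqb_iff, h] at he
    exact he.symm

theorem Reader.exactly_write {β : Type} [TEnc β] {write : β → List Letter}
    {p : List Letter → β × List Letter} (hp : Reader write p) (x : β) {r : List Letter}
    (hr : ∀ b, r.head? ≠ some (.bit b)) : exactly write p (write x ++ r) = some (x, r) := by
  simp [exactly, hp.read x r hr, eqb]

@[fun_prop]
theorem PTime.exactlyName {α : Type} [TEnc α] {f : α → List Letter} (hf : PTime f) :
    PTime fun x => exactly EpistemicSkills.nameStr PolyTime.readName (f x) := by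
  unfold exactly
  fun_prop

@[fun_prop]
theorem PTime.exactlySet {α : Type} [TEnc α] {f : α → List Letter} (hf : PTime f) :
    PTime fun x => exactly EpistemicSkills.setStr PolyTime.readSet (f x) := by
  unfold exactly
  fun_prop

/-! ### The algorithm -/

/-- Inclusion of listings. -/
def subset (l l' : List Name) : Bool := l.all fun x => l'.any fun y => eqb x y

/-- Equality of the listed sets. -/
def setEq (l l' : List Name) : Bool := subset l l' && subset l' l

@[simp] theorem any_eqb {l : List Name} {x : Name} : (l.any fun y => eqb x y) = true ↔ x ∈ l := by
  simp

@[simp] theorem subset_iff {l l' : List Name} : subset l l' = true ↔ l ⊆ l' := by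
  simp [subset, List.subset_def]

@[simp] theorem setEq_iff {l l' : List Name} :
    setEq l l' = true ↔ {x | x ∈ l} = {x | x ∈ l'} := by
  simp only [setEq, Bool.and_eq_true, subset_iff, List.subset_def, Set.ext_iff, Set.mem_ofPred_eq]
  exact ⟨fun h x => ⟨fun hx => h.1 hx, fun hx => h.2 hx⟩,
    fun h => ⟨fun {x} hx => (h x).1 hx, fun {x} hx => (h x).2 hx⟩⟩

/-- Whether the listings are those of a model. -/
def valid (p : Presentation) : Bool :=
  (p.edges.all fun e => (p.worlds.any fun w => eqb e.1 w) && p.worlds.any fun w => eqb e.2.1 w) &&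
  (p.worlds.all fun w => p.worlds.all fun u => p.edges.any fun e => eqb e.1 w && eqb e.2.1 u) &&
  (p.edges.all fun e => p.edges.all fun e' =>
    bif (eqb e.1 e'.1 && eqb e.2.1 e'.2.1) || (eqb e.1 e'.2.1 && eqb e.2.1 e'.1) then
      setEq e.2.2 e'.2.2 else true) &&
  (p.caps.all fun c => p.caps.all fun c' => bif eqb c.1 c'.1 then setEq c.2 c'.2 else true) &&
  (p.vals.all fun v => p.worlds.any fun w => eqb v.1 w) &&
  (p.worlds.all fun w => p.vals.any fun v => eqb v.1 w) &&
  (p.vals.all fun v => p.vals.all fun v' => bif eqb v.1 v'.1 then setEq v.2 v'.2 else true)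

/-- The capabilities of agents; earlier entries override later ones. -/
abbrev Env := List (Agent × List Skill)

/-- The skills of an agent. -/
def lookup (env : Env) (a : Agent) : Option (List Skill) :=
  ocase (env.filter fun e => eqb e.1 a).head? none fun e => some e.2

/-- The skills of an agent, none for an unknown agent. -/
def skills (env : Env) (a : Agent) : List Skill := ocase (lookup env a) [] fun l => l

/-- Whether the agents are known. -/
def known (env : Env) (G : List Agent) : Bool := G.all fun a => env.any fun e => eqb e.1 a

/-- The worlds `w` such that all `u` with `S ⊆ E(w, u)` are listed in `v`. -/
def boxList (p : Presentation) (S : List Skill) (v : List Name) : List Name :=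
  p.worlds.filter fun w => p.edges.all fun e =>
    !(eqb e.1 w && subset S e.2.2) || v.any fun u => eqb e.2.1 u

/-- The worlds where every agent in `G` knows `v`. -/
def everyoneList (p : Presentation) (env : Env) (G : List Agent) (v : List Name) : List Name :=
  p.worlds.filter fun w => G.all fun a => (boxList p (skills env a) v).any fun u => eqb w u

/-- The skills of some agent in `G`. -/
def unionList (env : Env) (G : List Agent) : List Skill := (G.map fun a => skills env a).flatten

/-- The skills of all agents in `G`. -/
def interList (env : Env) (G : List Agent) : List Skill :=
  (unionList env G).filter fun s => G.all fun a => (skills env a).any fun t => eqb s t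

/-- The worlds where `v` is common knowledge in `G`. After `n` rounds the list holds the worlds
where every iteration of mutual knowledge of `v` up to the `n`-th holds. -/
def commonList (p : Presentation) (env : Env) (G : List Agent) (v : List Name) : List Name :=
  p.worlds.foldl (fun z _ => everyoneList p env G (v.filter fun w => z.any fun u => eqb w u))
    p.worlds

/-- What remains to be done once the truth set of a subformula is known: negate, evaluate the right
side of an implication, combine the two sides, or apply an epistemic operator. -/
inductive Tag : Type
  | neg | left | right | mutual | distributed | field | common

/-- A frame of the recursion: its kind, the capabilities, a group, and a truth set. -/
abbrev Frame := Tag × Env × List Agent × List Name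

/-- A state of the evaluation, or `none` after a failure: the truth set of the formula just read
(`none` if a formula is to be read next), the capabilities, the recursion stack, and the remaining
string. -/
abbrev State := Option (Option (List Name) × Env × List Frame × List Letter)

/-- Read an epistemic operator with a group; `b` tells whether it belongs to the language. -/
def readGroup (b : Bool) (t : Tag) (env : Env) (fr : List Frame) (r : List Letter) : State :=
  ocase (exactly setStr readSet r) none fun q =>
    bif b && (!eqb q.1 [] && known env q.1) then some (none, env, (t, env, q.1, []) :: fr, q.2)
    else none

/-- Read an operator that changes the skills of an agent by means of a set of skills; `b` tells
whether it belongs to the language. -/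
def readUpdate (b : Bool) (op : List Skill → List Skill → List Skill) (env : Env) (fr : List Frame)
    (r : List Letter) : State :=
  ocase (exactly setStr readSet r) none fun q => lcase q.2 none fun c r =>
    ocase (exactly nameStr readName r) none fun a => ocase (lookup env a.1) none fun l =>
      bif b && (!eqb q.1 [] && eqb c .rpar) then some (none, (a.1, op l q.1) :: env, fr, a.2)
      else none

/-- Read an operator by which an agent takes over the skills of another one; `b` tells whether it
belongs to the language. -/
def readLearn (b : Bool) (env : Env) (fr : List Frame) (r : List Letter) : State :=
  ocase (exactly nameStr readName r) none fun q => lcase q.2 none fun c r =>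
    ocase (exactly nameStr readName r) none fun a => ocase (lookup env q.1) none fun l =>
      bif b && (known env [a.1] && eqb c .rpar) then some (none, (a.1, l) :: env, fr, a.2)
      else none

open Classical in
/-- Read the rest of a formula that begins with a parenthesis and the letter `c`. -/
noncomputable def parenStep (X : Set Op) (env : Env) (fr : List Frame) (c : Letter)
    (r : List Letter) : State :=
  match c with
  | .plus => readUpdate (decide (Op.upskill ∈ X)) (fun l S => l ++ S) env fr r
  | .minus => readUpdate (decide (Op.downskill ∈ X))
      (fun l S => l.filter fun s => !S.any fun t => eqb s t) env fr r
  | .eq => readUpdate (decide (Op.reskill ∈ X)) (fun _ S => S) env fr r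
  | .equiv => readLearn (decide (Op.learn ∈ X)) env fr r
  | c => some (none, env, (.left, env, [], []) :: fr, c :: r)

open Classical in
/-- Begin with a formula whose first letter is `c`. -/
noncomputable def letterStep (X : Set Op) (p : Presentation) (env : Env) (fr : List Frame)
    (c : Letter) (r : List Letter) : State :=
  match c with
  | .mark => ocase (exactly nameStr readName (.mark :: r)) none fun q =>
      some (some (p.worlds.filter fun w => p.vals.any fun v =>
        eqb v.1 w && v.2.any fun a => eqb q.1 a), env, fr, q.2)
  | .neg => some (none, env, (.neg, env, [], []) :: fr, r)
  | .K => ocase (exactly nameStr readName r) none fun q =>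
      bif known env [q.1] then some (none, env, (.mutual, env, [q.1], []) :: fr, q.2) else none
  | .C => readGroup (decide (Op.common ∈ X)) .common env fr r
  | .D => readGroup (decide (Op.distributed ∈ X)) .distributed env fr r
  | .E => readGroup (decide (Op.mutual ∈ X)) .mutual env fr r
  | .F => readGroup (decide (Op.field ∈ X)) .field env fr r
  | .lpar => lcase r none fun c r => parenStep X env fr c r
  | _ => none

/-- Go on with the frame `f` once the truth set `v` is known. -/
def frameStep (p : Presentation) (v : List Name) (env : Env) (f : Frame) (fr : List Frame)
    (r : List Letter) : State :=
  match f.1 with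
  | .neg => some (some (p.worlds.filter fun w => !v.any fun u => eqb w u), env, fr, r)
  | .left => lcase r none fun c r =>
      bif eqb c .imp then some (none, f.2.1, (.right, f.2.1, [], v) :: fr, r) else none
  | .right => lcase r none fun c r =>
      bif eqb c .rpar then
        some (some (p.worlds.filter fun w =>
          !(f.2.2.2.any fun u => eqb w u) || v.any fun u => eqb w u), env, fr, r)
      else none
  | .mutual => some (some (everyoneList p f.2.1 f.2.2.1 v), env, fr, r)
  | .distributed => some (some (boxList p (unionList f.2.1 f.2.2.1) v), env, fr, r)
  | .field => some (some (boxList p (interList f.2.1 f.2.2.1) v), env, fr, r)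
  | .common => some (some (commonList p f.2.1 f.2.2.1 v), env, fr, r)

/-- One step of the evaluation. -/
noncomputable def step (X : Set Op) (p : Presentation) (q : State) : State :=
  ocase q none fun q =>
    ocase q.1 (lcase q.2.2.2 none fun c r => letterStep X p q.2.1 q.2.2.1 c r) fun v =>
      lcase q.2.2.1 (some q) fun f fr => frameStep p v q.2.1 f fr q.2.2.2

/-- The state in which the evaluation of a string begins. -/
def start (env : Env) (fr : List Frame) (t : List Letter) : State := some (none, env, fr, t)

/-- The evaluation of a formula at the front of the string `t`. -/
noncomputable def run (X : Set Op) (p : Presentation) (t : List Letter) : State :=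
  (step X p)^[sz t] (start p.caps [] t)

/-- The model checking algorithm. -/
noncomputable def decideMC (X : Set Op) (s : List Letter) : Bool :=
  ocase (exactly Presentation.str readPresentation s) false fun a =>
    ocase (exactly nameStr readName a.2) false fun b =>
      valid a.1 && ((a.1.worlds.any fun w => eqb b.1 w) &&
        ocase (run X a.1 b.2) false fun q =>
          ocase q.1 false fun v => eqb q.2.2.2 [] && (lcase q.2.2.1 true fun _ _ => false) &&
            v.any fun w => eqb b.1 w)

/-! ### The algorithm takes polynomial time -/

instance : FinTy Tag where
  idx t := match t with
    | .neg => 0 | .left => 1 | .right => 2 | .mutual => 3 | .distributed => 4 | .field => 5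
    | .common => 6
  ofIdx n := [Tag.neg, .left, .right, .mutual, .distributed, .field].getD n .common
  card := 7
  idx_lt t := by cases t <;> decide
  ofIdx_idx t := by cases t <;> rfl

namespace PTime
variable {α : Type} [TEnc α] {p : α → Presentation} {env : α → Env} {G : α → List Agent}
  {v S S' : α → List Name} {a : α → Agent} {fr : α → List Frame} {c : α → Letter}
  {r : α → List Letter} {f : α → Frame}

@[fun_prop]
theorem subset (hS : PTime S) (hS' : PTime S') : PTime fun x => subset (S x) (S' x) := by
  unfold PolyTime.subset
  fun_prop

@[fun_prop]
theorem setEq (hS : PTime S) (hS' : PTime S') : PTime fun x => setEq (S x) (S' x) := by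
  unfold PolyTime.setEq
  fun_prop

@[fun_prop]
theorem valid (hp : PTime p) : PTime fun x => valid (p x) := by
  unfold PolyTime.valid
  fun_prop

@[fun_prop]
theorem lookup (he : PTime env) (ha : PTime a) : PTime fun x => lookup (env x) (a x) := by
  unfold PolyTime.lookup
  fun_prop

@[fun_prop]
theorem skills (he : PTime env) (ha : PTime a) : PTime fun x => skills (env x) (a x) := by
  unfold PolyTime.skills
  fun_prop

@[fun_prop]
theorem known (he : PTime env) (hG : PTime G) : PTime fun x => known (env x) (G x) := by
  unfold PolyTime.known
  fun_prop

@[fun_prop]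
theorem boxList (hp : PTime p) (hS : PTime S) (hv : PTime v) :
    PTime fun x => boxList (p x) (S x) (v x) := by
  unfold PolyTime.boxList
  fun_prop

@[fun_prop]
theorem everyoneList (hp : PTime p) (he : PTime env) (hG : PTime G) (hv : PTime v) :
    PTime fun x => everyoneList (p x) (env x) (G x) (v x) := by
  unfold PolyTime.everyoneList
  fun_prop

@[fun_prop]
theorem unionList (he : PTime env) (hG : PTime G) : PTime fun x => unionList (env x) (G x) := by
  unfold PolyTime.unionList
  fun_prop

@[fun_prop]
theorem interList (he : PTime env) (hG : PTime G) : PTime fun x => interList (env x) (G x) := by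
  unfold PolyTime.interList
  fun_prop

end PTime

theorem sz_filter_worlds_le (p : Presentation) (f : Name → Bool) :
    sz (p.worlds.filter f) ≤ sz p.worlds := sz_le_of_sublist List.filter_sublist

theorem sz_commonList_le (p : Presentation) (env : Env) (G : List Agent) (v l : List Name) :
    sz (l.foldl (fun z _ => everyoneList p env G (v.filter fun w => z.any fun u => eqb w u))
      p.worlds) ≤ sz p.worlds := by
  cases l using List.reverseRecOn with
  | nil => exact le_rfl
  | append_singleton l x =>
    rw [List.foldl_append]
    exact sz_filter_worlds_le p _

namespace PTime
variable {α : Type} [TEnc α] {p : α → Presentation} {env : α → Env} {G : α → List Agent}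
  {v S S' : α → List Name} {a : α → Agent} {fr : α → List Frame} {c : α → Letter}
  {r : α → List Letter} {f : α → Frame}

@[fun_prop]
theorem commonList (hp : PTime p) (he : PTime env) (hG : PTime G) (hv : PTime v) :
    PTime fun x => commonList (p x) (env x) (G x) (v x) := by
  obtain ⟨q, hq⟩ := hp.worlds.size_le
  exact foldl (s := fun x z _ => PolyTime.everyoneList (p x) (env x) (G x)
    ((v x).filter fun w => z.any fun u => PolyTime.eqb w u)) hp.worlds hp.worlds (by fun_prop) q
    fun x l _ => (sz_commonList_le _ _ _ _ _).trans (hq x)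

@[fun_prop]
theorem readGroup (b : Bool) (t : Tag) (he : PTime env) (hf : PTime fr) (hr : PTime r) :
    PTime fun x => readGroup b t (env x) (fr x) (r x) := by
  unfold PolyTime.readGroup
  fun_prop

theorem readUpdate (b : Bool) {op : List Skill → List Skill → List Skill}
    (ho : PTime fun q : List Skill × List Skill => op q.1 q.2) (he : PTime env) (hf : PTime fr)
    (hr : PTime r) : PTime fun x => readUpdate b op (env x) (fr x) (r x) := by
  have h : PTime fun q : (((α × List Name × List Letter) × Letter × List Letter) × Name ×
      List Letter) × List Name => op q.2 q.1.1.1.2.1 :=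
    ho.comp (f := fun q : (((α × List Name × List Letter) × Letter × List Letter) × Name ×
      List Letter) × List Name => (q.2, q.1.1.1.2.1)) (by fun_prop)
  unfold PolyTime.readUpdate
  refine .ocase (by fun_prop) (by fun_prop) (.lcase (by fun_prop) (by fun_prop)
    (.ocase (by fun_prop) (by fun_prop) (.ocase (by fun_prop) (by fun_prop)
    (.cond (by fun_prop) (.mk_some (.pair (by fun_prop) (.pair (.cons (.pair (by fun_prop) ?_)
      (by fun_prop)) (by fun_prop)))) (by fun_prop)))))
  exact h

@[fun_prop]
theorem readLearn (b : Bool) (he : PTime env) (hf : PTime fr) (hr : PTime r) :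
    PTime fun x => readLearn b (env x) (fr x) (r x) := by
  unfold PolyTime.readLearn
  fun_prop

@[fun_prop]
theorem parenStep (X : Set Op) (he : PTime env) (hf : PTime fr) (hc : PTime c) (hr : PTime r) :
    PTime fun x => parenStep X (env x) (fr x) (c x) (r x) := by
  refine cases_fin hc (f := fun c x => PolyTime.parenStep X (env x) (fr x) c (r x)) fun c => ?_
  cases c <;> unfold PolyTime.parenStep <;> dsimp only <;>
    first
    | exact readUpdate _ (by fun_prop) he hf hr
    | fun_prop

@[fun_prop]
theorem letterStep (X : Set Op) (hp : PTime p) (he : PTime env) (hf : PTime fr) (hc : PTime c)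
    (hr : PTime r) : PTime fun x => letterStep X (p x) (env x) (fr x) (c x) (r x) := by
  refine cases_fin hc
    (f := fun c x => PolyTime.letterStep X (p x) (env x) (fr x) c (r x)) fun c => ?_
  cases c <;> unfold PolyTime.letterStep <;> dsimp only <;> fun_prop

@[fun_prop]
theorem frameStep (hp : PTime p) (hv : PTime v) (he : PTime env) (hf : PTime f) (hfr : PTime fr)
    (hr : PTime r) : PTime fun x => frameStep (p x) (v x) (env x) (f x) (fr x) (r x) := by
  have h : ∀ t : Tag, PTime fun x =>
      PolyTime.frameStep (p x) (v x) (env x) (t, (f x).2) (fr x) (r x) := by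
    intro t
    cases t <;> unfold PolyTime.frameStep <;> dsimp only <;> fun_prop
  exact cases_fin hf.fst (f := fun t x =>
    PolyTime.frameStep (p x) (v x) (env x) (t, (f x).2) (fr x) (r x)) h

@[fun_prop]
theorem step (X : Set Op) {q : α → State} (hp : PTime p) (hq : PTime q) :
    PTime fun x => step X (p x) (q x) := by
  unfold PolyTime.step
  fun_prop

end PTime

/-! ### The states of the evaluation stay small -/

theorem ocase_ind {β γ : Type} {P : γ → Prop} {o : Option β} {z : γ} {s : β → γ} (hz : P z)
    (hs : ∀ x, o = some x → P (s x)) : P (ocase o z s) := by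
  cases o with
  | none => exact hz
  | some x => exact hs x rfl

theorem lcase_ind {β γ : Type} {P : γ → Prop} {l : List β} {z : γ} {s : β → List β → γ} (hz : P z)
    (hs : ∀ x t, l = x :: t → P (s x t)) : P (lcase l z s) := by
  cases l with
  | nil => exact hz
  | cons x t => exact hs x t rfl

theorem cond_ind {γ : Type} {P : γ → Prop} {c : Bool} {y z : γ} (hy : c = true → P y) (hz : P z) :
    P (bif c then y else z) := by
  cases c with
  | false => exact hz
  | true => exact hy rfl

theorem sz_worlds_le (p : Presentation) : sz p.worlds ≤ sz p := by
  change _ ≤ sz (p.worlds, p.edges, p.caps, p.vals)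
  simp only [sz_pair]
  omega

theorem sz_caps_le (p : Presentation) : sz p.caps ≤ sz p := by
  change _ ≤ sz (p.worlds, p.edges, p.caps, p.vals)
  simp only [sz_pair]
  omega

theorem exactly_suffix {β : Type} [TEnc β] {write : β → List Letter}
    {p : List Letter → β × List Letter} (hp : Reader write p) {s : List Letter}
    {q : β × List Letter} (h : exactly write p s = some q) : q.2 <:+ s := by
  revert h
  unfold exactly
  refine cond_ind (P := fun o => o = some q → _) (fun _ h => ?_) (by simp)
  rw [← Option.some.inj h]
  exact hp.suffix s

/-- Capabilities after `i` steps: there is at most one new entry per step, and entries grow at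
most by the names read in each step, whose size is bounded by `Q`. -/
def EnvOK (p : Presentation) (Q i : ℕ) (env : Env) : Prop :=
  env.length ≤ sz p + i ∧ ∀ e ∈ env, sz e ≤ sz p + i * (2 * Q + 1)

/-- Frames after `i` steps are of bounded size. -/
def FrameOK (p : Presentation) (Q i : ℕ) (f : Frame) : Prop :=
  EnvOK p Q i f.2.1 ∧ sz f.2.2.1 ≤ Q ∧ sz f.2.2.2 ≤ sz p

/-- States after `i` steps on the string `t` are of bounded size. -/
def StateOK (p : Presentation) (t : List Letter) (Q i : ℕ) (st : State) : Prop :=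
  ∀ q, st = some q → (∀ v, q.1 = some v → sz v ≤ sz p) ∧ EnvOK p Q i q.2.1 ∧
    (q.2.2.1.length ≤ i ∧ ∀ f ∈ q.2.2.1, FrameOK p Q i f) ∧ q.2.2.2 <:+ t

section
variable {p : Presentation} {t : List Letter} {Q i : ℕ} {env : Env} {fr : List Frame}
  {r : List Letter}

theorem EnvOK.mono (h : EnvOK p Q i env) {j : ℕ} (hij : i ≤ j) : EnvOK p Q j env :=
  ⟨h.1.trans (by omega), fun e he => (h.2 e he).trans (by gcongr)⟩

theorem FrameOK.mono {f : Frame} (h : FrameOK p Q i f) {j : ℕ} (hij : i ≤ j) : FrameOK p Q j f :=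
  ⟨h.1.mono hij, h.2⟩

theorem EnvOK.cons (h : EnvOK p Q i env) {a : Agent} {l : List Skill}
    (hl : sz (a, l) ≤ sz p + (i + 1) * (2 * Q + 1)) : EnvOK p Q (i + 1) ((a, l) :: env) := by
  have h' := h.mono (Nat.le_succ i)
  refine ⟨?_, ?_⟩
  · have := h.1
    simp only [List.length_cons]
    omega
  · intro e he
    rcases List.mem_cons.1 he with rfl | he
    · exact hl
    · exact h'.2 e he

theorem EnvOK.lookup (h : EnvOK p Q i env) {a : Agent} {l : List Skill}
    (hl : lookup env a = some l) : sz l + 1 ≤ sz p + i * (2 * Q + 1) := by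
  unfold PolyTime.lookup at hl
  cases he : (env.filter fun e => eqb e.1 a).head? with
  | none => simp [he] at hl
  | some e =>
    simp only [he, ocase_some, Option.some.injEq] at hl
    have h₁ := h.2 e (List.mem_of_mem_filter (List.mem_of_mem_head? he))
    have h₂ : sz e = sz e.1 + sz e.2 + 1 := rfl
    rw [hl] at h₂
    omega

theorem stateOK_none : StateOK p t Q i none := by
  intro q h
  cases h

theorem stateOK_mk {m : Option (List Name)} (hm : ∀ v, m = some v → sz v ≤ sz p)
    (he : EnvOK p Q i env) (hl : fr.length ≤ i) (hf : ∀ f ∈ fr, FrameOK p Q i f) (hr : r <:+ t) :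
    StateOK p t Q i (some (m, env, fr, r)) := by
  intro q h
  cases h
  exact ⟨hm, he, ⟨hl, hf⟩, hr⟩

theorem stateOK_push (he : EnvOK p Q i env) (hl : fr.length ≤ i)
    (hf : ∀ f ∈ fr, FrameOK p Q i f) (hr : r <:+ t) (g : Tag) {env' : Env} (he' : EnvOK p Q i env')
    {G : List Agent} {v : List Name} (hG : sz G ≤ Q) (hv : sz v ≤ sz p) :
    StateOK p t Q (i + 1) (some (none, env, (g, env', G, v) :: fr, r)) := by
  refine stateOK_mk (by simp) (he.mono (Nat.le_succ i)) (by simpa using hl) ?_ hr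
  intro f hf'
  rcases List.mem_cons.1 hf' with rfl | hf'
  · exact ⟨he'.mono (Nat.le_succ i), hG, hv⟩
  · exact (hf f hf').mono (Nat.le_succ i)

/-- The bound `Q` for the names and listings that are read off remainders of the string `t`. -/
def ReadBound (t : List Letter) (Q : ℕ) : Prop :=
  ∀ r, r <:+ t → (∀ q, exactly setStr readSet r = some q → sz q.1 ≤ Q) ∧
    ∀ q, exactly nameStr readName r = some q → sz q.1 + 2 ≤ Q

/-- Each step preserves the bounds, with an increased number of steps. -/
theorem stateOK_step (X : Set Op) (hQ : ReadBound t Q) (h1 : 1 ≤ Q) {st : State}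
    (h : StateOK p t Q i st) : StateOK p t Q (i + 1) (step X p st) := by
  have hp := sz_pos p
  unfold step
  refine ocase_ind stateOK_none fun ⟨m, env, fr, r⟩ hq => ?_
  obtain ⟨hm, he, ⟨hl, hf⟩, hr⟩ := h _ hq
  dsimp only at hm he hl hf hr ⊢
  have he' := he.mono (Nat.le_succ i)
  have hf' : ∀ f ∈ fr, FrameOK p Q (i + 1) f := fun f h => (hf f h).mono (Nat.le_succ i)
  have hw : ∀ f : Name → Bool, sz (p.worlds.filter f) ≤ sz p := fun f =>
    (sz_filter_worlds_le p f).trans (sz_worlds_le p)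
  refine ocase_ind ?_ ?_
  · refine lcase_ind stateOK_none fun c r' hc => ?_
    have hr' : r' <:+ t := (hc ▸ List.suffix_cons c r').trans hr
    have hgroup : ∀ b g, StateOK p t Q (i + 1) (readGroup b g env fr r') := by
      intro b g
      refine ocase_ind stateOK_none fun q hq => cond_ind (fun _ => ?_) stateOK_none
      exact stateOK_push he hl hf ((exactly_suffix reader_set hq).trans hr') g he
        ((hQ r' hr').1 q hq)
        (by simpa using hp)
    have hpush : ∀ r g, r <:+ t →
        StateOK p t Q (i + 1) (some (none, env, (g, env, [], []) :: fr, r)) := fun r g hr =>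
      stateOK_push he hl hf hr g he (by simpa using h1) (by simpa using hp)
    have hlearn : ∀ b r', r' <:+ t → StateOK p t Q (i + 1) (readLearn b env fr r') := by
      intro b r' hr'
      refine ocase_ind stateOK_none fun q hq => lcase_ind stateOK_none fun c r₂ hc =>
        ocase_ind stateOK_none fun a ha => ocase_ind stateOK_none fun l hl' =>
        cond_ind (fun _ => ?_) stateOK_none
      have hr₂ : r₂ <:+ t := ((hc ▸ List.suffix_cons c r₂).trans
        (exactly_suffix reader_name hq)).trans hr'
      have h₁ := (hQ r₂ hr₂).2 a ha
      have h₂ := he.lookup hl'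
      exact stateOK_mk (by simp) (he.cons (by rw [sz_pair, add_mul]; omega)) (by omega) hf'
        ((exactly_suffix reader_name ha).trans hr₂)
    have hupdate : ∀ b (op : List Skill → List Skill → List Skill) r',
        (∀ l S, sz (op l S) ≤ sz l + sz S) → r' <:+ t →
        StateOK p t Q (i + 1) (readUpdate b op env fr r') := by
      intro b op r' hop hr'
      refine ocase_ind stateOK_none fun q hq => lcase_ind stateOK_none fun c r₂ hc =>
        ocase_ind stateOK_none fun a ha => ocase_ind stateOK_none fun l hl' =>
        cond_ind (fun _ => ?_) stateOK_none
      have hr₂ : r₂ <:+ t := ((hc ▸ List.suffix_cons c r₂).trans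
        (exactly_suffix reader_set hq)).trans hr'
      have h₁ := (hQ r₂ hr₂).2 a ha
      have h₂ := he.lookup hl'
      have h₃ := (hQ r' hr').1 q hq
      have h₄ := hop l q.1
      exact stateOK_mk (by simp) (he.cons (by rw [sz_pair, add_mul]; omega)) (by omega) hf'
        ((exactly_suffix reader_name ha).trans hr₂)
    cases c <;> unfold letterStep <;> dsimp only <;> try exact stateOK_none
    · refine ocase_ind stateOK_none fun q hq => ?_
      exact stateOK_mk (by rintro _ ⟨⟩; exact hw _) he' (by omega) hf'
        ((exactly_suffix reader_name hq).trans (hc ▸ hr))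
    · refine lcase_ind stateOK_none fun c r₂ hc₂ => ?_
      have hr₂ : r₂ <:+ t := (hc₂ ▸ List.suffix_cons c r₂).trans hr'
      cases c <;> unfold parenStep <;> dsimp only <;> try exact hpush _ _ (hc₂ ▸ hr')
      · exact hupdate _ _ _ (fun l S => by have := sz_append l S; omega) hr₂
      · exact hupdate _ _ _ (fun l S => le_add_right (sz_le_of_sublist List.filter_sublist)) hr₂
      · exact hupdate _ _ _ (fun l S => by omega) hr₂
      · exact hlearn _ _ hr₂
    · exact hpush _ _ hr'
    · refine ocase_ind stateOK_none fun q hq => cond_ind (fun _ => ?_) stateOK_none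
      have := (hQ r' hr').2 q hq
      exact stateOK_push he hl hf ((exactly_suffix reader_name hq).trans hr') _ he
        (by simp only [sz_cons, sz_nil]; omega) (by simpa using hp)
    all_goals exact hgroup _ _
  · intro v hv
    have hv' := hm v hv
    refine lcase_ind (P := StateOK p t Q (i + 1)) ?_ ?_
    · exact stateOK_mk hm he' (by omega) hf' hr
    · rintro ⟨g, env', G, u⟩ fr' hfr
      subst hfr
      have hl' : fr'.length ≤ i := by simp at hl; omega
      have hf₁ : ∀ f ∈ fr', FrameOK p Q (i + 1) f := fun f h => hf' f (by simp [h])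
      have hf₂ : ∀ f ∈ fr', FrameOK p Q i f := fun f h => hf f (by simp [h])
      have hf₀ := hf _ List.mem_cons_self
      have hret : ∀ v r, sz v ≤ sz p → r <:+ t →
          StateOK p t Q (i + 1) (some (some v, env, fr', r)) := fun v r hv hr =>
        stateOK_mk (by rintro _ ⟨⟩; exact hv) he' (by omega) hf₁ hr
      cases g <;> unfold frameStep <;> dsimp only
      · exact hret _ _ (hw _) hr
      · refine lcase_ind stateOK_none fun c r' hc => cond_ind (fun _ => ?_) stateOK_none
        exact stateOK_push hf₀.1 hl' hf₂ ((hc ▸ List.suffix_cons c r').trans hr) _ hf₀.1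
          (by simpa using h1) hv'
      · refine lcase_ind stateOK_none fun c r' hc => cond_ind (fun _ => ?_) stateOK_none
        exact hret _ _ (hw _) ((hc ▸ List.suffix_cons c r').trans hr)
      · exact hret _ _ (hw _) hr
      · exact hret _ _ (hw _) hr
      · exact hret _ _ (hw _) hr
      · exact hret _ _ ((sz_commonList_le _ _ _ _ _).trans (sz_worlds_le p)) hr
end

/-- The bound for a state adds up those for the capabilities, for the frames, each with capabilities
of its own, and for the truth set and the remaining string. -/
theorem sz_le_of_stateOK {p : Presentation} {t : List Letter} {Q i n : ℕ} {st : State}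
    (h : StateOK p t Q i st) (hi : i ≤ n) (hp : sz p ≤ n) (ht : sz t ≤ n) :
    sz st ≤ ((n + n) * (n + n * (2 * Q + 1) + 1) + 1) +
      (n * ((n + n) * (n + n * (2 * Q + 1) + 1) + Q + n + 21) + 1) + 2 * n + 10 := by
  have hE : ∀ env, EnvOK p Q i env → sz env ≤ (n + n) * (n + n * (2 * Q + 1) + 1) + 1 := by
    intro env he
    refine (sz_le_of_forall he.2).trans ?_
    have := he.1
    gcongr
    omega
  cases st with
  | none => simp
  | some q =>
    obtain ⟨m, env, fr, r⟩ := q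
    obtain ⟨hm, he, ⟨hl, hf⟩, hr⟩ := h _ rfl
    dsimp only at hm he hl hf hr
    have hF : ∀ f ∈ fr, sz f ≤ (n + n) * (n + n * (2 * Q + 1) + 1) + Q + n + 20 := by
      rintro ⟨g, e, G, v⟩ hf'
      obtain ⟨h₁, h₂, h₃⟩ := hf _ hf'
      dsimp only at h₁ h₂ h₃
      have h₄ := hE _ h₁
      have h₅ : sz g ≤ 13 := by cases g <;> decide
      simp only [sz_pair]
      omega
    have h₁ := sz_le_of_forall hF
    have h₂ : fr.length * ((n + n) * (n + n * (2 * Q + 1) + 1) + Q + n + 20 + 1) ≤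
        n * ((n + n) * (n + n * (2 * Q + 1) + 1) + Q + n + 21) :=
      Nat.mul_le_mul_right _ (hl.trans hi)
    have h₃ := hE _ he
    have h₄ := sz_le_of_sublist hr.sublist
    have h₅ : sz m ≤ n + 2 := by
      cases m with
      | none => simp
      | some v =>
        have := hm v rfl
        simp only [sz_some]
        omega
    simp only [sz_some, sz_pair]
    omega

@[fun_prop]
theorem PTime.run (X : Set Op) {α : Type} [TEnc α] {p : α → Presentation} {t : α → List Letter}
    (hp : PTime p) (ht : PTime t) :
    PTime fun x => run X (p x) (t x) := by
  have hs : PTime fun x => exactly EpistemicSkills.setStr PolyTime.readSet x :=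
    PTime.exactlySet PTime.id
  have hn : PTime fun x => exactly EpistemicSkills.nameStr PolyTime.readName x :=
    PTime.exactlyName PTime.id
  obtain ⟨q₁, hq₁⟩ := hs.size_le
  obtain ⟨q₂, hq₂⟩ := hn.size_le
  let n : Polynomial ℕ := Polynomial.X
  let Q : Polynomial ℕ := q₁ + q₂ + 2
  have hi : ∀ (q : Presentation × List Letter) i,
      (fun s : Presentation × State => (s.1, PolyTime.step X s.1 s.2))^[i]
        (q.1, start q.1.caps [] q.2) =
          (q.1, (PolyTime.step X q.1)^[i] (start q.1.caps [] q.2)) := by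
    intro q i
    induction i with
    | zero => rfl
    | succ i ih => rw [Function.iterate_succ_apply', ih, Function.iterate_succ_apply']
  have h := iter (h := fun q : Presentation × List Letter => q.2)
    (f := fun q => (q.1, start q.1.caps [] q.2)) (by fun_prop)
    (by unfold start; fun_prop) (g := fun s => (s.1, PolyTime.step X s.1 s.2)) (by fun_prop)
    (((n + n) * (n + n * (2 * Q + 1) + 1) + 1) +
      (n * ((n + n) * (n + n * (2 * Q + 1) + 1) + Q + n + 21) + 1) + 2 * n + 10 + n + 1)
    (fun ⟨p, t⟩ i hit => by
      rw [hi]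
      have hpt : sz (p, t) = sz p + sz t + 1 := rfl
      have hok : StateOK p t (Q.eval (sz (p, t))) i
          ((PolyTime.step X p)^[i] (start p.caps [] t)) := by
        clear hit
        induction i with
        | zero =>
          have h₁ := sz_caps_le p
          have h₂ := length_le_sz p.caps
          refine stateOK_mk (by simp) ⟨by omega, fun e he => ?_⟩ le_rfl (by simp) List.suffix_rfl
          have := sz_le_of_mem he
          omega
        | succ i ih =>
          rw [Function.iterate_succ_apply']
          refine stateOK_step X (fun r hr => ?_) (by simp [Q]) ih
          have h₁ := (hq₁ r).trans (eval_mono q₁ ((sz_le_of_sublist hr.sublist).trans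
            (show sz t ≤ sz (p, t) by omega)))
          have h₂ := (hq₂ r).trans (eval_mono q₂ ((sz_le_of_sublist hr.sublist).trans
            (show sz t ≤ sz (p, t) by omega)))
          have hQ : Q.eval (sz (p, t)) = q₁.eval (sz (p, t)) + q₂.eval (sz (p, t)) + 2 := by
            simp [Q]
          constructor
          · rintro ⟨a, b⟩ hq
            have h₃ : sz (a, b) = sz a + sz b + 1 := rfl
            rw [hq, sz_some] at h₁
            rw [hQ]
            dsimp only
            omega
          · rintro ⟨a, b⟩ hq
            have h₃ : sz (a, b) = sz a + sz b + 1 := rfl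
            rw [hq, sz_some] at h₂
            rw [hQ]
            dsimp only
            omega
      have h₁ := sz_le_of_stateOK hok (n := sz (p, t)) (by dsimp only at hit; omega) (by omega)
        (by omega)
      rw [sz_pair p]
      simp only [n, Polynomial.eval_add, Polynomial.eval_mul, Polynomial.eval_X,
        Polynomial.eval_one, Polynomial.eval_ofNat]
      omega)
  simp only [hi] at h
  unfold PolyTime.run
  exact h.snd.comp (hp.pair ht)

theorem ptime_decideMC (X : Set Op) : PTime (decideMC X) := by
  have h : PTime fun x => exactly Presentation.str readPresentation x := by
    unfold exactly
    fun_prop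
  unfold decideMC
  fun_prop

/-- Languages that are decided in polynomial time on trees are in P. -/
theorem inP_of_ptime {f : List Letter → Bool} (hf : PTime f) {L : Language Letter}
    (h : ∀ s, f s = true ↔ s ∈ L) : InP L := by
  refine ⟨f, h, ?_⟩
  -- The machine reads its input onto a stack, so that the program gets it in reverse.
  obtain ⟨p, q, hp⟩ := hf.comp (PTime.reverse (l := fun s : List Letter => s) PTime.id)
  have hread : ∀ (s : List Letter) (l : List Letter) ,
      readWord (fun c => true :: (enc c).code) s (enc l).code = (enc (s.reverse ++ l)).code := by
    intro s
    induction s with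
    | nil => intro l; rfl
    | cons c s ih =>
      intro l
      rw [List.reverse_cons, List.append_assoc]
      exact ih (c :: l)
  have hsz : ∀ s : List Letter, sz s ≤ 40 * s.length + 1 := by
    intro s
    -- The 19 letters are represented by their numbers in unary.
    have h : ∀ c : Letter, sz c ≤ 39 := by
      intro c
      rcases c with _ | b | _ | _ | _ | _ | _ | _ | _ | _ | _ | _ | _ | _ | _ | _ | _ | _ <;>
        try cases b
      all_goals decide
    have := sz_le_of_forall (l := s) fun c _ => h c
    omega
  refine exists_machine (fun c => true :: (enc c).code) p f
    (q.comp (40 * Polynomial.X + 1)) fun s => ?_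
  obtain ⟨t, ht, he⟩ := (hp s.reverse).2 [] [] [] [] []
  have h₁ : bitWord (f s) = (enc (f s)).code := by cases f s <;> rfl
  refine ⟨t, ht.trans ?_, ?_⟩
  · rw [sz_reverse, Polynomial.eval_comp]
    refine eval_mono q ?_
    simpa using hsz s
  · have h₂ := hread s []
    rw [List.append_nil] at h₂
    rw [h₁, show [false] = (enc ([] : List Letter)).code from rfl, h₂]
    simpa using he

section

/-! ### Truth sets as listings -/

/-- Iterating a monotone operator on sets, from the set of all elements, becomes stationary after
as many rounds as there are elements. -/
theorem iterate_univ_stationary {W : Type} [Finite W] {F : Set W → Set W} (hF : Monotone F) {n : ℕ}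
    (hn : Nat.card W ≤ n) {m : ℕ} (hm : n ≤ m) : F^[m] Set.univ = F^[n] Set.univ := by
  have hanti : ∀ k, F^[k + 1] Set.univ ⊆ F^[k] Set.univ := by
    intro k
    induction k with
    | zero => exact Set.subset_univ _
    | succ k ih =>
      have := hF ih
      rwa [← Function.iterate_succ_apply' F, ← Function.iterate_succ_apply' F] at this
  have hk : ∀ k, (∃ j < k, F^[j + 1] Set.univ = F^[j] Set.univ) ∨
      (F^[k] Set.univ).ncard + k ≤ Nat.card W := by
    intro k
    induction k with
    | zero => right; simp [Set.ncard_univ]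
    | succ k ih =>
      rcases ih with ⟨j, hj, he⟩ | h
      · exact .inl ⟨j, by omega, he⟩
      · by_cases he : F^[k + 1] Set.univ = F^[k] Set.univ
        · exact .inl ⟨k, by omega, he⟩
        · have := Set.ncard_lt_ncard ((hanti k).ssubset_of_ne he)
          right
          omega
  obtain ⟨j, hj, he⟩ : ∃ j ≤ n, F^[j + 1] Set.univ = F^[j] Set.univ := by
    rcases hk n with ⟨j, hj, he⟩ | h
    · exact ⟨j, hj.le, he⟩
    · have h₀ : F^[n] Set.univ = ∅ := (Set.ncard_eq_zero (Set.toFinite _)).1 (by omega)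
      refine ⟨n, le_rfl, ?_⟩
      have := hanti n
      rw [h₀] at this ⊢
      exact Set.subset_empty_iff.1 this
  have hc : ∀ m, j ≤ m → F^[m] Set.univ = F^[j] Set.univ := by
    intro m hm
    obtain ⟨i, rfl⟩ := Nat.exists_eq_add_of_le' hm
    rw [Function.iterate_add_apply]
    refine Function.iterate_fixed ?_ i
    rw [← Function.iterate_succ_apply' F j, he]
  rw [hc m (by omega), hc n hj]

theorem mem_everyone {W : Type} {M : Model W} {G : Finset Agent} {T : Set W} {w : W} :
    w ∈ M.everyone G T ↔ ∀ a ∈ G, ∀ u, M.C a ⊆ M.E w u → u ∈ T := Iff.rfl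

/-- Common knowledge is reached after as many rounds as there are worlds. -/
theorem iterate_everyone_eq {W : Type} [Finite W] (M : Model W) (G : Finset Agent) (T : Set W)
    {n : ℕ} (hn : Nat.card W ≤ n) : (fun A => M.everyone G (T ∩ A))^[n] Set.univ =
      {w | ∀ n : ℕ, 1 ≤ n → w ∈ (M.everyone G)^[n] T} := by
  have hk : ∀ k w, w ∈ (fun A => M.everyone G (T ∩ A))^[k] Set.univ ↔
      ∀ j, j < k → w ∈ (M.everyone G)^[j + 1] T := by
    intro k
    induction k with
    | zero => simp
    | succ k ih =>
      intro w
      rw [Function.iterate_succ_apply']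
      simp only [mem_everyone, Set.mem_inter_iff, ih]
      constructor
      · intro h j hj
        rw [Function.iterate_succ_apply', mem_everyone]
        intro a ha u hu
        cases j with
        | zero => exact (h a ha u hu).1
        | succ j => exact (h a ha u hu).2 j (by omega)
      · intro h a ha u hu
        refine ⟨h 0 (by omega) a ha u hu, fun j hj => ?_⟩
        have := h (j + 1) (by omega)
        rw [Function.iterate_succ_apply'] at this
        exact this a ha u hu
  have hmono : Monotone fun A => M.everyone G (T ∩ A) := fun A B hAB w h a ha u hu =>
    ⟨(h a ha u hu).1, hAB (h a ha u hu).2⟩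
  ext w
  constructor
  · intro h j hj
    obtain ⟨j, rfl⟩ := Nat.exists_eq_add_of_le' hj
    refine (hk (max n (j + 1)) w).1 ?_ j (by omega)
    rwa [iterate_univ_stationary hmono hn (le_max_left _ _)]
  · intro h
    exact (hk n w).2 fun j _ => h (j + 1) (by omega)

variable {X : Set Op} {p : Presentation} {M : Model p.World} {env : Env} {v : List Name}
  {T : Set p.World}

/-- The set of worlds is listed by `v`, which may contain other names, too. -/
def Lists (v : List Name) (T : Set p.World) : Prop := ∀ w : p.World, w.1 ∈ v ↔ w ∈ T

/-- The model is described by the listings in `p`, except that the capabilities are given by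
`env`. -/
structure Rep (p : Presentation) (env : Env) (M : Model p.World) : Prop where
  edge_total : ∀ w u : p.World, ∃ S, (w.1, u.1, S) ∈ p.edges
  edge_mem : ∀ w u S, (w, u, S) ∈ p.edges →
    ∃ (hw : w ∈ p.worlds) (hu : u ∈ p.worlds), M.E ⟨w, hw⟩ ⟨u, hu⟩ = {s | s ∈ S}
  val_total : ∀ w : p.World, ∃ S, (w.1, S) ∈ p.vals
  val_mem : ∀ w S, (w, S) ∈ p.vals → ∃ hw : w ∈ p.worlds, M.β ⟨w, hw⟩ = {q | q ∈ S}
  cap : ∀ a l, lookup env a = some l → M.C a = {s | s ∈ l}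
  dom : ∀ a, a ∈ p.agents ↔ ∃ l, lookup env a = some l

theorem lookup_cons (a b : Agent) (l : List Skill) (env : Env) :
    lookup ((a, l) :: env) b = if a = b then some l else lookup env b := by
  by_cases h : a = b <;> simp [lookup, eqb, h]

theorem mem_of_lookup {a : Agent} {l : List Skill} (h : lookup env a = some l) : (a, l) ∈ env := by
  induction env with
  | nil => cases h
  | cons e env ih =>
    rw [show e = (e.1, e.2) from rfl, lookup_cons] at h
    split_ifs at h with he
    · cases h
      simp [← he]
    · exact List.mem_cons_of_mem _ (ih h)

theorem exists_lookup {a : Agent} : (∃ l, lookup env a = some l) ↔ ∃ l, (a, l) ∈ env := by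
  refine ⟨fun ⟨l, h⟩ => ⟨l, mem_of_lookup h⟩, ?_⟩
  rintro ⟨l, h⟩
  induction env with
  | nil => cases h
  | cons e env ih =>
    rw [show e = (e.1, e.2) from rfl, lookup_cons]
    split_ifs with he
    · exact ⟨e.2, rfl⟩
    · rcases List.mem_cons.1 h with rfl | h
      · exact absurd rfl he
      · exact ih h

theorem known_iff {G : List Agent} :
    known env G = true ↔ ∀ a ∈ G, ∃ l, lookup env a = some l := by
  simp only [known, List.all_eq_true, List.any_eq_true, eqb_iff, exists_lookup, Prod.exists]
  exact forall₂_congr fun a _ => ⟨fun ⟨b, l, h, hb⟩ => ⟨l, hb ▸ h⟩, fun ⟨l, h⟩ => ⟨a, l, h, rfl⟩⟩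

theorem Presents.rep (h : p.Presents M) : Rep p p.caps M where
  edge_total := h.edge_total
  edge_mem := h.edge_mem
  val_total := h.val_total
  val_mem := h.val_mem
  cap _ _ hl := h.cap_mem _ _ (mem_of_lookup hl)
  dom _ := exists_lookup.symm

namespace Rep

theorem setSkills (h : Rep p env M) {a : Agent} (ha : a ∈ p.agents) {l : List Skill} {S : Set Skill}
    (hS : {s | s ∈ l} = S) : Rep p ((a, l) :: env) (M.setSkills a S) where
  edge_total := h.edge_total
  edge_mem := h.edge_mem
  val_total := h.val_total
  val_mem := h.val_mem
  cap b _ hl := by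
    rw [lookup_cons] at hl
    split_ifs at hl with hab
    · cases hl
      subst hab
      simp [Model.setSkills, hS]
    · simpa [Model.setSkills, Function.update_of_ne (Ne.symm hab)] using h.cap b _ hl
  dom b := by
    rw [lookup_cons]
    split_ifs with hab
    · subst hab
      simp [ha]
    · exact h.dom b

theorem known_iff (h : Rep p env M) {G : List Agent} :
    known env G = true ↔ ∀ a ∈ G, a ∈ p.agents := by
  simp only [PolyTime.known_iff, h.dom]

theorem skills_eq (h : Rep p env M) {a : Agent} (ha : a ∈ p.agents) :
    M.C a = {s | s ∈ skills env a} := by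
  obtain ⟨l, hl⟩ := (h.dom a).1 ha
  rw [h.cap a l hl, skills, hl, ocase_some]

theorem lists_filter {f : Name → Bool} (hf : ∀ w : p.World, f w.1 = true ↔ w ∈ T) :
    Lists (p.worlds.filter f) T := by
  intro w
  rw [List.mem_filter, hf]
  exact and_iff_right w.2

theorem lists_box (h : Rep p env M) (hv : Lists v T) (S : List Skill) :
    Lists (boxList p S v) (M.box {s | s ∈ S} T) := by
  refine lists_filter fun w => ?_
  simp only [List.all_eq_true, Bool.or_eq_true, Bool.not_eq_true', Bool.and_eq_false_iff,
    any_eqb, Prod.forall, Model.box, Set.mem_ofPred_eq]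
  constructor
  · intro hw u hu
    obtain ⟨S', hS'⟩ := h.edge_total w u
    obtain ⟨_, _, he⟩ := h.edge_mem _ _ _ hS'
    rcases hw _ _ _ hS' with (hn | hn) | hn
    · simp [eqb] at hn
    · have : PolyTime.subset S S' = true := by
        rw [subset_iff]
        intro s hs
        have := hu hs
        rw [he] at this
        exact this
      rw [this] at hn
      cases hn
    · exact (hv u).1 hn
  · intro hw w' u' S' hS'
    obtain ⟨hw', hu', he⟩ := h.edge_mem _ _ _ hS'
    by_cases hww : w' = w.1
    · by_cases hsub : S ⊆ S'
      · right
        refine (hv ⟨u', hu'⟩).2 (hw _ fun s hs => ?_)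
        have hwe : (⟨w', hw'⟩ : p.World) = w := Subtype.ext hww
        rw [← hwe, he]
        exact hsub hs
      · left; right
        rw [Bool.eq_false_iff]
        simpa using hsub
    · left; left
      rw [Bool.eq_false_iff]
      simpa using hww

theorem lists_everyone (h : Rep p env M) (hv : Lists v T) {G : List Agent}
    (hG : ∀ a ∈ G, a ∈ p.agents) :
    Lists (everyoneList p env G v) (M.everyone G.toFinset T) := by
  refine lists_filter fun w => ?_
  simp only [List.all_eq_true, any_eqb, Model.everyone, List.mem_toFinset, Set.mem_ofPred_eq]
  refine forall₂_congr fun a ha => ?_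
  rw [h.skills_eq (hG a ha)]
  exact h.lists_box hv _ w

theorem union_eq (h : Rep p env M) {G : List Agent} (hG : ∀ a ∈ G, a ∈ p.agents) :
    ⋃ a ∈ G.toFinset, M.C a = {s | s ∈ unionList env G} := by
  ext s
  simp only [Set.mem_iUnion, List.mem_toFinset, unionList, List.mem_flatten, List.mem_map,
    Set.mem_ofPred_eq]
  constructor
  · rintro ⟨a, ha, hs⟩
    rw [h.skills_eq (hG a ha)] at hs
    exact ⟨_, ⟨a, ha, rfl⟩, hs⟩
  · rintro ⟨_, ⟨a, ha, rfl⟩, hs⟩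
    refine ⟨a, ha, ?_⟩
    rw [h.skills_eq (hG a ha)]
    exact hs

theorem inter_eq (h : Rep p env M) {G : List Agent} (hG : ∀ a ∈ G, a ∈ p.agents) (hne : G ≠ []) :
    ⋂ a ∈ G.toFinset, M.C a = {s | s ∈ interList env G} := by
  have hU := h.union_eq hG
  ext s
  have hs := Set.ext_iff.1 hU s
  simp only [Set.mem_iUnion, List.mem_toFinset, Set.mem_ofPred_eq] at hs
  simp only [Set.mem_iInter, List.mem_toFinset, interList, List.mem_filter, List.all_eq_true,
    any_eqb, Set.mem_ofPred_eq]
  obtain ⟨b, hb⟩ := List.exists_mem_of_ne_nil G hne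
  constructor
  · intro hi
    refine ⟨hs.1 ⟨b, hb, hi b hb⟩, fun a ha => ?_⟩
    have := hi a ha
    rw [h.skills_eq (hG a ha)] at this
    exact this
  · rintro ⟨_, hi⟩ a ha
    rw [h.skills_eq (hG a ha)]
    exact hi a ha

theorem card_worlds_le (p : Presentation) : Nat.card p.World ≤ p.worlds.length := by
  have h : Nat.card p.World = p.worlds.toFinset.card := by
    rw [← Nat.card_eq_finsetCard]
    exact Nat.card_congr (Equiv.subtypeEquivRight fun w => by simp)
  rw [h]
  exact List.toFinset_card_le _

theorem lists_common (h : Rep p env M) (hv : Lists v T) {G : List Agent}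
    (hG : ∀ a ∈ G, a ∈ p.agents) :
    Lists (commonList p env G v)
      {w | ∀ n : ℕ, 1 ≤ n → w ∈ (M.everyone G.toFinset)^[n] T} := by
  have : Finite p.World := (p.worlds.finite_toSet).to_subtype
  rw [← iterate_everyone_eq M G.toFinset T (card_worlds_le p), commonList, List.foldl_const]
  generalize p.worlds.length = n
  induction n with
  | zero => intro w; simp [w.2]
  | succ n ih =>
    rw [Function.iterate_succ_apply', Function.iterate_succ_apply']
    refine h.lists_everyone (fun w => ?_) hG
    rw [List.mem_filter, any_eqb, hv, ih]
    rfl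

end Rep

/-! ### Listings of models -/

theorem cond_eq_true_iff {b c : Bool} :
    (bif b then c else true) = true ↔ (b = true → c = true) := by
  cases b <;> simp

theorem valid_iff : valid p = true ↔
    (∀ w u S, (w, u, S) ∈ p.edges → w ∈ p.worlds ∧ u ∈ p.worlds) ∧
    (∀ w ∈ p.worlds, ∀ u ∈ p.worlds, ∃ S, (w, u, S) ∈ p.edges) ∧
    (∀ w u S, (w, u, S) ∈ p.edges → ∀ w' u' S', (w', u', S') ∈ p.edges →
      (w = w' ∧ u = u') ∨ (w = u' ∧ u = w') → {s | s ∈ S} = {s | s ∈ S'}) ∧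
    (∀ a S, (a, S) ∈ p.caps → ∀ a' S', (a', S') ∈ p.caps → a = a' →
      {s | s ∈ S} = {s | s ∈ S'}) ∧
    (∀ w S, (w, S) ∈ p.vals → w ∈ p.worlds) ∧
    (∀ w ∈ p.worlds, ∃ S, (w, S) ∈ p.vals) ∧
    (∀ w S, (w, S) ∈ p.vals → ∀ w' S', (w', S') ∈ p.vals → w = w' →
      {s | s ∈ S} = {s | s ∈ S'}) := by
  simp only [valid, Bool.and_eq_true, cond_eq_true_iff, List.all_eq_true, List.any_eq_true,
    eqb_iff, Bool.or_eq_true, setEq_iff, Prod.forall, Prod.exists, and_assoc]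
  simp

theorem valid_of_presents (h : p.Presents M) : valid p = true := by
  rw [valid_iff]
  refine ⟨fun w u S hS => ?_, fun w hw u hu => h.edge_total ⟨w, hw⟩ ⟨u, hu⟩, ?_, ?_,
    fun w S hS => (h.val_mem w S hS).1, fun w hw => h.val_total ⟨w, hw⟩, ?_⟩
  · obtain ⟨hw, hu, _⟩ := h.edge_mem w u S hS
    exact ⟨hw, hu⟩
  · intro w u S hS w' u' S' hS' he
    obtain ⟨hw, hu, h₁⟩ := h.edge_mem w u S hS
    obtain ⟨hw', hu', h₂⟩ := h.edge_mem w' u' S' hS'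
    rw [← h₁, ← h₂]
    rcases he with ⟨rfl, rfl⟩ | ⟨rfl, rfl⟩
    · rfl
    · exact M.symmetry _ _
  · rintro a S hS _ S' hS' rfl
    rw [← h.cap_mem a S hS, ← h.cap_mem a S' hS']
  · rintro w S hS _ S' hS' rfl
    obtain ⟨hw, h₁⟩ := h.val_mem w S hS
    obtain ⟨hw', h₂⟩ := h.val_mem w S' hS'
    rw [← h₁, ← h₂]

theorem exists_presents (h : valid p = true) (w₀ : p.World) :
    ∃ M : Model p.World, p.Presents M := by
  obtain ⟨h₁, h₂, h₃, h₄, h₅, h₆, h₇⟩ := valid_iff.1 h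
  have h₂' : ∀ w u : p.World, ∃ S, (w.1, u.1, S) ∈ p.edges := fun w u => h₂ w w.2 u u.2
  have h₆' : ∀ w : p.World, ∃ S, (w.1, S) ∈ p.vals := fun w => h₆ w w.2
  choose E hE using h₂'
  choose V hV using h₆'
  let M : Model p.World :=
    { nonempty := ⟨w₀⟩
      E := fun w u => {s | s ∈ E w u}
      C := fun a => {s | ∃ S, (a, S) ∈ p.caps ∧ s ∈ S}
      β := fun w => {q | q ∈ V w}
      -- A finite set of skills is never the set of all skills.
      positivity := fun w u hwu => absurd ((E w u).finite_toSet)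
        (by
          have : {s | s ∈ E w u} = (Set.univ : Set Skill) := hwu
          rw [this]
          exact Set.infinite_univ)
      symmetry := fun w u => h₃ _ _ _ (hE w u) _ _ _ (hE u w) (.inr ⟨rfl, rfl⟩) }
  refine ⟨M, fun w u => ⟨_, hE w u⟩, fun w u S hS => ?_, fun a S hS => ?_, fun w => ⟨_, hV w⟩,
    fun w S hS => ⟨h₅ w S hS, h₇ _ _ (hV _) _ _ hS rfl⟩⟩
  · obtain ⟨hw, hu⟩ := h₁ w u S hS
    exact ⟨hw, hu, h₃ _ _ _ (hE ⟨w, hw⟩ ⟨u, hu⟩) _ _ _ hS (.inl ⟨rfl, rfl⟩)⟩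
  · ext s
    constructor
    · rintro ⟨S', hS', hs⟩
      have := h₄ _ _ hS' _ _ hS rfl
      exact (Set.ext_iff.1 this s).1 hs
    · intro hs
      exact ⟨S, hS, hs⟩

end

section

variable {X : Set Op} {p : Presentation} {φ ψ : Formula} {s t r : List Letter}

/-! ### Correctness of the evaluation -/

/-- The evaluation, when it comes to the formula `φ` written as `t` with `r` behind it, computes
the truth set of `φ` in at most `2 * t.length` steps and goes on with `r`. -/
def Evaluates (X : Set Op) (p : Presentation) (φ : Formula) (t r : List Letter) : Prop :=
  ∀ env (M : Model p.World), Rep p env M → ∀ fr, ∃ k ≤ 2 * t.length, ∃ v env',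
    Lists v (M.truthSet φ) ∧ (step X p)^[k] (start env fr (t ++ r)) = some (some v, env', fr, r)

theorem step_start (env : Env) (fr : List Frame) (c : Letter) (r : List Letter) :
    step X p (start env fr (c :: r)) = letterStep X p env fr c r := rfl

theorem step_return (v : List Name) (env : Env) (f : Frame) (fr : List Frame) (r : List Letter) :
    step X p (some (some v, env, f :: fr, r)) = frameStep p v env f fr r := rfl

theorem step_stop (v : List Name) (env : Env) (r : List Letter) :
    step X p (some (some v, env, [], r)) = some (some v, env, [], r) := rfl

theorem step_none : step X p none = none := rfl

namespace Evaluates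

/-- An operator whose truth set is computed from that of the operand by means of a frame. -/
theorem frame (h : Evaluates X p φ s r) (hlen : s.length < t.length) (f : Env → Frame)
    (g : Env → List Name → List Name)
    (h₁ : ∀ env (M : Model p.World), Rep p env M → ∀ fr,
      step X p (start env fr (t ++ r)) = start env (f env :: fr) (s ++ r))
    (h₂ : ∀ env v env' fr, frameStep p v env' (f env) fr r = some (some (g env v), env', fr, r))
    (h₃ : ∀ env (M : Model p.World) v, Rep p env M → Lists v (M.truthSet φ) →
      Lists (g env v) (M.truthSet ψ)) : Evaluates X p ψ t r := by
  intro env M hM fr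
  obtain ⟨k, hk, v, env', hv, he⟩ := h env M hM (f env :: fr)
  refine ⟨k + 1 + 1, by omega, g env v, env', h₃ env M v hM hv, ?_⟩
  rw [Function.iterate_succ_apply, h₁ env M hM, Function.iterate_succ_apply', he, step_return, h₂]

/-- An operator that changes the model in which the operand is evaluated. -/
theorem change (h : Evaluates X p φ s r) (hlen : s.length < t.length)
    (h₁ : ∀ env (M : Model p.World), Rep p env M → ∃ env' M', Rep p env' M' ∧
      M.truthSet ψ = M'.truthSet φ ∧
      ∀ fr, step X p (start env fr (t ++ r)) = start env' fr (s ++ r)) : Evaluates X p ψ t r := by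
  intro env M hM fr
  obtain ⟨env', M', hM', hT, hs⟩ := h₁ env M hM
  obtain ⟨k, hk, v, env'', hv, he⟩ := h env' M' hM' fr
  refine ⟨k + 1, by omega, v, env'', hT ▸ hv, ?_⟩
  rw [Function.iterate_succ_apply, hs, he]

end Evaluates

/-- The letters with which a formula may begin. -/
def IsHead : Letter → Prop
  | .mark | .neg | .lpar | .K | .C | .D | .E | .F => True
  | _ => False

theorem writes_head (h : φ.Writes t) : ∃ c s, t = c :: s ∧ IsHead c := by
  cases h <;> exact ⟨_, _, rfl, trivial⟩

theorem head?_ne_bit (h : φ.Writes t) (r : List Letter) (b : Bool) :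
    (t ++ r).head? ≠ some (.bit b) := by
  obtain ⟨c, s, rfl, hc⟩ := writes_head h
  intro hb
  simp only [List.cons_append, List.head?_cons, Option.some.injEq] at hb
  subst hb
  exact hc

theorem exactly_name (h : φ.Writes t) (a : Name) (r : List Letter) :
    exactly nameStr readName (nameStr a ++ (t ++ r)) = some (a, t ++ r) :=
  reader_name.exactly_write a (head?_ne_bit h r)

theorem exactly_set (h : φ.Writes t) (l : List Name) (r : List Letter) :
    exactly setStr readSet (setStr l ++ (t ++ r)) = some (l, t ++ r) :=
  reader_set.exactly_write l (head?_ne_bit h r)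

theorem Evaluates.atom {q : Atom} (hr : exactly nameStr readName (nameStr q ++ r) = some (q, r)) :
    Evaluates X p (.atom q) (nameStr q) r := by
  intro env M hM fr
  refine ⟨1, by simp [nameStr]; omega, p.worlds.filter fun w => p.vals.any fun v =>
    eqb v.1 w && v.2.any fun a => eqb q a, env, ?_, ?_⟩
  rotate_left
  · rw [Function.iterate_one, nameStr, List.cons_append, step_start, letterStep]
    rw [nameStr, List.cons_append] at hr
    rw [hr, ocase_some]
  · refine Rep.lists_filter fun w => ?_
    simp only [List.any_eq_true, Bool.and_eq_true, eqb_iff, Prod.exists, Model.truthSet,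
      Set.mem_ofPred_eq]
    constructor
    · rintro ⟨u, S, hS, rfl, _, hq, rfl⟩
      obtain ⟨hu, he⟩ := hM.val_mem _ _ hS
      rw [show w = ⟨w.1, hu⟩ from rfl, he]
      exact hq
    · intro hq
      obtain ⟨S, hS⟩ := hM.val_total w
      obtain ⟨_, he⟩ := hM.val_mem _ _ hS
      rw [show M.β w = _ from he] at hq
      exact ⟨w.1, S, hS, rfl, _, hq, rfl⟩

theorem Evaluates.neg (h : Evaluates X p φ s r) : Evaluates X p (.neg φ) ([.neg] ++ s) r := by
  refine h.frame (by simp) (fun env => (.neg, env, [], []))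
    (fun _ v => p.worlds.filter fun w => !v.any fun u => eqb w u) (fun _ _ _ _ => rfl)
    (fun _ _ _ _ => rfl) fun env M v _ hv => Rep.lists_filter fun w => ?_
  rw [Bool.not_eq_true', ← Bool.not_eq_true, any_eqb, hv]
  rfl

theorem parenStep_head {c : Letter} (hc : IsHead c) (env : Env) (fr : List Frame)
    (r : List Letter) :
    parenStep X env fr c r = start env ((.left, env, [], []) :: fr) (c :: r) := by
  cases c <;> first | rfl | exact absurd hc id

theorem Evaluates.imp (hs : φ.Writes s) (h : Evaluates X p φ s (.imp :: (t ++ (.rpar :: r))))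
    (h' : Evaluates X p ψ t (.rpar :: r)) :
    Evaluates X p (.imp φ ψ) ([.lpar] ++ s ++ [.imp] ++ t ++ [.rpar]) r := by
  intro env M hM fr
  obtain ⟨k, hk, v, env₁, hv, he⟩ := h env M hM ((.left, env, [], []) :: fr)
  obtain ⟨k', hk', v', env₂, hv', he'⟩ := h' env M hM ((.right, env, [], v) :: fr)
  have h₀ : step X p (start env fr ([.lpar] ++ s ++ [.imp] ++ t ++ [.rpar] ++ r)) =
      start env ((.left, env, [], []) :: fr) (s ++ (.imp :: (t ++ (.rpar :: r)))) := by
    obtain ⟨c, s', rfl, hc⟩ := writes_head hs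
    simp only [List.cons_append, List.append_assoc, List.nil_append, step_start, letterStep,
      lcase_cons, parenStep_head hc]
  have h₁ : step X p (some (some v, env₁, (.left, env, [], []) :: fr,
      .imp :: (t ++ (.rpar :: r)))) =
      start env ((.right, env, [], v) :: fr) (t ++ (.rpar :: r)) := rfl
  refine ⟨k' + 1 + 1 + k + 1, ?_, p.worlds.filter fun w =>
    !(v.any fun u => eqb w u) || v'.any fun u => eqb w u, env₂, Rep.lists_filter fun w => ?_, ?_⟩
  · simp only [List.length_append, List.length_cons, List.length_nil]
    omega
  · have h₃ := hv w
    have h₄ := hv' w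
    rw [Bool.or_eq_true, Bool.not_eq_true', ← Bool.not_eq_true, any_eqb, any_eqb, h₃, h₄]
    exact imp_iff_not_or.symm
  · rw [Function.iterate_succ_apply, h₀, Function.iterate_add_apply, he,
      Function.iterate_succ_apply, h₁, Function.iterate_succ_apply', he', step_return]
    rfl

section group
variable {G : Finset Agent} {hG : G.Nonempty} {l : List Agent}

theorem ne_nil_of_toFinset (hG : G.Nonempty) (hl : l.toFinset = G) : l ≠ [] := by
  rintro rfl
  simp [← hl] at hG

theorem readGroup_eq (hG : G.Nonempty) (hl : l.toFinset = G) (hag : ∀ a ∈ l, a ∈ p.agents)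
    (hs : φ.Writes s) {env : Env} {M : Model p.World} (hM : Rep p env M) (g : Tag)
    (fr : List Frame) : readGroup true g env fr (setStr l ++ (s ++ r)) =
      start env ((g, env, l, []) :: fr) (s ++ r) := by
  have h₁ : (true && (!eqb l [] && known env l)) = true := by
    rw [hM.known_iff.2 hag]
    simp [eqb, ne_nil_of_toFinset hG hl]
  rw [readGroup, exactly_set hs, ocase_some, h₁, cond_true, start]

theorem Evaluates.know {a : Agent} (ha : a ∈ p.agents) (hs : φ.Writes s) (h : Evaluates X p φ s r) :
    Evaluates X p (.know a φ) ([.K] ++ nameStr a ++ s) r := by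
  have hag : ∀ b ∈ [a], b ∈ p.agents := by simpa using ha
  refine h.frame (by simp) (fun env => (.mutual, env, [a], []))
    (fun env v => everyoneList p env [a] v) (fun env M hM fr => ?_) (fun _ _ _ _ => rfl)
    fun env M v hM hv => ?_
  · simp only [List.cons_append, List.append_assoc, List.nil_append, step_start, letterStep]
    rw [exactly_name hs, ocase_some, hM.known_iff.2 hag, cond_true, start]
  · have := hM.lists_everyone hv hag
    simpa [Model.everyone, Model.truthSet] using this

theorem Evaluates.common (hX : Op.common ∈ X) (hl : l.toFinset = G) (hag : ∀ a ∈ l, a ∈ p.agents)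
    (hs : φ.Writes s) (h : Evaluates X p φ s r) :
    Evaluates X p (.common G hG φ) ([.C] ++ setStr l ++ s) r := by
  refine h.frame (by simp) (fun env => (.common, env, l, []))
    (fun env v => commonList p env l v) (fun env M hM fr => ?_) (fun _ _ _ _ => rfl)
    fun env M v hM hv => ?_
  · simp only [List.cons_append, List.append_assoc, List.nil_append, step_start, letterStep,
      hX, decide_true]
    exact readGroup_eq hG hl hag hs hM _ _
  · subst hl
    exact hM.lists_common hv hag

theorem Evaluates.distributed (hX : Op.distributed ∈ X) (hl : l.toFinset = G)
    (hag : ∀ a ∈ l, a ∈ p.agents) (hs : φ.Writes s) (h : Evaluates X p φ s r) :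
    Evaluates X p (.distributed G hG φ) ([.D] ++ setStr l ++ s) r := by
  refine h.frame (by simp) (fun env => (.distributed, env, l, []))
    (fun env v => boxList p (unionList env l) v) (fun env M hM fr => ?_) (fun _ _ _ _ => rfl)
    fun env M v hM hv => ?_
  · simp only [List.cons_append, List.append_assoc, List.nil_append, step_start, letterStep,
      hX, decide_true]
    exact readGroup_eq hG hl hag hs hM _ _
  · subst hl
    rw [Model.truthSet, hM.union_eq hag]
    exact hM.lists_box hv _

theorem Evaluates.mutual (hX : Op.mutual ∈ X) (hl : l.toFinset = G) (hag : ∀ a ∈ l, a ∈ p.agents)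
    (hs : φ.Writes s) (h : Evaluates X p φ s r) :
    Evaluates X p (.mutual G hG φ) ([.E] ++ setStr l ++ s) r := by
  refine h.frame (by simp) (fun env => (.mutual, env, l, []))
    (fun env v => everyoneList p env l v) (fun env M hM fr => ?_) (fun _ _ _ _ => rfl)
    fun env M v hM hv => ?_
  · simp only [List.cons_append, List.append_assoc, List.nil_append, step_start, letterStep,
      hX, decide_true]
    exact readGroup_eq hG hl hag hs hM _ _
  · subst hl
    exact hM.lists_everyone hv hag

theorem Evaluates.field (hX : Op.field ∈ X) (hl : l.toFinset = G) (hag : ∀ a ∈ l, a ∈ p.agents)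
    (hs : φ.Writes s) (h : Evaluates X p φ s r) :
    Evaluates X p (.field G hG φ) ([.F] ++ setStr l ++ s) r := by
  have hne := ne_nil_of_toFinset hG hl
  refine h.frame (by simp) (fun env => (.field, env, l, []))
    (fun env v => boxList p (interList env l) v) (fun env M hM fr => ?_) (fun _ _ _ _ => rfl)
    fun env M v hM hv => ?_
  · simp only [List.cons_append, List.append_assoc, List.nil_append, step_start, letterStep,
      hX, decide_true]
    exact readGroup_eq hG hl hag hs hM _ _
  · subst hl
    rw [Model.truthSet, hM.inter_eq hag hne]
    exact hM.lists_box hv _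

end group

section update
variable {S : Finset Skill} {hS : S.Nonempty} {l : List Skill} {a : Agent}

theorem readUpdate_eq (hS : S.Nonempty) (hl : l.toFinset = S) (hs : φ.Writes s) {env : Env}
    {L : List Skill} (hL : lookup env a = some L) (op : List Skill → List Skill → List Skill)
    (fr : List Frame) :
    readUpdate true op env fr (setStr l ++ (.rpar :: (nameStr a ++ (s ++ r)))) =
      start ((a, op L l) :: env) fr (s ++ r) := by
  have h₁ : (true && (!eqb l [] && eqb Letter.rpar .rpar)) = true := by
    simp [eqb, ne_nil_of_toFinset hS hl]
  rw [readUpdate, reader_set.exactly_write l (by simp), ocase_some, lcase_cons, exactly_name hs,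
    ocase_some, hL, ocase_some, h₁, cond_true, start]

theorem Evaluates.upskill (hX : Op.upskill ∈ X) (hl : l.toFinset = S) (ha : a ∈ p.agents)
    (hs : φ.Writes s) (h : Evaluates X p φ s r) :
    Evaluates X p (.upskill S hS a φ)
      ([.lpar, .plus] ++ setStr l ++ [.rpar] ++ nameStr a ++ s) r := by
  refine h.change (by simp; omega) fun env M hM => ?_
  obtain ⟨L, hL⟩ := (hM.dom a).1 ha
  refine ⟨(a, L ++ l) :: env, M.setSkills a (M.C a ∪ S), hM.setSkills ha ?_, rfl, fun fr => ?_⟩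
  · rw [hM.cap a L hL, ← hl]
    ext x
    simp
  · simp only [List.cons_append, List.append_assoc, List.nil_append, step_start, letterStep,
      lcase_cons, parenStep, hX, decide_true]
    exact readUpdate_eq hS hl hs hL _ fr

theorem Evaluates.downskill (hX : Op.downskill ∈ X) (hl : l.toFinset = S) (ha : a ∈ p.agents)
    (hs : φ.Writes s) (h : Evaluates X p φ s r) : Evaluates X p (.downskill S hS a φ)
      ([.lpar, .minus] ++ setStr l ++ [.rpar] ++ nameStr a ++ s) r := by
  refine h.change (by simp; omega) fun env M hM => ?_
  obtain ⟨L, hL⟩ := (hM.dom a).1 ha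
  refine ⟨(a, L.filter fun x => !l.any fun y => eqb x y) :: env, M.setSkills a (M.C a \ S),
    hM.setSkills ha ?_, rfl, fun fr => ?_⟩
  · rw [hM.cap a L hL, ← hl]
    ext x
    simp only [List.mem_filter, Bool.not_eq_true', ← Bool.not_eq_true, any_eqb,
      Set.mem_ofPred_eq, Set.mem_sdiff, List.coe_toFinset]
  · simp only [List.cons_append, List.append_assoc, List.nil_append, step_start, letterStep,
      lcase_cons, parenStep, hX, decide_true]
    exact readUpdate_eq hS hl hs hL _ fr

theorem Evaluates.reskill (hX : Op.reskill ∈ X) (hl : l.toFinset = S) (ha : a ∈ p.agents)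
    (hs : φ.Writes s) (h : Evaluates X p φ s r) :
    Evaluates X p (.reskill S hS a φ)
      ([.lpar, .eq] ++ setStr l ++ [.rpar] ++ nameStr a ++ s) r := by
  refine h.change (by simp; omega) fun env M hM => ?_
  obtain ⟨L, hL⟩ := (hM.dom a).1 ha
  refine ⟨(a, l) :: env, M.setSkills a S, hM.setSkills ha ?_, rfl, fun fr => ?_⟩
  · rw [← hl]
    ext x
    simp
  · simp only [List.cons_append, List.append_assoc, List.nil_append, step_start, letterStep,
      lcase_cons, parenStep, hX, decide_true]
    exact readUpdate_eq hS hl hs hL (fun _ S => S) fr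

theorem Evaluates.learn {b : Agent} (hX : Op.learn ∈ X) (hb : b ∈ p.agents) (ha : a ∈ p.agents)
    (hs : φ.Writes s) (h : Evaluates X p φ s r) :
    Evaluates X p (.learn b a φ) ([.lpar, .equiv] ++ nameStr b ++ [.rpar] ++ nameStr a ++ s) r := by
  refine h.change (by simp; omega) fun env M hM => ?_
  obtain ⟨L, hL⟩ := (hM.dom b).1 hb
  refine ⟨(a, L) :: env, M.setSkills a (M.C b), hM.setSkills ha (hM.cap b L hL).symm, rfl,
    fun fr => ?_⟩
  have h₁ : (true && (known env [a] && eqb Letter.rpar .rpar)) = true := by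
    rw [hM.known_iff.2 (by simpa using ha)]
    simp [eqb]
  simp only [List.cons_append, List.append_assoc, List.nil_append, step_start, letterStep,
    lcase_cons, parenStep, hX, decide_true]
  rw [readLearn, reader_name.exactly_write b (by simp), ocase_some, lcase_cons, exactly_name hs,
    ocase_some, hL, ocase_some, h₁, cond_true, start]

end update

/-- Formulas of the language about known agents are evaluated correctly. -/
theorem runs_of_writes (h : φ.Writes t) (hX : φ.ops ⊆ X) (ha : φ.agents ⊆ p.agents)
    (hr : ∀ b, r.head? ≠ some (.bit b)) : Evaluates X p φ t r := by
  induction h generalizing r with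
  | atom q => exact .atom (reader_name.exactly_write q hr)
  | neg h ih => exact .neg (ih hX ha hr)
  | imp h h' ih ih' =>
    simp only [Formula.ops, Formula.agents, Set.union_subset_iff] at hX ha
    exact .imp h (ih hX.1 ha.1 (by simp)) (ih' hX.2 ha.2 (by simp))
  | know a h ih =>
    simp only [Formula.ops, Formula.agents, Set.insert_subset_iff] at hX ha
    exact .know ha.1 h (ih hX ha.2 hr)
  | common G hG l hl h ih =>
    simp only [Formula.ops, Formula.agents, Set.insert_subset_iff, Set.union_subset_iff] at hX ha
    exact .common hX.1 hl (fun a h => ha.1 (by simpa [← hl] using h)) h (ih hX.2 ha.2 hr)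
  | distributed G hG l hl h ih =>
    simp only [Formula.ops, Formula.agents, Set.insert_subset_iff, Set.union_subset_iff] at hX ha
    exact .distributed hX.1 hl (fun a h => ha.1 (by simpa [← hl] using h)) h (ih hX.2 ha.2 hr)
  | field G hG l hl h ih =>
    simp only [Formula.ops, Formula.agents, Set.insert_subset_iff, Set.union_subset_iff] at hX ha
    exact .field hX.1 hl (fun a h => ha.1 (by simpa [← hl] using h)) h (ih hX.2 ha.2 hr)
  | upskill S hS a l hl h ih =>
    simp only [Formula.ops, Formula.agents, Set.insert_subset_iff] at hX ha
    exact .upskill hX.1 hl ha.1 h (ih hX.2 ha.2 hr)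
  | downskill S hS a l hl h ih =>
    simp only [Formula.ops, Formula.agents, Set.insert_subset_iff] at hX ha
    exact .downskill hX.1 hl ha.1 h (ih hX.2 ha.2 hr)
  | reskill S hS a l hl h ih =>
    simp only [Formula.ops, Formula.agents, Set.insert_subset_iff] at hX ha
    exact .reskill hX.1 hl ha.1 h (ih hX.2 ha.2 hr)
  | learn b a h ih =>
    simp only [Formula.ops, Formula.agents, Set.insert_subset_iff] at hX ha
    exact .learn hX.1 ha.1 ha.2.1 h (ih hX.2 ha.2.2 hr)
  | _ =>
    rename_i hl h ih
    simp only [Formula.ops, Formula.agents, Set.insert_subset_iff, Set.union_subset_iff] at hX ha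
    exact .mutual hX.1 hl (fun a h => ha.1 (by simpa [← hl] using h)) h (ih hX.2 ha.2 hr)

end

section

/-! ### The problem is in P -/

variable {X : Set Op} {p : Presentation}

/-- The evaluation that is in the state `q` ends without failure. -/
def Accepts (X : Set Op) (p : Presentation) (q : State) : Prop :=
  ∃ n v env r, (step X p)^[n] q = some (some v, env, [], r)

namespace Accepts

theorem not_none : ¬ Accepts X p none := by
  rintro ⟨n, v, env, r, h⟩
  rw [Function.iterate_fixed step_none] at h
  cases h

theorem iterate {q : State} (h : Accepts X p q) (k : ℕ) : Accepts X p ((step X p)^[k] q) := by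
  obtain ⟨n, v, env, r, h⟩ := h
  refine ⟨n, v, env, r, ?_⟩
  rw [← Function.iterate_add_apply, add_comm, Function.iterate_add_apply, h,
    Function.iterate_fixed (step_stop v env r)]

theorem ocase {β : Type} {o : Option β} {s : β → State} (h : Accepts X p (ocase o none s)) :
    ∃ x, o = some x ∧ Accepts X p (s x) := by
  cases o with
  | none => exact absurd h not_none
  | some x => exact ⟨x, rfl, h⟩

theorem lcase {β : Type} {l : List β} {s : β → List β → State}
    (h : Accepts X p (lcase l none s)) : ∃ x t, l = x :: t ∧ Accepts X p (s x t) := by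
  cases l with
  | nil => exact absurd h not_none
  | cons x t => exact ⟨x, t, rfl, h⟩

theorem cond {c : Bool} {q : State} (h : Accepts X p (bif c then q else none)) :
    c = true ∧ Accepts X p q := by
  cases c with
  | false => exact absurd h not_none
  | true => exact ⟨rfl, h⟩

end Accepts

/-- The string `ts` begins with a formula of the language about known agents, and the evaluation
deals with it correctly. -/
def Parses (X : Set Op) (p : Presentation) (ts : List Letter) : Prop :=
  ∃ (φ : Formula) (t r : List Letter), ts = t ++ r ∧ φ.Writes t ∧ φ.ops ⊆ X ∧
    φ.agents ⊆ p.agents ∧ Evaluates X p φ t r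

theorem readGroup_inv {b : Bool} {g : Tag} {env : Env} {fr : List Frame} {r : List Letter}
    {M : Model p.World} (hM : Rep p env M) (h : Accepts X p (readGroup b g env fr r)) :
    b = true ∧ ∃ l r', r = setStr l ++ r' ∧ l ≠ [] ∧ (∀ a ∈ l, a ∈ p.agents) ∧
      Accepts X p (start env ((g, env, l, []) :: fr) r') := by
  obtain ⟨⟨l, r'⟩, hl, h⟩ := h.ocase
  obtain ⟨hc, h⟩ := h.cond
  simp only [Bool.and_eq_true, Bool.not_eq_true', hM.known_iff] at hc
  exact ⟨hc.1, l, r', exactly_eq_some hl, by simpa [eqb] using hc.2.1, hc.2.2, h⟩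

theorem readUpdate_inv {b : Bool} {op : List Skill → List Skill → List Skill} {env : Env}
    {fr : List Frame} {r : List Letter} {M : Model p.World} (hM : Rep p env M)
    (h : Accepts X p (readUpdate b op env fr r)) :
    b = true ∧ ∃ l a L r', r = setStr l ++ (.rpar :: (nameStr a ++ r')) ∧ l ≠ [] ∧
      a ∈ p.agents ∧ Accepts X p (start ((a, L) :: env) fr r') := by
  obtain ⟨⟨l, r₁⟩, hl, h⟩ := h.ocase
  obtain ⟨c, r₂, hr₁, h⟩ := h.lcase
  obtain ⟨⟨a, r₃⟩, ha, h⟩ := h.ocase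
  obtain ⟨L, hL, h⟩ := h.ocase
  obtain ⟨hc, h⟩ := h.cond
  simp only [Bool.and_eq_true, Bool.not_eq_true', eqb_iff] at hc
  refine ⟨hc.1, l, a, _, r₃, ?_, by simpa [eqb] using hc.2.1, (hM.dom a).2 ⟨L, hL⟩, h⟩
  dsimp only at hr₁
  rw [exactly_eq_some hl, hr₁, exactly_eq_some ha, hc.2.2]

theorem readLearn_inv {b : Bool} {env : Env} {fr : List Frame} {r : List Letter}
    {M : Model p.World} (hM : Rep p env M) (h : Accepts X p (readLearn b env fr r)) :
    b = true ∧ ∃ a' a L r', r = nameStr a' ++ (.rpar :: (nameStr a ++ r')) ∧ a' ∈ p.agents ∧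
      a ∈ p.agents ∧ Accepts X p (start ((a, L) :: env) fr r') := by
  obtain ⟨⟨a', r₁⟩, hl, h⟩ := h.ocase
  obtain ⟨c, r₂, hr₁, h⟩ := h.lcase
  obtain ⟨⟨a, r₃⟩, ha, h⟩ := h.ocase
  obtain ⟨L, hL, h⟩ := h.ocase
  obtain ⟨hc, h⟩ := h.cond
  simp only [Bool.and_eq_true, hM.known_iff, eqb_iff] at hc
  refine ⟨hc.1, a', a, _, r₃, ?_, (hM.dom a').2 ⟨L, hL⟩, hc.2.1 a (by simp), h⟩
  dsimp only at hr₁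
  rw [exactly_eq_some hl, hr₁, exactly_eq_some ha, hc.2.2]

/-- Whenever the evaluation of a string does not fail, the string begins with a formula of the
language about known agents, by induction on the length of the string. -/
theorem parses_of_accepts (n : ℕ) : ∀ ts : List Letter, ts.length ≤ n → ∀ env fr
    (M : Model p.World), Rep p env M → Accepts X p (start env fr ts) → Parses X p ts := by
  induction n with
  | zero =>
    intro ts hts env fr M _ h
    rw [List.length_eq_zero_iff.1 (Nat.le_zero.1 hts)] at h
    exact absurd (h.iterate 1) Accepts.not_none
  | succ n ih =>
    intro ts hts env fr M hM h
    classical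
    rcases ts with _ | ⟨c, ts⟩
    · exact absurd (h.iterate 1) Accepts.not_none
    have hts' : ts.length ≤ n := by simpa using hts
    have h := h.iterate 1
    rw [Function.iterate_one, step_start] at h
    have hupdate : ∀ {b op r}, r.length ≤ n → Accepts X p (readUpdate b op env fr r) → b = true ∧
        ∃ l a φ t r', r = setStr l ++ (.rpar :: (nameStr a ++ (t ++ r'))) ∧ l.toFinset.Nonempty ∧
          a ∈ p.agents ∧ φ.Writes t ∧ φ.ops ⊆ X ∧ φ.agents ⊆ p.agents ∧
          Evaluates X p φ t r' := by
      intro b op r hn h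
      obtain ⟨hb, l, a, L, r₁, rfl, hl, ha, h⟩ := readUpdate_inv hM h
      obtain ⟨φ, t, r, rfl, hφ⟩ := ih r₁ (by simp at hn; omega) _ _ _ (hM.setSkills ha rfl) h
      exact ⟨hb, l, a, φ, t, r, rfl, by simpa using hl, ha, hφ⟩
    have hgroup : ∀ {b g}, Accepts X p (readGroup b g env fr ts) → b = true ∧
        ∃ l φ t r', ts = setStr l ++ (t ++ r') ∧ l.toFinset.Nonempty ∧ (∀ a ∈ l, a ∈ p.agents) ∧
          ((l.toFinset : Set Agent) ⊆ p.agents) ∧ φ.Writes t ∧ φ.ops ⊆ X ∧ φ.agents ⊆ p.agents ∧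
          Evaluates X p φ t r' := by
      intro b g h
      obtain ⟨hb, l, r₁, rfl, hl, ha, h⟩ := readGroup_inv hM h
      obtain ⟨φ, t, r, rfl, hφ⟩ := ih r₁ (by simp at hts'; omega) _ _ _ hM h
      exact ⟨hb, l, φ, t, r, rfl, by simpa using hl, ha, fun a h => ha a (by simpa using h), hφ⟩
    cases c <;> unfold letterStep at h <;> dsimp only at h <;>
      try exact absurd h Accepts.not_none
    · obtain ⟨⟨q, r⟩, hq, h⟩ := h.ocase
      have he := exactly_eq_some hq
      refine ⟨.atom q, nameStr q, r, he, .atom q, Set.empty_subset _, Set.empty_subset _,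
        .atom ?_⟩
      rw [← he, hq]
    · obtain ⟨c, r, rfl, hc⟩ := h.lcase
      have hr : r.length ≤ n := by simp at hts'; omega
      have himp : Accepts X p (start env ((.left, env, [], []) :: fr) (c :: r)) →
          Parses X p (.lpar :: c :: r) := by
        intro h
        obtain ⟨φ, t, r₁, ht, hφ, hX, ha, hE⟩ := ih _ hts' _ _ _ hM h
        rw [ht] at h ⊢
        -- The run on the left side is known to return, so that the whole run gets to what follows.
        obtain ⟨k, _, v, env', _, hk⟩ := hE env M hM ((.left, env, [], []) :: fr)
        have h₁ := (h.iterate k).iterate 1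
        rw [hk, Function.iterate_one, step_return] at h₁
        unfold frameStep at h₁
        obtain ⟨c₁, r₂, rfl, h₂⟩ := h₁.lcase
        obtain ⟨hc₁, h₃⟩ := h₂.cond
        rw [eqb_iff] at hc₁
        subst hc₁
        have hlen := congrArg List.length ht
        simp only [List.length_cons, List.length_append] at hlen hts'
        obtain ⟨ψ, u, r₃, rfl, hψ, hX', ha', hE'⟩ := ih r₂ (by omega) _ _ _ hM h₃
        obtain ⟨k, _, v', env'', _, hk⟩ := hE' env M hM ((.right, env, [], v) :: fr)
        have h₄ : Accepts X p (start env ((.right, env, [], v) :: fr) (u ++ r₃)) := h₃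
        have h₅ := (h₄.iterate k).iterate 1
        rw [hk, Function.iterate_one, step_return] at h₅
        unfold frameStep at h₅
        obtain ⟨c₂, r₄, rfl, h₆⟩ := h₅.lcase
        obtain ⟨hc₂, _⟩ := h₆.cond
        rw [eqb_iff] at hc₂
        subst hc₂
        exact ⟨.imp φ ψ, [.lpar] ++ t ++ [.imp] ++ u ++ [.rpar], r₄, by simp, .imp hφ hψ,
          Set.union_subset hX hX', Set.union_subset ha ha', .imp hφ hE hE'⟩
      cases c <;> unfold parenStep at hc <;> try exact himp hc
      · obtain ⟨hb, l, a, φ, t, r', rfl, hS, ha, hφ, hX, hA, hE⟩ := hupdate hr hc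
        replace hb := of_decide_eq_true hb
        exact ⟨.upskill l.toFinset hS a φ, _, r', by simp, .upskill _ hS a l rfl hφ,
          Set.insert_subset hb hX, Set.insert_subset ha hA, .upskill hb rfl ha hφ hE⟩
      · obtain ⟨hb, l, a, φ, t, r', rfl, hS, ha, hφ, hX, hA, hE⟩ := hupdate hr hc
        replace hb := of_decide_eq_true hb
        exact ⟨.downskill l.toFinset hS a φ, _, r', by simp, .downskill _ hS a l rfl hφ,
          Set.insert_subset hb hX, Set.insert_subset ha hA, .downskill hb rfl ha hφ hE⟩
      · obtain ⟨hb, l, a, φ, t, r', rfl, hS, ha, hφ, hX, hA, hE⟩ := hupdate hr hc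
        replace hb := of_decide_eq_true hb
        exact ⟨.reskill l.toFinset hS a φ, _, r', by simp, .reskill _ hS a l rfl hφ,
          Set.insert_subset hb hX, Set.insert_subset ha hA, .reskill hb rfl ha hφ hE⟩
      · obtain ⟨hb, b, a, L, r₁, rfl, hb', ha, h⟩ := readLearn_inv hM hc
        replace hb := of_decide_eq_true hb
        obtain ⟨φ, t, r, rfl, hφ, hX, hA, hE⟩ :=
          ih r₁ (by simp at hr; omega) _ _ _ (hM.setSkills ha rfl) h
        exact ⟨.learn b a φ, _, r, by simp, .learn b a hφ, Set.insert_subset hb hX,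
          Set.insert_subset hb' (Set.insert_subset ha hA), .learn hb hb' ha hφ hE⟩
    · obtain ⟨φ, t, r, rfl, hφ, hX, hA, hE⟩ := ih _ hts' _ _ _ hM h
      exact ⟨.neg φ, _, r, by simp, .neg hφ, hX, hA, .neg hE⟩
    · obtain ⟨⟨a, r₁⟩, ha, h⟩ := h.ocase
      obtain ⟨hk, h₁⟩ := h.cond
      clear h
      rw [hM.known_iff] at hk
      obtain rfl := exactly_eq_some ha
      obtain ⟨φ, t, r, rfl, hφ, hX, hA, hE⟩ := ih r₁ (by simp at hts'; omega) _ _ _ hM h₁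
      have ha := hk a (by simp)
      exact ⟨.know a φ, _, r, by simp, .know a hφ, hX, Set.insert_subset ha hA, .know ha hφ hE⟩
    · obtain ⟨hb, l, φ, t, r', rfl, hG, ha, ha', hφ, hX, hA, hE⟩ := hgroup h
      replace hb := of_decide_eq_true hb
      exact ⟨.common l.toFinset hG φ, _, r', by simp, .common _ hG l rfl hφ,
        Set.insert_subset hb hX, Set.union_subset ha' hA, .common hb rfl ha hφ hE⟩
    · obtain ⟨hb, l, φ, t, r', rfl, hG, ha, ha', hφ, hX, hA, hE⟩ := hgroup h
      replace hb := of_decide_eq_true hb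
      exact ⟨.distributed l.toFinset hG φ, _, r', by simp, .distributed _ hG l rfl hφ,
        Set.insert_subset hb hX, Set.union_subset ha' hA, .distributed hb rfl ha hφ hE⟩
    · obtain ⟨hb, l, φ, t, r', rfl, hG, ha, ha', hφ, hX, hA, hE⟩ := hgroup h
      replace hb := of_decide_eq_true hb
      exact ⟨.mutual l.toFinset hG φ, _, r', by simp, .mutual _ hG l rfl hφ,
        Set.insert_subset hb hX, Set.union_subset ha' hA, .mutual hb rfl ha hφ hE⟩
    · obtain ⟨hb, l, φ, t, r', rfl, hG, ha, ha', hφ, hX, hA, hE⟩ := hgroup h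
      replace hb := of_decide_eq_true hb
      exact ⟨.field l.toFinset hG φ, _, r', by simp, .field _ hG l rfl hφ,
        Set.insert_subset hb hX, Set.union_subset ha' hA, .field hb rfl ha hφ hE⟩

/-- The algorithm accepts precisely the strings in the model checking problem. -/
theorem decideMC_iff (X : Set Op) (s : List Letter) :
    decideMC X s = true ↔ s ∈ modelChecking X := by
  constructor
  · intro h
    have hocase : ∀ {β : Type} {o : Option β} {f : β → Bool}, ocase o false f = true →
        ∃ x, o = some x ∧ f x = true := by
      intro β o f h
      cases o with
      | none => cases h
      | some x => exact ⟨x, rfl, h⟩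
    obtain ⟨⟨p, s₁⟩, hp, h⟩ := hocase h
    obtain ⟨⟨w, t⟩, hw, h⟩ := hocase h
    simp only [Bool.and_eq_true, List.any_eq_true, eqb_iff] at h
    obtain ⟨hval, ⟨_, hmem, rfl⟩, h⟩ := h
    obtain ⟨⟨m, env, fr, r⟩, hrun, h⟩ := hocase h
    obtain ⟨v, hv, h⟩ := hocase h
    dsimp only at hv hmem hval hrun
    subst hv
    simp only [Bool.and_eq_true, any_eqb, eqb_iff] at h
    obtain ⟨⟨rfl, hfr⟩, hwv⟩ := h
    obtain rfl : fr = [] := by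
      cases fr with
      | nil => rfl
      | cons => cases hfr
    obtain ⟨M, hM⟩ := exists_presents hval ⟨w, hmem⟩
    obtain ⟨φ, t, r, rfl, hφ, hX, hA, hE⟩ := parses_of_accepts t.length t le_rfl p.caps [] M
      (Presents.rep hM) ⟨_, _, _, _, hrun⟩
    obtain ⟨k, _, v', env', hv', hk⟩ := hE _ M (Presents.rep hM) []
    -- Both runs have reached a final state, so that they end in the same one.
    have he : some (some v', env', ([] : List Frame), r) = some (some v, env, [], []) := by
      have h₁ := congrArg ((step X p)^[sz (t ++ r)]) hk
      rw [← Function.iterate_add_apply, add_comm, Function.iterate_add_apply] at h₁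
      unfold run at hrun
      rw [hrun, Function.iterate_fixed (step_stop v env []),
        Function.iterate_fixed (step_stop v' env' r)] at h₁
      exact h₁.symm
    simp only [Option.some.injEq, Prod.mk.injEq, true_and] at he
    obtain ⟨rfl, rfl, rfl⟩ := he
    refine ⟨p, M, ⟨w, hmem⟩, φ, t, hM, hX, hA, hφ, ?_, (hv' ⟨w, hmem⟩).1 hwv⟩
    have h₁ := exactly_eq_some hp
    have h₂ := exactly_eq_some hw
    dsimp only at h₂
    rw [h₁, h₂]
    simp
  · rintro ⟨p, M, w, φ, t, hM, hX, hA, hφ, rfl, hsat⟩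
    have h₁ := reader_presentation.exactly_write p (r := nameStr w.1 ++ t) (by simp [nameStr])
    have h₂ := exactly_name hφ w.1 []
    have hE := runs_of_writes (r := []) hφ hX hA (by simp)
    obtain ⟨k, hk, v, env, hv, he⟩ := hE _ M (Presents.rep hM) []
    rw [List.append_nil] at h₂ he
    have hrun : run X p t = some (some v, env, [], []) := by
      have := length_le_sz t
      obtain ⟨j, hj⟩ := Nat.exists_eq_add_of_le' (show k ≤ sz t by omega)
      rw [run, hj, Function.iterate_add_apply, he,
        Function.iterate_fixed (step_stop v env [])]
    have hwv : w.1 ∈ v := (hv w).2 hsat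
    have hw := w.2
    rw [decideMC, List.append_assoc, h₁, ocase_some, h₂, ocase_some, hrun, ocase_some]
    simp only [ocase_some, valid_of_presents hM, lcase_nil, Bool.true_and, Bool.and_true,
      Bool.and_eq_true, any_eqb, eqb_iff]
    exact ⟨hw, trivial, hwv⟩

end

end EpistemicSkills.PolyTime

theorem mainTheorem2 (X : Set EpistemicSkills.Op) :
    EpistemicSkills.InP (EpistemicSkills.modelChecking X) :=
  EpistemicSkills.PolyTime.inP_of_ptime (EpistemicSkills.PolyTime.ptime_decideMC X)
    (EpistemicSkills.PolyTime.decideMC_iff X)
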